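/- Let $k$ be a field, write $\otimes=\otimes_k$, and let $B^e=B\otimes B^{op}$ for a $k$-algebra $B$, so that $B$-bimodules are left $B^e$-modules. **Differential graded coalgebra resolutions.** Let $P$ be a resolution $\cdots\to P_1\to P_0\to B\to 0$ of $B$ by projective $B$-bimodules with differential $\partial_P$ and augmentation $\mu_P:P_0\to B$, extended by $0$ to $P_i$, $i\ge 1$. Write $|p|=i$ for $p\in P_i$; the differential of $P\otimes_BP$ is $p\otimes p'\mapsto \partial p\otimes p'+(-1)^{|p|}p\otimes\partial p'$. $P$ is a *differential graded coalgebra resolution* $(P,\Delta_P,\mu_P)$ if it is given a chain map of bimodules $\Delta_P:P\to P\otimes_BP$ of degree $0$ that is coassociative, $(\Delta_P\otimes1)\Delta_P=(1\otimes\Delta_P)\Delta_P$, and counital, $(\mu_P\otimes1)\Delta_P=1_P=(1\otimes\mu_P)\Delta_P$, where $(\mu_P\otimes 1)(p\otimes p')=\mu_P(p)p'$ and $(1\otimes\mu_P)(p\otimes p')=p\,\mu_P(p')$. A *homotopy from $\mu_P\otimes1$ to $1\otimes\mu_P$* is a bimodule map $\phi_P:P\otimes_BP\to P$ of degree $1$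 with $\partial_P\phi_P+\phi_P\partial_{P\otimes_B P}=\mu_P\otimes1-1\otimes\mu_P$. **Data.** Let $G$ be a finite group acting on a $k$-algebra $S$ by algebra automorphisms, $s\mapsto{}^gs$, and let $A=S\rtimes G$ be the skew group algebra, with product $(sg)(s'g')=s({}^gs')gg'$. Let * $(C,\Delta_C,\mu_C)$ be a differential graded coalgebra resolution of $kG$ that is $G$-graded: $C_i=\bigoplus_{g\in G}(C_i)_g$ with $g_1(C_i)_{g_2}g_3=(C_i)_{g_1g_2g_3}$, and $\partial_C,\Delta_C,\mu_C$ preserve the $G$-grading (where $g$ has degree $g$ in $kG$, and $C_g\otimes C_h$ has degree $gh$ in $C\otimes_{kG}C$); * $(D,\Delta_D,\mu_D)$ be a differential graded coalgebra resolution of $S$ on which $G$ acts $k$-linearly, preserving each $D_i$, with $g(sds')=({}^gs)(gd)({}^gs')$, such that $\partial_D,\Delta_D,\mu_D$ are $G$-equivariant ($G$ acts diagonally on $D\otimes_SD$); * $\phi_C$ and $\phi_D$ be homotopies from $\mu_C\otimes1$ to $1\otimes\mu_C$ and from $\mu_D\otimes1$ to $1\otimes\mu_D$. **The twisted product resolution.**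 $X=C\otimes^GD$ is the complex with $X_n=\bigoplus_{i+j=n}C_i\otimes D_j$, differential $c\otimes d\mapsto\partial c\otimes d+(-1)^{|c|}c\otimes\partial d$, augmentation $c\otimes d\mapsto\mu_C(c)\mu_D(d)\in A$, and $A$-bimodule structure $$s'g'\cdot(c\otimes d)\cdot sg=g'cg\otimes({}^{(g'hg)^{-1}}s')\,\bigl(g^{-1}(ds)\bigr)\qquad(c\in C_h).$$ Let $\tau:C\otimes D\to D\otimes C$ be the bijection $\tau(c\otimes d)=(-1)^{|c||d|}(gd)\otimes c$ for $c\in C_g$; it induces a bijection $1\otimes\tau\otimes1:(C\otimes_{kG}C)\otimes(D\otimes_SD)\to X\otimes_AX$ with inverse $1\otimes\tau^{-1}\otimes1$. Put $\epsilon_C(c)=(-1)^{|c|}c$ and $$\Delta_X=(1\otimes\tau\otimes1)(\Delta_C\otimes\Delta_D):X\to X\otimes_AX,$$ $$\phi_X=\bigl(\phi_C\otimes(\mu_D\otimes1_D)+(1_C\otimes\mu_C)(\epsilon_C\otimes1)\otimes\phi_D\bigr)(1\otimes\tau^{-1}\otimes1):X\otimes_AX\to X.$$ Extend cochains in $\mathrm{Hom}_{A^e}(X_n,A)$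 to $X$ by $0$. For cochains $f$ and $f'$ of degrees $n$ and $m$ let $f\circ_Xf'$ be the composite $$X\xrightarrow{(1\otimes\Delta_X)\Delta_X}X\otimes_AX\otimes_AX\xrightarrow{1\otimes f'\otimes1}X\otimes_AX\xrightarrow{\phi_X}X\xrightarrow{f}A,$$ where $(1\otimes f'\otimes1)(x\otimes y\otimes z)=(-1)^{|x|m}x\otimes f'(y)z$, and put $[f,f']_X=f\circ_Xf'-(-1)^{(n-1)(m-1)}f'\circ_Xf$. **Hochschild cohomology and the bracket.** A Hochschild $n$-cochain is a $k$-multilinear map $F:A^n\to A$, i.e. an element of $\mathrm{Hom}_{A^e}(A\otimes A^{\otimes n}\otimes A,A)$ on the bar resolution of $A$. The Gerstenhaber bracket of Hochschild cochains of degrees $n,m$ is $[F,F']=F\circ F'-(-1)^{(n-1)(m-1)}F'\circ F$ with $$(F\circ F')(a_1,\dots,a_{n+m-1})=\sum_{i=1}^n(-1)^{(m-1)(i-1)}F\bigl(a_1,\dots,a_{i-1},F'(a_i,\dots,a_{i+m-1}),a_{i+m},\dots,a_{n+m-1}\bigr).$$ A *comparison map* $\theta$ is a chain map of $A$-bimodules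 from the bar resolution of $A$ to $X$ lifting $1_A$. A cocycle $f\in\mathrm{Hom}_{A^e}(X_n,A)$ and a Hochschild cochain $F$ *represent the same class* (via $\theta$) if $F-f\theta_n$ is a Hochschild coboundary. **Theorem.** 1. A comparison map from the bar resolution of $A$ to $X$ exists. 2. If $\phi_C$ preserves the $G$-grading and $\phi_D$ is $G$-equivariant, then $\phi_X$ is a homomorphism of $A$-bimodules. 3. Suppose that $\phi_X$ is a homomorphism of $A$-bimodules. Let $f\in\mathrm{Hom}_{A^e}(X_n,A)$ and $f'\in\mathrm{Hom}_{A^e}(X_m,A)$ be cocycles with $n+m\ge1$. Then $[f,f']_X$ is a cocycle in $\mathrm{Hom}_{A^e}(X_{n+m-1},A)$, and it represents the Gerstenhaber bracket of the classes of $f$ and $f'$: if the Hochschild cochains $F$ and $F'$ represent the same classes as $f$ and $f'$, each via some comparison map, then $[F,F']$ represents the same class as $[f,f']_X$, via every comparison map. -/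

import Mathlib

open scoped TensorProduct

noncomputable section

/-! ### Bimodules and tensor products over a noncommutative algebra -/

/-- The enveloping algebra `Aᵉ = A ⊗ Aᵒᵖ`. An `A`-bimodule (over `k`) is a module over `Env k A`. -/
abbrev Env (k A : Type*) [Field k] [Ring A] [Algebra k A] : Type _ := A ⊗[k] Aᵐᵒᵖ

/-- A shortcut instance. -/
instance (k A M : Type*) [Field k] [Ring A] [Algebra k A] [AddCommGroup M] [Module (Env k A) M] :
    SMul (Env k A) M := inferInstance

section Bimodule

variable (k : Type*) [Field k] (A : Type*) [Ring A] [Algebra k A]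
variable (M : Type*) [AddCommGroup M] [Module k M] [Module (Env k A) M]
  [IsScalarTower k (Env k A) M]

/-- The left action of `A` on a bimodule: `lAct k A M a m = a · m`. -/
def lAct : A →ₐ[k] Module.End k M :=
  (Algebra.lsmul k k M).comp
    (Algebra.TensorProduct.includeLeft : A →ₐ[k] Env k A)

/-- The right action of `A` on a bimodule: `rAct k A M (op a) m = m · a`. -/
def rAct : Aᵐᵒᵖ →ₐ[k] Module.End k M :=
  (Algebra.lsmul k k M).comp
    (Algebra.TensorProduct.includeRight : Aᵐᵒᵖ →ₐ[k] Env k A)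

variable {k A M}

theorem lAct_apply (a : A) (m : M) : lAct k A M a m = (a ⊗ₜ[k] (1 : Aᵐᵒᵖ) : Env k A) • m := rfl

theorem rAct_apply (b : Aᵐᵒᵖ) (m : M) : rAct k A M b m = ((1 : A) ⊗ₜ[k] b : Env k A) • m := rfl

theorem tmul_smul_eq (a : A) (b : Aᵐᵒᵖ) (m : M) :
    (a ⊗ₜ[k] b : Env k A) • m = lAct k A M a (rAct k A M b m) := by
  rw [lAct_apply, rAct_apply, smul_smul]; simp

theorem lAct_rAct (a : A) (b : Aᵐᵒᵖ) (m : M) :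
    lAct k A M a (rAct k A M b m) = rAct k A M b (lAct k A M a m) := by
  rw [lAct_apply, rAct_apply, rAct_apply, lAct_apply, smul_smul, smul_smul]; simp

variable {N : Type*} [AddCommGroup N] [Module k N] [Module (Env k A) N]
  [IsScalarTower k (Env k A) N]

theorem map_lAct (f : M →ₗ[Env k A] N) (a : A) (m : M) :
    f (lAct k A M a m) = lAct k A N a (f m) := by
  rw [lAct_apply, lAct_apply, map_smul]

theorem map_rAct (f : M →ₗ[Env k A] N) (b : Aᵐᵒᵖ) (m : M) :
    f (rAct k A M b m) = rAct k A N b (f m) := by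
  rw [rAct_apply, rAct_apply, map_smul]

/-- A `k`-linear map commuting with both actions is a bimodule map. -/
def bimodHom (f : M →ₗ[k] N) (hl : ∀ a m, f (lAct k A M a m) = lAct k A N a (f m))
    (hr : ∀ b m, f (rAct k A M b m) = rAct k A N b (f m)) : M →ₗ[Env k A] N where
  toFun := f
  map_add' := map_add f
  map_smul' e m := LinearMap.congr_fun (TensorProduct.ext'
    (g := f.comp ((Algebra.lsmul k k M).toLinearMap.flip m))
    (h := (Algebra.lsmul k k N).toLinearMap.flip (f m)) fun a b => by
      change f ((a ⊗ₜ[k] b : Env k A) • m) = (a ⊗ₜ[k] b : Env k A) • f m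
      rw [tmul_smul_eq, tmul_smul_eq, hl, hr]) e

@[simp] theorem bimodHom_apply (f : M →ₗ[k] N) (hl) (hr) (m : M) :
    bimodHom (A := A) f hl hr m = f m := rfl


end Bimodule


/-- The bimodule structure given by a pair of commuting left and right actions. -/
abbrev bimodOfActions {k : Type*} [Field k] {A : Type*} [Ring A] [Algebra k A]
    {M : Type*} [AddCommGroup M] [Module k M] (L : A →ₐ[k] Module.End k M)
    (R : Aᵐᵒᵖ →ₐ[k] Module.End k M) (h : ∀ a b, Commute (L a) (R b)) : Module (Env k A) M :=
  Module.compHom M (Algebra.TensorProduct.lift L R h).toRingHom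

section

variable {k : Type*} [Field k] {A : Type*} [Ring A] [Algebra k A]
  {M : Type*} [AddCommGroup M] [Module k M] (L : A →ₐ[k] Module.End k M)
  (R : Aᵐᵒᵖ →ₐ[k] Module.End k M) (h : ∀ a b, Commute (L a) (R b))

theorem bimodOfActions_tower :
    letI := bimodOfActions L R h
    IsScalarTower k (Env k A) M :=
  letI := bimodOfActions L R h
  ⟨fun r e z => LinearMap.congr_fun (map_smul (Algebra.TensorProduct.lift L R h) r e) z⟩

theorem bimodOfActions_tmul (a : A) (b : Aᵐᵒᵖ) (m : M) :
    letI := bimodOfActions L R h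
    (a ⊗ₜ[k] b : Env k A) • m = L a (R b m) := by
  change Algebra.TensorProduct.lift L R h (a ⊗ₜ b) m = _
  rw [Algebra.TensorProduct.lift_tmul]; rfl

end

/-- `A` is a bimodule over itself: `(a ⊗ b) • x = a * x * b`. -/
instance envModuleSelf (k A : Type*) [Field k] [Ring A] [Algebra k A] : Module (Env k A) A :=
  instModuleTensorProductMop k A

section Balanced

variable (k : Type*) [Field k] (A : Type*) [Ring A] [Algebra k A]

theorem envSelf_tmul_smul (a : A) (b : Aᵐᵒᵖ) (x : A) :
    (a ⊗ₜ[k] b : Env k A) • x = a * x * b.unop := by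
  change a * (x * b.unop) = _
  rw [mul_assoc]

instance : IsScalarTower k (Env k A) A where
  smul_assoc r e x :=
    LinearMap.congr_fun (map_smul (AlgHom.mulLeftRight k A) r e) x

theorem lAct_self (a x : A) : lAct k A A a x = a * x := by
  rw [lAct_apply, envSelf_tmul_smul]; simp

theorem rAct_self (b : Aᵐᵒᵖ) (x : A) : rAct k A A b x = x * b.unop := by
  rw [rAct_apply, envSelf_tmul_smul]; simp

variable (M : Type*) [AddCommGroup M] [Module k M] [Module (Env k A) M]
  [IsScalarTower k (Env k A) M]
variable (N : Type*) [AddCommGroup N] [Module k N] [Module (Env k A) N]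
  [IsScalarTower k (Env k A) N]

/-- The `k`-subspace of `M ⊗ N` spanned by all `(m · a) ⊗ n - m ⊗ (a · n)`. -/
def balancedRel : Submodule k (M ⊗[k] N) :=
  Submodule.span k {z | ∃ (m : M) (a : A) (n : N),
    z = rAct k A M (MulOpposite.op a) m ⊗ₜ[k] n - m ⊗ₜ[k] lAct k A N a n}

/-- The tensor product `M ⊗_A N` of two bimodules over the (noncommutative) algebra `A`. -/
def BTensor : Type _ := (M ⊗[k] N) ⧸ balancedRel k A M N

instance : AddCommGroup (BTensor k A M N) :=
  inferInstanceAs (AddCommGroup ((M ⊗[k] N) ⧸ balancedRel k A M N))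

instance : Module k (BTensor k A M N) :=
  inferInstanceAs (Module k ((M ⊗[k] N) ⧸ balancedRel k A M N))

/-- The canonical projection `M ⊗ N → M ⊗_A N`. -/
def BTensor.proj : M ⊗[k] N →ₗ[k] BTensor k A M N := (balancedRel k A M N).mkQ

variable {M N}

/-- The element `m ⊗_A n`. -/
def BTensor.tmul (m : M) (n : N) : BTensor k A M N := BTensor.proj k A M N (m ⊗ₜ[k] n)

theorem BTensor.tmul_eq (m : M) (n : N) :
    BTensor.proj k A M N (m ⊗ₜ[k] n) = BTensor.tmul k A m n := rfl

theorem BTensor.balanced (m : M) (b : Aᵐᵒᵖ) (n : N) :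
    BTensor.tmul k A (rAct k A M b m) n = BTensor.tmul k A m (lAct k A N b.unop n) :=
  (Submodule.Quotient.eq _).2 (Submodule.subset_span ⟨m, b.unop, n, rfl⟩)

variable {k A}
variable {Q : Type*} [AddCommGroup Q] [Module k Q]

/-- `k`-linear maps out of `M ⊗_A N` from balanced `k`-bilinear maps. -/
def BTensor.lift (f : M →ₗ[k] N →ₗ[k] Q)
    (h : ∀ m a n, f (rAct k A M (MulOpposite.op a) m) n = f m (lAct k A N a n)) :
    BTensor k A M N →ₗ[k] Q :=
  (balancedRel k A M N).liftQ (TensorProduct.lift f) (by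
    refine Submodule.span_le.2 ?_
    rintro _ ⟨m, a, n, rfl⟩
    simp [h])

@[simp] theorem BTensor.lift_tmul (f : M →ₗ[k] N →ₗ[k] Q) (h) (m : M) (n : N) :
    BTensor.lift (A := A) f h (BTensor.tmul k A m n) = f m n := rfl

theorem BTensor.hom_ext {f g : BTensor k A M N →ₗ[k] Q}
    (h : ∀ m n, f (BTensor.tmul k A m n) = g (BTensor.tmul k A m n)) : f = g :=
  Submodule.linearMap_qext _ (TensorProduct.ext' h)

theorem BTensor.induction {p : BTensor k A M N → Prop} (z : BTensor k A M N)
    (h0 : p 0) (h1 : ∀ m n, p (BTensor.tmul k A m n)) (h2 : ∀ x y, p x → p y → p (x + y)) :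
    p z := by
  obtain ⟨t, rfl⟩ := Submodule.mkQ_surjective _ z
  induction t using TensorProduct.induction_on with
  | zero => rw [map_zero]; exact h0
  | tmul m n => exact h1 m n
  | add x y hx hy => rw [map_add]; exact h2 _ _ hx hy

variable (k A M N) in
/-- The bilinear map `(m, n) ↦ m ⊗_A n`. -/
def BTensor.mk : M →ₗ[k] N →ₗ[k] BTensor k A M N :=
  (TensorProduct.mk k M N).compr₂ (BTensor.proj k A M N)

@[simp] theorem BTensor.mk_apply (m : M) (n : N) :
    BTensor.mk k A M N m n = BTensor.tmul k A m n := rfl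

variable (k A M N) in
/-- The left action on `M ⊗_A N`: `a · (m ⊗ n) = (a · m) ⊗ n`. -/
def BTensor.left : A →ₐ[k] Module.End k (BTensor k A M N) where
  toFun a := BTensor.lift ((BTensor.mk k A M N).comp (lAct k A M a)) fun m c n => by
    simp only [LinearMap.comp_apply, BTensor.mk_apply, lAct_rAct, BTensor.balanced,
      MulOpposite.unop_op]
  map_one' := BTensor.hom_ext fun m n => by
    change BTensor.tmul k A (lAct k A M 1 m) n = BTensor.tmul k A m n
    rw [map_one]; rfl
  map_mul' a b := BTensor.hom_ext fun m n => by
    change BTensor.tmul k A (lAct k A M (a * b) m) n =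
      BTensor.tmul k A (lAct k A M a (lAct k A M b m)) n
    rw [map_mul]; rfl
  map_zero' := BTensor.hom_ext fun m n => by
    change BTensor.mk k A M N (lAct k A M 0 m) n = 0
    rw [map_zero, LinearMap.zero_apply, map_zero, LinearMap.zero_apply]
  map_add' a b := BTensor.hom_ext fun m n => by
    change BTensor.mk k A M N (lAct k A M (a + b) m) n =
      BTensor.mk k A M N (lAct k A M a m) n + BTensor.mk k A M N (lAct k A M b m) n
    rw [map_add, LinearMap.add_apply, map_add, LinearMap.add_apply]
  commutes' r := BTensor.hom_ext fun m n => by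
    change BTensor.mk k A M N (lAct k A M (algebraMap k A r) m) n = r • BTensor.mk k A M N m n
    rw [AlgHom.commutes, Module.algebraMap_end_apply, map_smul, LinearMap.smul_apply]

variable (k A M N) in
/-- The right action on `M ⊗_A N`: `(m ⊗ n) · b = m ⊗ (n · b)`. -/
def BTensor.right : Aᵐᵒᵖ →ₐ[k] Module.End k (BTensor k A M N) where
  toFun b := BTensor.lift ((BTensor.mk k A M N).compl₂ (rAct k A N b)) fun m c n => by
    simp only [LinearMap.compl₂_apply, BTensor.mk_apply, ← lAct_rAct, BTensor.balanced,
      MulOpposite.unop_op]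
  map_one' := BTensor.hom_ext fun m n => by
    change BTensor.tmul k A m (rAct k A N 1 n) = BTensor.tmul k A m n
    rw [map_one]; rfl
  map_mul' a b := BTensor.hom_ext fun m n => by
    change BTensor.tmul k A m (rAct k A N (a * b) n) =
      BTensor.tmul k A m (rAct k A N a (rAct k A N b n))
    rw [map_mul]; rfl
  map_zero' := BTensor.hom_ext fun m n => by
    change BTensor.mk k A M N m (rAct k A N 0 n) = 0
    rw [map_zero, LinearMap.zero_apply, map_zero]
  map_add' a b := BTensor.hom_ext fun m n => by
    change BTensor.mk k A M N m (rAct k A N (a + b) n) =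
      BTensor.mk k A M N m (rAct k A N a n) + BTensor.mk k A M N m (rAct k A N b n)
    rw [map_add, LinearMap.add_apply, map_add]
  commutes' r := BTensor.hom_ext fun m n => by
    change BTensor.mk k A M N m (rAct k A N (algebraMap k Aᵐᵒᵖ r) n) = r • BTensor.mk k A M N m n
    rw [AlgHom.commutes, Module.algebraMap_end_apply, map_smul]

theorem BTensor.left_tmul (a : A) (m : M) (n : N) :
    BTensor.left k A M N a (BTensor.tmul k A m n) = BTensor.tmul k A (lAct k A M a m) n := rfl

theorem BTensor.right_tmul (b : Aᵐᵒᵖ) (m : M) (n : N) :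
    BTensor.right k A M N b (BTensor.tmul k A m n) = BTensor.tmul k A m (rAct k A N b n) := rfl

theorem BTensor.left_right (a : A) (b : Aᵐᵒᵖ) :
    Commute (BTensor.left k A M N a) (BTensor.right k A M N b) :=
  BTensor.hom_ext fun m n => by
    rw [Module.End.mul_apply, Module.End.mul_apply, BTensor.left_tmul, BTensor.right_tmul,
      BTensor.right_tmul, BTensor.left_tmul]

instance : Module (Env k A) (BTensor k A M N) :=
  bimodOfActions (BTensor.left k A M N) (BTensor.right k A M N) BTensor.left_right

instance : IsScalarTower k (Env k A) (BTensor k A M N) :=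
  bimodOfActions_tower _ _ _

@[simp] theorem BTensor.lAct_tmul (a : A) (m : M) (n : N) :
    lAct k A (BTensor k A M N) a (BTensor.tmul k A m n) =
      BTensor.tmul k A (lAct k A M a m) n :=
  (bimodOfActions_tmul _ _ BTensor.left_right a 1 _).trans (by rw [map_one, Module.End.one_apply, BTensor.left_tmul])

@[simp] theorem BTensor.rAct_tmul (b : Aᵐᵒᵖ) (m : M) (n : N) :
    rAct k A (BTensor k A M N) b (BTensor.tmul k A m n) =
      BTensor.tmul k A m (rAct k A N b n) :=
  (bimodOfActions_tmul _ _ BTensor.left_right 1 b _).trans (by rw [map_one, Module.End.one_apply, BTensor.right_tmul])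

variable {M' : Type*} [AddCommGroup M'] [Module k M'] [Module (Env k A) M']
  [IsScalarTower k (Env k A) M']
variable {N' : Type*} [AddCommGroup N'] [Module k N'] [Module (Env k A) N']
  [IsScalarTower k (Env k A) N']

/-- `f ⊗ g : M ⊗_A N → M' ⊗_A N'` for bimodule maps `f` and `g` (no sign). -/
def BTensor.map (f : M →ₗ[Env k A] M') (g : N →ₗ[Env k A] N') :
    BTensor k A M N →ₗ[Env k A] BTensor k A M' N' :=
  bimodHom
    (BTensor.lift ((BTensor.mk k A M' N').compl₁₂ (f.restrictScalars k) (g.restrictScalars k))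
      fun m a n => by simp [map_rAct, map_lAct, BTensor.balanced])
    (fun a z => by
      induction z using BTensor.induction with
      | h0 => simp
      | h1 m n => simp [map_lAct]
      | h2 x y hx hy => simp only [map_add, hx, hy])
    (fun b z => by
      induction z using BTensor.induction with
      | h0 => simp
      | h1 m n => simp [map_rAct]
      | h2 x y hx hy => simp only [map_add, hx, hy])

@[simp] theorem BTensor.map_tmul (f : M →ₗ[Env k A] M') (g : N →ₗ[Env k A] N') (m : M) (n : N) :
    BTensor.map f g (BTensor.tmul k A m n) = BTensor.tmul k A (f m) (g n) := rfl

/-- `f ⊗ 1 : M ⊗_A N → N`, `m ⊗ n ↦ f m · n`, for a bimodule map `f : M → A`. -/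
def BTensor.evalLeft (f : M →ₗ[Env k A] A) : BTensor k A M N →ₗ[Env k A] N :=
  bimodHom
    (BTensor.lift ((lAct k A N).toLinearMap.comp (f.restrictScalars k)) fun m a n => by
      change lAct k A N (f (rAct k A M _ m)) n = lAct k A N (f m) (lAct k A N a n)
      rw [map_rAct, rAct_self, map_mul]; rfl)
    (fun a z => by
      induction z using BTensor.induction with
      | h0 => simp
      | h1 m n =>
        rw [BTensor.lAct_tmul]
        change lAct k A N (f (lAct k A M a m)) n = lAct k A N a (lAct k A N (f m) n)
        rw [map_lAct, lAct_self, map_mul]; rfl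
      | h2 x y hx hy => simp only [map_add, hx, hy])
    (fun b z => by
      induction z using BTensor.induction with
      | h0 => simp
      | h1 m n =>
        rw [BTensor.rAct_tmul]
        exact lAct_rAct _ _ _
      | h2 x y hx hy => simp only [map_add, hx, hy])

@[simp] theorem BTensor.evalLeft_tmul (f : M →ₗ[Env k A] A) (m : M) (n : N) :
    BTensor.evalLeft f (BTensor.tmul k A m n) = lAct k A N (f m) n := rfl

/-- `1 ⊗ f : M ⊗_A N → M`, `m ⊗ n ↦ m · f n`, for a bimodule map `f : N → A`. -/
def BTensor.evalRight (f : N →ₗ[Env k A] A) : BTensor k A M N →ₗ[Env k A] M :=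
  bimodHom
    (BTensor.lift (((rAct k A M).toLinearMap.comp
        ((MulOpposite.opLinearEquiv k).toLinearMap.comp (f.restrictScalars k))).flip)
      fun m a n => by
        change rAct k A M (MulOpposite.op (f n)) (rAct k A M (MulOpposite.op a) m) =
          rAct k A M (MulOpposite.op (f (lAct k A N a n))) m
        rw [map_lAct, lAct_self, MulOpposite.op_mul, map_mul]; rfl)
    (fun a z => by
      induction z using BTensor.induction with
      | h0 => simp
      | h1 m n =>
        rw [BTensor.lAct_tmul]
        exact (lAct_rAct _ _ _).symm
      | h2 x y hx hy => simp only [map_add, hx, hy])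
    (fun b z => by
      induction z using BTensor.induction with
      | h0 => simp
      | h1 m n =>
        rw [BTensor.rAct_tmul]
        change rAct k A M (MulOpposite.op (f (rAct k A N b n))) m =
          rAct k A M b (rAct k A M (MulOpposite.op (f n)) m)
        rw [map_rAct, rAct_self, MulOpposite.op_mul, map_mul]; rfl
      | h2 x y hx hy => simp only [map_add, hx, hy])

@[simp] theorem BTensor.evalRight_tmul (f : N →ₗ[Env k A] A) (m : M) (n : N) :
    BTensor.evalRight f (BTensor.tmul k A m n) = rAct k A M (MulOpposite.op (f n)) m := rfl

variable (k A M N) in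
/-- The associativity map `(M ⊗_A N) ⊗_A P → M ⊗_A (N ⊗_A P)`. -/
def BTensor.assoc (P : Type*) [AddCommGroup P] [Module k P] [Module (Env k A) P]
    [IsScalarTower k (Env k A) P] :
    BTensor k A (BTensor k A M N) P →ₗ[k] BTensor k A M (BTensor k A N P) :=
  BTensor.lift
    (BTensor.lift
      (LinearMap.mk₂ k
        (fun m n => ((BTensor.mk k A M (BTensor k A N P)) m).comp (BTensor.mk k A N P n))
        (fun m m' n => by ext p; simp only [map_add, LinearMap.comp_apply, LinearMap.add_apply])
        (fun r m n => by ext p; simp only [map_smul, LinearMap.comp_apply, LinearMap.smul_apply])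
        (fun m n n' => by ext p; simp only [map_add, LinearMap.comp_apply, LinearMap.add_apply])
        (fun r m n => by ext p; simp only [map_smul, LinearMap.comp_apply, LinearMap.smul_apply]))
      fun m a n => by ext p; simp [BTensor.balanced])
    fun z a p => by
      induction z using BTensor.induction with
      | h0 => simp
      | h1 m n => simp [BTensor.balanced]
      | h2 x y hx hy => simp only [map_add, LinearMap.add_apply, hx, hy]

@[simp] theorem BTensor.assoc_tmul {P : Type*} [AddCommGroup P] [Module k P] [Module (Env k A) P]
    [IsScalarTower k (Env k A) P] (m : M) (n : N) (p : P) :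
    BTensor.assoc k A M N P (BTensor.tmul k A (BTensor.tmul k A m n) p) =
      BTensor.tmul k A m (BTensor.tmul k A n p) := rfl

variable (k A) in
/-- Given families `U`, `V` of subspaces of `M`, `N` indexed by `ι` and an operation on `ι`, the
span of all `m ⊗ n` with `m ∈ U i`, `n ∈ V j`, `op i j = s`: the degree `s` part of `M ⊗_A N`. -/
def BTensor.degree {ι : Type*} (op : ι → ι → ι) (U : ι → Set M) (V : ι → Set N) (s : ι) :
    Submodule k (BTensor k A M N) :=
  Submodule.span k {z | ∃ i j m n, m ∈ U i ∧ n ∈ V j ∧ op i j = s ∧ z = BTensor.tmul k A m n}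

end Balanced


/-! ### Graded modules -/

section Graded

variable (k : Type*) [Field k] {R : Type*} [Ring R] [Algebra k R]
  {M : Type*} [AddCommGroup M] [Module k M] [Module R M] [IsScalarTower k R M]
  {N : Type*} [AddCommGroup N] [Module k N]
  {ι : Type*} [DecidableEq ι] (U : ι → Submodule R M) [DirectSum.Decomposition U]

/-- The `k`-linear map `M = ⨁ U i → N` that is equal to `F i` on the component `U i`. -/
def gradedMap (F : ι → M →ₗ[k] N) : M →ₗ[k] N :=
  (DirectSum.toModule k ι N fun i => (F i).comp ((U i).subtype.restrictScalars k)).comp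
    ((DirectSum.decomposeLinearEquiv U).toLinearMap.restrictScalars k)

variable {k U}

theorem gradedMap_of_mem (F : ι → M →ₗ[k] N) {i : ι} {m : M} (hm : m ∈ U i) :
    gradedMap k U F m = F i m := by
  change DirectSum.toModule k ι N _ (DirectSum.decompose U m) = _
  rw [DirectSum.decompose_of_mem U hm]
  exact DirectSum.toModule_lof (M := fun j => U j) k i ⟨m, hm⟩

variable (U) in
theorem graded_hom_ext {f g : M →ₗ[k] N} (h : ∀ i, ∀ m ∈ U i, f m = g m) : f = g := by
  ext m
  induction m using DirectSum.Decomposition.inductionOn U with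
  | zero => rw [map_zero, map_zero]
  | homogeneous m => exact h _ m m.2
  | add m m' hm hm' => rw [map_add, map_add, hm, hm']

end Graded

/-! ### Differential graded coalgebra resolutions -/

section Resolution

variable (k : Type*) [Field k] (A : Type*) [Ring A] [Algebra k A]
variable (P : Type*) [AddCommGroup P] [Module k P] [Module (Env k A) P]
  [IsScalarTower k (Env k A) P]

/-- A projective resolution `… → P₂ → P₁ → P₀ → A → 0` of `A` by `A`-bimodules. `P` is the total
bimodule `⨁ Pₙ`, and `gr n` is the sub-bimodule `Pₙ`. -/
structure BimodResolution where
  /-- The component `Pₙ`. -/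
  gr : ℕ → Submodule (Env k A) P
  [dec : DirectSum.Decomposition gr]
  /-- The differential. -/
  d : P →ₗ[Env k A] P
  /-- The augmentation, extended by zero to `Pₙ` for `n ≥ 1`. -/
  aug : P →ₗ[Env k A] A
  projective : ∀ n, Module.Projective (Env k A) (gr n)
  d_mem : ∀ n, ∀ x ∈ gr (n + 1), d x ∈ gr n
  d_zero : ∀ x ∈ gr 0, d x = 0
  d_d : ∀ x, d (d x) = 0
  aug_pos : ∀ n, ∀ x ∈ gr (n + 1), aug x = 0
  aug_d : ∀ x, aug (d x) = 0
  aug_surjective : Function.Surjective aug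
  exact_zero : ∀ x ∈ gr 0, aug x = 0 → ∃ y ∈ gr 1, d y = x
  exact_succ : ∀ n, ∀ x ∈ gr (n + 1), d x = 0 → ∃ y ∈ gr (n + 2), d y = x

attribute [instance] BimodResolution.dec

variable {k A P}

/-- The sign map `ε` of a resolution: `x ↦ (-1)^|x| x` for homogeneous `x`. -/
def BimodResolution.sgn (R : BimodResolution k A P) : P →ₗ[Env k A] P :=
  bimodHom (gradedMap k R.gr fun n => (-1 : k) ^ n • LinearMap.id)
    (fun a => LinearMap.congr_fun (f := (gradedMap k R.gr _).comp (lAct k A P a))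
      (g := (lAct k A P a).comp (gradedMap k R.gr _)) (graded_hom_ext R.gr fun n m hm => by
        have h : lAct k A P a m ∈ R.gr n := (R.gr n).smul_mem _ hm
        rw [LinearMap.comp_apply, LinearMap.comp_apply, gradedMap_of_mem _ h,
          gradedMap_of_mem _ hm]
        simp))
    (fun a => LinearMap.congr_fun (f := (gradedMap k R.gr _).comp (rAct k A P a))
      (g := (rAct k A P a).comp (gradedMap k R.gr _)) (graded_hom_ext R.gr fun n m hm => by
        have h : rAct k A P a m ∈ R.gr n := (R.gr n).smul_mem _ hm
        rw [LinearMap.comp_apply, LinearMap.comp_apply, gradedMap_of_mem _ h,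
          gradedMap_of_mem _ hm]
        simp))

theorem BimodResolution.sgn_of_mem (R : BimodResolution k A P) {n : ℕ} {x : P}
    (hx : x ∈ R.gr n) : R.sgn x = (-1 : k) ^ n • x := by
  change gradedMap k R.gr _ x = _
  rw [gradedMap_of_mem _ hx]; rfl

/-- The differential `∂ ⊗ 1 + ε ⊗ ∂` of `P ⊗_A P`, i.e. `x ⊗ y ↦ ∂x ⊗ y + (-1)^|x| x ⊗ ∂y`. -/
def BimodResolution.dTensor (R : BimodResolution k A P) :
    BTensor k A P P →ₗ[Env k A] BTensor k A P P :=
  BTensor.map R.d LinearMap.id + BTensor.map R.sgn R.d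

/-- The degree `n` part of `P ⊗_A P`. -/
def BimodResolution.grTensor (R : BimodResolution k A P) (n : ℕ) :
    Submodule k (BTensor k A P P) :=
  BTensor.degree k A (· + ·) (fun i => (R.gr i : Set P)) (fun j => (R.gr j : Set P)) n

variable (k A P) in
/-- A projective bimodule resolution that is a differential graded coalgebra: it has a diagonal
map `Δ : P → P ⊗_A P`, a chain map of degree `0` that is coassociative and counital. (`Δ` lifts
the isomorphism `A ≅ A ⊗_A A`, since `counit_left` gives `(aug ⊗ aug) ∘ Δ = aug`.) -/
structure DGCoalgResolution extends BimodResolution k A P where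
  /-- The diagonal map. -/
  Δ : P →ₗ[Env k A] BTensor k A P P
  Δ_degree : ∀ n, ∀ x ∈ gr n, Δ x ∈ toBimodResolution.grTensor n
  Δ_d : ∀ x, Δ (d x) = toBimodResolution.dTensor (Δ x)
  coassoc : ∀ x, BTensor.assoc k A P P P (BTensor.map Δ LinearMap.id (Δ x)) =
    BTensor.map LinearMap.id Δ (Δ x)
  counit_left : ∀ x, BTensor.evalLeft aug (Δ x) = x
  counit_right : ∀ x, BTensor.evalRight aug (Δ x) = x

/-- `φ : P ⊗_A P → P` is a chain homotopy of bimodule complexes from `aug ⊗ 1` to `1 ⊗ aug`. -/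
structure IsCounitHomotopy (R : BimodResolution k A P) (φ : BTensor k A P P →ₗ[Env k A] P) :
    Prop where
  degree : ∀ n, ∀ z ∈ R.grTensor n, φ z ∈ R.gr (n + 1)
  homotopy : ∀ z, R.d (φ z) + φ (R.dTensor z) =
    BTensor.evalLeft R.aug z - BTensor.evalRight R.aug z

end Resolution

/-! ### Hochschild cochains and the Gerstenhaber bracket -/

section Hochschild

variable (k : Type*) [Field k] (A : Type*) [Ring A] [Algebra k A]

/-- The Hochschild differential of `t : Aⁿ → M`, where `M` is an `A`-bimodule:
`a₁ t(a₂, …, aₙ₊₁) + ∑ᵢ (-1)ⁱ t(…, aᵢ aᵢ₊₁, …) + (-1)ⁿ⁺¹ t(a₁, …, aₙ) aₙ₊₁`.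
A multilinear map `t` is the same as a bimodule map `T : A ⊗ A^{⊗ n} ⊗ A → M` on the `n`th term of
the bar resolution, `T (a₀ ⊗ … ⊗ aₙ₊₁) = a₀ t(a₁, …, aₙ) aₙ₊₁`, and `hochD t` corresponds to the
composite of `T` with the differential of the bar resolution. -/
def hochD {M : Type*} [AddCommGroup M] [Module k M] [Module (Env k A) M]
    [IsScalarTower k (Env k A) M] {n : ℕ} (t : (Fin n → A) → M) (a : Fin (n + 1) → A) : M :=
  lAct k A M (a 0) (t (Fin.tail a)) +
    ∑ i : Fin n, (-1 : k) ^ ((i : ℕ) + 1) • t (Fin.contractNth i.castSucc (· * ·) a) +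
    (-1 : k) ^ (n + 1) • rAct k A M (MulOpposite.op (a (Fin.last n))) (t (Fin.init a))

/-- `F : Aⁿ → A` is a Hochschild coboundary. -/
def IsHochCoboundary : (n : ℕ) → ((Fin n → A) → A) → Prop
  | 0, F => F = 0
  | n + 1, F => ∃ H : MultilinearMap k (fun _ : Fin n => A) A, F = hochD k A H

variable {A}

/-- The circle product of `f : Aⁿ → A` and `f' : Aᵐ → A`, where `l = n + m - 1`:
`∑ᵢ (-1)^((m-1)(i-1)) f(a₁, …, aᵢ₋₁, f'(aᵢ, …, aᵢ₊ₘ₋₁), aᵢ₊ₘ, …, aₗ)`, `1 ≤ i ≤ n`.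
(Here `i` starts at `0`, and `m + 1` replaces `m - 1` in the exponent, which has the same parity.) -/
def circ {n m l : ℕ} (h : n + m = l + 1) (f : (Fin n → A) → A) (f' : (Fin m → A) → A)
    (a : Fin l → A) : A :=
  ∑ i : Fin n, (-1 : k) ^ ((m + 1) * (i : ℕ)) • f fun j : Fin n =>
    if hj : (j : ℕ) < i then a ⟨j, by omega⟩
    else if hj' : (j : ℕ) = i then f' fun s : Fin m => a ⟨(i : ℕ) + s, by omega⟩
    else a ⟨(j : ℕ) + m - 1, by omega⟩

/-- The Gerstenhaber bracket `f ∘ f' - (-1)^((n-1)(m-1)) f' ∘ f` of Hochschild cochains. -/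
def gerstenhaberBracket {n m l : ℕ} (h : n + m = l + 1) (f : (Fin n → A) → A)
    (f' : (Fin m → A) → A) (a : Fin l → A) : A :=
  circ k h f f' a - (-1 : k) ^ ((n + 1) * (m + 1)) • circ k ((add_comm m n).trans h) f' f a

end Hochschild


/-! ### Group gradings, group actions and twisted products -/

section GroupData

variable (k G : Type*) [Field k] [Group G]
variable (C : Type*) [AddCommGroup C] [Module k C] [Module (Env k (MonoidAlgebra k G)) C]
  [IsScalarTower k (Env k (MonoidAlgebra k G)) C]
variable (S : Type*) [Ring S] [Algebra k S] [MulSemiringAction G S] [SMulCommClass G k S]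
variable (D : Type*) [AddCommGroup D] [Module k D] [Module (Env k S) D]
  [IsScalarTower k (Env k S) D]

/-- Left multiplication by the group element `g` on a `kG`-bimodule. -/
def gLeft : G →* Module.End k C :=
  ((lAct k (MonoidAlgebra k G) C : MonoidAlgebra k G →* Module.End k C)).comp (MonoidAlgebra.of k G)

/-- Right multiplication by the group element `g` on a `kG`-bimodule. -/
def gRight (g : G) : Module.End k C :=
  rAct k (MonoidAlgebra k G) C (MulOpposite.op (MonoidAlgebra.of k G g))

variable {k G C}

theorem gRight_one : gRight k G C 1 = 1 := by
  rw [gRight, map_one, MulOpposite.op_one, map_one]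

theorem gRight_mul (g h : G) : gRight k G C (g * h) = gRight k G C h * gRight k G C g := by
  rw [gRight, map_mul, MulOpposite.op_mul, map_mul]; rfl

theorem gLeft_gRight (g h : G) (c : C) :
    gLeft k G C g (gRight k G C h c) = gRight k G C h (gLeft k G C g c) :=
  lAct_rAct (k := k) (A := MonoidAlgebra k G) (MonoidAlgebra.of k G g)
    (MulOpposite.op (MonoidAlgebra.of k G h)) c

variable (k G C)
variable [DecidableEq G]

/-- A `G`-grading `C = ⨁ C_g` of a `kG`-bimodule with `g₁ (C_g₂) g₃ ⊆ C_{g₁ g₂ g₃}`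
(equality follows, by acting with inverses). -/
structure GroupGrading where
  /-- The component `C_g`. -/
  comp : G → Submodule k C
  [decComp : DirectSum.Decomposition comp]
  smul_mem : ∀ g₁ g₂ g₃ : G, ∀ c ∈ comp g₂, gLeft k G C g₁ (gRight k G C g₃ c) ∈ comp (g₁ * g₂ * g₃)

attribute [instance] GroupGrading.decComp

/-- A `k`-linear action of `G` on an `S`-bimodule, compatible with the action of `G` on `S`. -/
structure CompatibleAction where
  /-- The action of `G`. -/
  ρ : Representation k G D
  left_compat : ∀ (g : G) (s : S) (d : D), ρ g (lAct k S D s d) = lAct k S D (g • s) (ρ g d)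
  right_compat : ∀ (g : G) (s : S) (d : D),
    ρ g (rAct k S D (MulOpposite.op s) d) = rAct k S D (MulOpposite.op (g • s)) (ρ g d)

variable {k G C S D}

theorem GroupGrading.gLeft_mem (Γ : GroupGrading k G C) {g h : G} {c : C} (hc : c ∈ Γ.comp h) :
    gLeft k G C g c ∈ Γ.comp (g * h) := by
  have := Γ.smul_mem g h 1 c hc
  rwa [gRight_one, mul_one, Module.End.one_apply] at this

theorem GroupGrading.gRight_mem (Γ : GroupGrading k G C) {g h : G} {c : C} (hc : c ∈ Γ.comp h) :
    gRight k G C g c ∈ Γ.comp (h * g) := by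
  have := Γ.smul_mem 1 h g c hc
  rwa [map_one, one_mul, Module.End.one_apply] at this

/-- The diagonal action `g · (d ⊗ d') = (g · d) ⊗ (g · d')` on `D ⊗_S D`. -/
def CompatibleAction.diag (α : CompatibleAction k G S D) (g : G) :
    BTensor k S D D →ₗ[k] BTensor k S D D :=
  BTensor.lift ((BTensor.mk k S D D).compl₁₂ (α.ρ g) (α.ρ g)) fun d s d' => by
    change BTensor.tmul k S (α.ρ g (rAct k S D _ d)) (α.ρ g d') =
      BTensor.tmul k S (α.ρ g d) (α.ρ g (lAct k S D s d'))
    rw [α.right_compat, α.left_compat, BTensor.balanced, MulOpposite.unop_op]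

/-- The underlying space `C ⊗ D` of the twisted product. -/
def TwistedProduct (_Γ : GroupGrading k G C) (_α : CompatibleAction k G S D) : Type _ := C ⊗[k] D

namespace TwistedProduct

variable (Γ : GroupGrading k G C) (α : CompatibleAction k G S D)

instance : AddCommGroup (TwistedProduct Γ α) := inferInstanceAs (AddCommGroup (C ⊗[k] D))
instance : Module k (TwistedProduct Γ α) := inferInstanceAs (Module k (C ⊗[k] D))

/-- The identity `C ⊗ D → C ⊗^G D`. -/
def of : C ⊗[k] D ≃ₗ[k] TwistedProduct Γ α := LinearEquiv.refl k _

/-- A linear map out of `C ⊗ D`, as a linear map out of `C ⊗^G D`. -/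
def ofTensor {N : Type*} [AddCommGroup N] [Module k N] (f : C ⊗[k] D →ₗ[k] N) :
    TwistedProduct Γ α →ₗ[k] N := f ∘ₗ (of Γ α).symm.toLinearMap

/-- The linear map `f ⊗ g` on `C ⊗^G D`. -/
def map (f : C →ₗ[k] C) (g : D →ₗ[k] D) : TwistedProduct Γ α →ₗ[k] TwistedProduct Γ α :=
  ofTensor Γ α ((of Γ α).toLinearMap ∘ₗ TensorProduct.map f g)

/-- The element `c ⊗ d` of the twisted product. -/
def mk : C →ₗ[k] D →ₗ[k] TwistedProduct Γ α := (TensorProduct.mk k C D).compr₂ (of Γ α).toLinearMap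

variable {Γ α} in
theorem hom_ext {N : Type*} [AddCommGroup N] [Module k N] {f g : TwistedProduct Γ α →ₗ[k] N}
    (h : ∀ x, ∀ c ∈ Γ.comp x, ∀ d, f (mk Γ α c d) = g (mk Γ α c d)) : f = g :=
  TensorProduct.ext (graded_hom_ext Γ.comp fun x c hc => LinearMap.ext fun d => h x c hc d)

/-- `s · (c ⊗ d) = c ⊗ ((h⁻¹ • s) · d)` for `c ∈ C_h`. -/
def leftS (s : S) : Module.End k (TwistedProduct Γ α) :=
  ofTensor Γ α <| TensorProduct.lift (gradedMap k Γ.comp fun h => (mk Γ α).compl₂ (lAct k S D (h⁻¹ • s)))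

/-- `g · (c ⊗ d) = g c ⊗ d`. -/
def leftG (g : G) : Module.End k (TwistedProduct Γ α) :=
  map Γ α (gLeft k G C g) LinearMap.id

/-- `(c ⊗ d) · s = c ⊗ d s`. -/
def rightS (s : S) : Module.End k (TwistedProduct Γ α) :=
  map Γ α LinearMap.id (rAct k S D (MulOpposite.op s))

/-- `(c ⊗ d) · g = c g ⊗ g⁻¹ · d`. -/
def rightG (g : G) : Module.End k (TwistedProduct Γ α) :=
  map Γ α (gRight k G C g) (α.ρ g⁻¹)

variable {Γ α}

theorem ofTensor_mk {N : Type*} [AddCommGroup N] [Module k N] (f : C ⊗[k] D →ₗ[k] N) (c : C)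
    (d : D) : ofTensor Γ α f (mk Γ α c d) = f (c ⊗ₜ d) := rfl

theorem map_mk (f : C →ₗ[k] C) (g : D →ₗ[k] D) (c : C) (d : D) :
    map Γ α f g (mk Γ α c d) = mk Γ α (f c) (g d) := rfl

theorem leftS_mk {h : G} {c : C} (hc : c ∈ Γ.comp h) (s : S) (d : D) :
    leftS Γ α s (mk Γ α c d) = mk Γ α c (lAct k S D (h⁻¹ • s) d) := by
  change (gradedMap k Γ.comp (fun h => (mk Γ α).compl₂ (lAct k S D (h⁻¹ • s))) c) d = _
  rw [gradedMap_of_mem _ hc]; rfl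

theorem leftG_mk (g : G) (c : C) (d : D) :
    leftG Γ α g (mk Γ α c d) = mk Γ α (gLeft k G C g c) d := rfl

theorem rightS_mk (s : S) (c : C) (d : D) :
    rightS Γ α s (mk Γ α c d) = mk Γ α c (rAct k S D (MulOpposite.op s) d) := rfl

theorem rightG_mk (g : G) (c : C) (d : D) :
    rightG Γ α g (mk Γ α c d) = mk Γ α (gRight k G C g c) (α.ρ g⁻¹ d) := rfl

variable (Γ α)

/-- The left action of `S ⋊ G`: `s g · (c ⊗ d) = g c ⊗ (((g h)⁻¹ • s) · d)` for `c ∈ C_h`. -/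
def left : SkewMonoidAlgebra S G →ₐ[k] Module.End k (TwistedProduct Γ α) :=
  SkewMonoidAlgebra.liftNCAlgHom
    { toFun := leftS Γ α
      map_one' := hom_ext fun h c hc d => by
        rw [leftS_mk hc, smul_one, map_one]; rfl
      map_mul' := fun s t => hom_ext fun h c hc d => by
        rw [Module.End.mul_apply, leftS_mk hc, leftS_mk hc, leftS_mk hc, smul_mul', map_mul]; rfl
      map_zero' := hom_ext fun h c hc d => by
        rw [leftS_mk hc, smul_zero, map_zero, LinearMap.zero_apply, map_zero]; rfl
      map_add' := fun s t => hom_ext fun h c hc d => by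
        rw [LinearMap.add_apply, leftS_mk hc, leftS_mk hc, leftS_mk hc, smul_add, map_add,
          LinearMap.add_apply, map_add]
      commutes' := fun r => hom_ext fun h c hc d => by
        rw [leftS_mk hc, smul_algebraMap, AlgHom.commutes, Module.algebraMap_end_apply,
          Module.algebraMap_end_apply, map_smul] }
    { toFun := leftG Γ α
      map_one' := hom_ext fun h c hc d => by rw [leftG_mk, map_one]; rfl
      map_mul' := fun g g' => hom_ext fun h c hc d => by
        rw [Module.End.mul_apply, leftG_mk, leftG_mk, leftG_mk, map_mul]; rfl }
    (fun {s g} => hom_ext fun h c hc d => by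
      change leftS Γ α (g • s) (leftG Γ α g (mk Γ α c d)) = leftG Γ α g (leftS Γ α s (mk Γ α c d))
      rw [leftG_mk, leftS_mk (Γ.gLeft_mem hc), leftS_mk hc, leftG_mk, smul_smul]
      simp)

/-- The right action of `S ⋊ G`: `(c ⊗ d) · s g = c g ⊗ g⁻¹ · (d s)`. -/
def right : (SkewMonoidAlgebra S G)ᵐᵒᵖ →ₐ[k] Module.End k (TwistedProduct Γ α) :=
  AlgHom.opComm <| SkewMonoidAlgebra.liftNCAlgHom
    { toFun := fun s => MulOpposite.op (rightS Γ α s)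
      map_one' := congrArg MulOpposite.op <| hom_ext fun h c hc d => by
        rw [rightS_mk, MulOpposite.op_one, map_one]; rfl
      map_mul' := fun s t => congrArg MulOpposite.op <| hom_ext fun h c hc d => by
        change rightS Γ α (s * t) (mk Γ α c d) = rightS Γ α t (rightS Γ α s (mk Γ α c d))
        rw [rightS_mk, rightS_mk, rightS_mk, MulOpposite.op_mul, map_mul]; rfl
      map_zero' := congrArg MulOpposite.op <| hom_ext fun h c hc d => by
        rw [rightS_mk, MulOpposite.op_zero, map_zero, LinearMap.zero_apply, map_zero]; rfl
      map_add' := fun s t => congrArg MulOpposite.op <| hom_ext fun h c hc d => by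
        change rightS Γ α (s + t) (mk Γ α c d) =
          rightS Γ α s (mk Γ α c d) + rightS Γ α t (mk Γ α c d)
        rw [rightS_mk, rightS_mk, rightS_mk, MulOpposite.op_add, map_add,
          LinearMap.add_apply, map_add]
      commutes' := fun r => congrArg MulOpposite.op <| hom_ext fun h c hc d => by
        change _ = r • mk Γ α c d
        rw [rightS_mk, ← MulOpposite.algebraMap_apply, AlgHom.commutes,
          Module.algebraMap_end_apply, map_smul] }
    { toFun := fun g => MulOpposite.op (rightG Γ α g)
      map_one' := congrArg MulOpposite.op <| hom_ext fun h c hc d => by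
        rw [rightG_mk, gRight_one, inv_one, map_one]; rfl
      map_mul' := fun g g' => congrArg MulOpposite.op <| hom_ext fun h c hc d => by
        change rightG Γ α (g * g') (mk Γ α c d) = rightG Γ α g' (rightG Γ α g (mk Γ α c d))
        rw [rightG_mk, rightG_mk, rightG_mk, gRight_mul, mul_inv_rev, map_mul]; rfl }
    (fun {s g} => congrArg MulOpposite.op <| hom_ext fun h c hc d => by
      change rightG Γ α g (rightS Γ α (g • s) (mk Γ α c d)) = rightS Γ α s (rightG Γ α g (mk Γ α c d))
      rw [rightG_mk, rightS_mk, rightS_mk, rightG_mk, α.right_compat, inv_smul_smul])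

variable {Γ α}

theorem left_single (s : S) (g : G) (x : TwistedProduct Γ α) :
    left Γ α (SkewMonoidAlgebra.single g s) x = leftS Γ α s (leftG Γ α g x) :=
  LinearMap.congr_fun (SkewMonoidAlgebra.liftNC_single _ _ g s) x

theorem right_single (s : S) (g : G) (x : TwistedProduct Γ α) :
    right Γ α (MulOpposite.op (SkewMonoidAlgebra.single g s)) x =
      rightG Γ α g (rightS Γ α s x) :=
  LinearMap.congr_fun (congrArg MulOpposite.unop (SkewMonoidAlgebra.liftNC_single _ _ g s)) x

theorem left_right (a : SkewMonoidAlgebra S G) (b : (SkewMonoidAlgebra S G)ᵐᵒᵖ) :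
    Commute (left Γ α a) (right Γ α b) := by
  induction b using MulOpposite.rec' with
  | h b =>
  induction a using SkewMonoidAlgebra.induction_on with
  | zero => rw [map_zero]; exact Commute.zero_left _
  | add x y hx hy => rw [map_add]; exact hx.add_left hy
  | single g s =>
  induction b using SkewMonoidAlgebra.induction_on with
  | zero => rw [MulOpposite.op_zero, map_zero]; exact Commute.zero_right _
  | add x y hx hy => rw [MulOpposite.op_add, map_add]; exact hx.add_right hy
  | single g' s' =>
    refine hom_ext fun h c hc d => ?_
    rw [Module.End.mul_apply, Module.End.mul_apply, left_single, left_single, right_single,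
      right_single, rightS_mk, rightG_mk, leftG_mk, leftS_mk (Γ.gLeft_mem (Γ.gRight_mem hc)),
      leftG_mk, leftS_mk (Γ.gLeft_mem hc), rightS_mk, rightG_mk, gLeft_gRight, ← lAct_rAct,
      α.left_compat, smul_smul, ← mul_inv_rev, mul_assoc]

variable (Γ α)

instance : Module (Env k (SkewMonoidAlgebra S G)) (TwistedProduct Γ α) :=
  bimodOfActions (left Γ α) (right Γ α) left_right

instance : IsScalarTower k (Env k (SkewMonoidAlgebra S G)) (TwistedProduct Γ α) :=
  bimodOfActions_tower _ _ _

variable {Γ α}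

theorem lAct_eq (a : SkewMonoidAlgebra S G) :
    lAct k (SkewMonoidAlgebra S G) (TwistedProduct Γ α) a = left Γ α a :=
  LinearMap.ext fun x => (bimodOfActions_tmul _ _ left_right a 1 x).trans
    (by rw [map_one, Module.End.one_apply])

theorem rAct_eq (b : (SkewMonoidAlgebra S G)ᵐᵒᵖ) :
    rAct k (SkewMonoidAlgebra S G) (TwistedProduct Γ α) b = right Γ α b :=
  LinearMap.ext fun x => (bimodOfActions_tmul _ _ left_right 1 b x).trans
    (by rw [map_one, Module.End.one_apply])

theorem leftG_one : leftG Γ α 1 = 1 := hom_ext fun h c hc d => by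
  rw [leftG_mk, map_one]; rfl

theorem rightG_one : rightG Γ α 1 = 1 := hom_ext fun h c hc d => by
  rw [rightG_mk, gRight_one, inv_one, map_one]; rfl

theorem leftS_one : leftS Γ α 1 = 1 := hom_ext fun h c hc d => by
  rw [leftS_mk hc, smul_one, map_one]; rfl

theorem rightS_one : rightS Γ α 1 = 1 := hom_ext fun h c hc d => by
  rw [rightS_mk, MulOpposite.op_one, map_one]; rfl

theorem lAct_s (s : S) (x : TwistedProduct Γ α) :
    lAct k (SkewMonoidAlgebra S G) _ (SkewMonoidAlgebra.single 1 s) x = leftS Γ α s x := by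
  rw [lAct_eq, left_single, leftG_one]; rfl

theorem lAct_g (g : G) (x : TwistedProduct Γ α) :
    lAct k (SkewMonoidAlgebra S G) _ (SkewMonoidAlgebra.single g 1) x = leftG Γ α g x := by
  rw [lAct_eq, left_single, leftS_one]; rfl

theorem rAct_s (s : S) (x : TwistedProduct Γ α) :
    rAct k (SkewMonoidAlgebra S G) _ (MulOpposite.op (SkewMonoidAlgebra.single 1 s)) x =
      rightS Γ α s x := by
  rw [rAct_eq, right_single, rightG_one]; rfl

theorem rAct_g (g : G) (x : TwistedProduct Γ α) :
    rAct k (SkewMonoidAlgebra S G) _ (MulOpposite.op (SkewMonoidAlgebra.single g 1)) x =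
      rightG Γ α g x := by
  rw [rAct_eq, right_single, rightS_one]; rfl

theorem single_eq (s : S) (g : G) : (SkewMonoidAlgebra.single g s : SkewMonoidAlgebra S G) =
    SkewMonoidAlgebra.single 1 s * SkewMonoidAlgebra.single g 1 := by
  rw [SkewMonoidAlgebra.single_mul_single]; simp

/-- A `k`-linear map from a twisted product is a bimodule map if it commutes with the actions of
`S` and `G` from both sides. -/
def bimodHom {N : Type*} [AddCommGroup N] [Module k N]
    [Module (Env k (SkewMonoidAlgebra S G)) N] [IsScalarTower k (Env k (SkewMonoidAlgebra S G)) N]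
    (f : TwistedProduct Γ α →ₗ[k] N)
    (hls : ∀ s h, ∀ c ∈ Γ.comp h, ∀ d, f (mk Γ α c (lAct k S D (h⁻¹ • s) d)) =
      lAct k (SkewMonoidAlgebra S G) N (SkewMonoidAlgebra.single 1 s) (f (mk Γ α c d)))
    (hlg : ∀ g c d, f (mk Γ α (gLeft k G C g c) d) =
      lAct k (SkewMonoidAlgebra S G) N (SkewMonoidAlgebra.single g 1) (f (mk Γ α c d)))
    (hrs : ∀ s c d, f (mk Γ α c (rAct k S D (MulOpposite.op s) d)) =
      rAct k (SkewMonoidAlgebra S G) N (MulOpposite.op (SkewMonoidAlgebra.single 1 s))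
        (f (mk Γ α c d)))
    (hrg : ∀ g c d, f (mk Γ α (gRight k G C g c) (α.ρ g⁻¹ d)) =
      rAct k (SkewMonoidAlgebra S G) N (MulOpposite.op (SkewMonoidAlgebra.single g 1))
        (f (mk Γ α c d))) :
    TwistedProduct Γ α →ₗ[Env k (SkewMonoidAlgebra S G)] N :=
  have hls' (s : S) (x : TwistedProduct Γ α) := LinearMap.congr_fun (f := f ∘ₗ leftS Γ α s)
    (g := lAct k (SkewMonoidAlgebra S G) N (SkewMonoidAlgebra.single 1 s) ∘ₗ f)
    (hom_ext fun h c hc d => by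
      rw [LinearMap.comp_apply, LinearMap.comp_apply, leftS_mk hc, hls s h c hc]) x
  have hlg' (g : G) (x : TwistedProduct Γ α) := LinearMap.congr_fun (f := f ∘ₗ leftG Γ α g)
    (g := lAct k (SkewMonoidAlgebra S G) N (SkewMonoidAlgebra.single g 1) ∘ₗ f)
    (hom_ext fun h c hc d => by
      rw [LinearMap.comp_apply, LinearMap.comp_apply, leftG_mk, hlg]) x
  have hrs' (s : S) (x : TwistedProduct Γ α) := LinearMap.congr_fun (f := f ∘ₗ rightS Γ α s)
    (g := rAct k (SkewMonoidAlgebra S G) N (MulOpposite.op (SkewMonoidAlgebra.single 1 s)) ∘ₗ f)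
    (hom_ext fun h c hc d => by
      rw [LinearMap.comp_apply, LinearMap.comp_apply, rightS_mk, hrs]) x
  have hrg' (g : G) (x : TwistedProduct Γ α) := LinearMap.congr_fun (f := f ∘ₗ rightG Γ α g)
    (g := rAct k (SkewMonoidAlgebra S G) N (MulOpposite.op (SkewMonoidAlgebra.single g 1)) ∘ₗ f)
    (hom_ext fun h c hc d => by
      rw [LinearMap.comp_apply, LinearMap.comp_apply, rightG_mk, hrg]) x
  _root_.bimodHom f
    (fun a x => by
      induction a using SkewMonoidAlgebra.induction_on with
      | zero => rw [map_zero, map_zero, LinearMap.zero_apply, LinearMap.zero_apply, map_zero]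
      | add a b ha hb =>
        rw [map_add, map_add, LinearMap.add_apply, LinearMap.add_apply, map_add, ha, hb]
      | single g s =>
        rw [lAct_eq, left_single, single_eq s g, map_mul, Module.End.mul_apply]
        exact (hls' s _).trans (congrArg _ (hlg' g x)))
    (fun b x => by
      induction b using MulOpposite.rec' with
      | h b =>
      induction b using SkewMonoidAlgebra.induction_on with
      | zero =>
        rw [MulOpposite.op_zero, map_zero, map_zero, LinearMap.zero_apply, LinearMap.zero_apply,
          map_zero]
      | add a b ha hb =>
        rw [MulOpposite.op_add, map_add, map_add, LinearMap.add_apply, LinearMap.add_apply,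
          map_add, ha, hb]
      | single g s =>
        rw [rAct_eq, right_single, single_eq s g, MulOpposite.op_mul, map_mul,
          Module.End.mul_apply]
        exact (hrg' g _).trans (congrArg _ (hrs' s x)))

/-- Balancedness over `S ⋊ G` can be checked on `S` and on `G`. -/
theorem balanced_of {N Q : Type*} [AddCommGroup N] [Module k N]
    [Module (Env k (SkewMonoidAlgebra S G)) N] [IsScalarTower k (Env k (SkewMonoidAlgebra S G)) N]
    [AddCommGroup Q] [Module k Q] (f : TwistedProduct Γ α →ₗ[k] N →ₗ[k] Q)
    (hs : ∀ s x y, f (rightS Γ α s x) y =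
      f x (lAct k (SkewMonoidAlgebra S G) N (SkewMonoidAlgebra.single 1 s) y))
    (hg : ∀ g x y, f (rightG Γ α g x) y =
      f x (lAct k (SkewMonoidAlgebra S G) N (SkewMonoidAlgebra.single g 1) y))
    (x : TwistedProduct Γ α) (a : SkewMonoidAlgebra S G) (y : N) :
    f (rAct k (SkewMonoidAlgebra S G) _ (MulOpposite.op a) x) y =
      f x (lAct k (SkewMonoidAlgebra S G) N a y) := by
  induction a using SkewMonoidAlgebra.induction_on with
  | zero =>
    rw [MulOpposite.op_zero, map_zero, map_zero, LinearMap.zero_apply, LinearMap.zero_apply,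
      map_zero, map_zero, LinearMap.zero_apply]
  | add a b ha hb =>
    rw [MulOpposite.op_add, map_add, map_add, LinearMap.add_apply, LinearMap.add_apply,
      map_add, map_add, LinearMap.add_apply, ha, hb]
  | single g s =>
    rw [rAct_eq, right_single, hg, hs, single_eq s g, map_mul, Module.End.mul_apply]

end TwistedProduct
end GroupData


/-! ### The twisted product resolution -/

/-- `1 ⊗ τ ⊗ 1`, for a map `τ : M₂ ⊗ M₃ → N₂ ⊗ N₃`. -/
def innerMap {k : Type*} [Field k] (M₁ M₄ : Type*) {M₂ M₃ N₂ N₃ : Type*}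
    [AddCommGroup M₁] [Module k M₁] [AddCommGroup M₂] [Module k M₂]
    [AddCommGroup M₃] [Module k M₃] [AddCommGroup M₄] [Module k M₄]
    [AddCommGroup N₂] [Module k N₂] [AddCommGroup N₃] [Module k N₃]
    (τ : M₂ ⊗[k] M₃ →ₗ[k] N₂ ⊗[k] N₃) :
    (M₁ ⊗[k] M₂) ⊗[k] (M₃ ⊗[k] M₄) →ₗ[k] (M₁ ⊗[k] N₂) ⊗[k] (N₃ ⊗[k] M₄) :=
  (TensorProduct.assoc k M₁ N₂ (N₃ ⊗[k] M₄)).symm.toLinearMap ∘ₗ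
    ((TensorProduct.assoc k N₂ N₃ M₄).toLinearMap ∘ₗ
      τ.rTensor M₄ ∘ₗ (TensorProduct.assoc k M₂ M₃ M₄).symm.toLinearMap).lTensor M₁ ∘ₗ
    (TensorProduct.assoc k M₁ M₂ (M₃ ⊗[k] M₄)).toLinearMap

theorem innerMap_tmul {k : Type*} [Field k] {M₁ M₄ M₂ M₃ N₂ N₃ : Type*}
    [AddCommGroup M₁] [Module k M₁] [AddCommGroup M₂] [Module k M₂]
    [AddCommGroup M₃] [Module k M₃] [AddCommGroup M₄] [Module k M₄]
    [AddCommGroup N₂] [Module k N₂] [AddCommGroup N₃] [Module k N₃]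
    (τ : M₂ ⊗[k] M₃ →ₗ[k] N₂ ⊗[k] N₃) {x : M₁} {y : M₂} {z : M₃} {w : M₄} {u : N₂} {v : N₃}
    (h : τ (y ⊗ₜ z) = u ⊗ₜ v) :
    innerMap M₁ M₄ τ ((x ⊗ₜ y) ⊗ₜ (z ⊗ₜ w)) = (x ⊗ₜ u) ⊗ₜ (v ⊗ₜ w) := by
  simp [innerMap, h]

section Twisted

variable (k G : Type*) [Field k] [Group G] [DecidableEq G]
variable (C : Type*) [AddCommGroup C] [Module k C] [Module (Env k (MonoidAlgebra k G)) C]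
  [IsScalarTower k (Env k (MonoidAlgebra k G)) C]
variable (S : Type*) [Ring S] [Algebra k S] [MulSemiringAction G S] [SMulCommClass G k S]
variable (D : Type*) [AddCommGroup D] [Module k D] [Module (Env k S) D]
  [IsScalarTower k (Env k S) D]

/-- A differential graded coalgebra resolution of `kG` that is `G`-graded: each `Cₙ` is the direct
sum of its parts `Cₙ ∩ C_g`, and the differential, the augmentation and the diagonal map preserve
the `G`-grading. -/
structure GroupGradedResolution extends DGCoalgResolution k (MonoidAlgebra k G) C,
    GroupGrading k G C where
  comp_gr : ∀ n, ∀ c ∈ gr n, ∀ g, (DirectSum.decompose comp c g : C) ∈ gr n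
  d_comp : ∀ g, ∀ c ∈ comp g, d c ∈ comp g
  aug_comp : ∀ g, ∀ c ∈ comp g, ∃ r : k, aug c = MonoidAlgebra.single g r
  Δ_comp : ∀ g, ∀ c ∈ comp g,
    Δ c ∈ BTensor.degree k (MonoidAlgebra k G) (· * ·) (fun a => (comp a : Set C))
      (fun b => (comp b : Set C)) g

/-- A differential graded coalgebra resolution of `S` with a compatible action of `G` on each `Dₙ`
for which the differential, the augmentation and the diagonal map are `G`-equivariant. -/
structure EquivariantResolution extends DGCoalgResolution k S D, CompatibleAction k G S D where
  ρ_gr : ∀ g n, ∀ x ∈ gr n, ρ g x ∈ gr n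
  ρ_d : ∀ g x, d (ρ g x) = ρ g (d x)
  aug_ρ : ∀ g x, aug (ρ g x) = g • aug x
  Δ_ρ : ∀ g x, Δ (ρ g x) = toCompatibleAction.diag g (Δ x)

variable {k G C S D}
variable (R : GroupGradedResolution k G C) (T : EquivariantResolution k G S D)

/-- The twisted product `X = C ⊗^G D`, a bimodule over `S ⋊ G`. -/
abbrev TwistedRes : Type _ := TwistedProduct R.toGroupGrading T.toCompatibleAction

/-- `d ↦ (-1)^(i|d|) d` on `D`. -/
def EquivariantResolution.sgnPow (i : ℕ) : D →ₗ[Env k S] D := (T.sgn : Module.End (Env k S) D) ^ i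

/-- `τ : C ⊗ D → D ⊗ C`, `τ (c ⊗ d) = (-1)^(ij) (g · d) ⊗ c` for `c ∈ (C_i)_g`, `d ∈ D_j`. -/
def tau : C ⊗[k] D →ₗ[k] D ⊗[k] C :=
  TensorProduct.lift (gradedMap k R.gr fun i => gradedMap k R.comp fun g =>
    (TensorProduct.mk k D C).flip.compl₂ (T.ρ g ∘ₗ (T.sgnPow i).restrictScalars k))

/-- The inverse of `τ`: `τ⁻¹ (d ⊗ c) = (-1)^(ij) c ⊗ (g⁻¹ · d)` for `c ∈ (C_i)_g`, `d ∈ D_j`. -/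
def tauInv : D ⊗[k] C →ₗ[k] C ⊗[k] D :=
  TensorProduct.lift (gradedMap k R.gr fun i => gradedMap k R.comp fun g =>
    (TensorProduct.mk k C D).compl₂ (T.ρ g⁻¹ ∘ₗ (T.sgnPow i).restrictScalars k)).flip

variable {R T}

theorem tau_tmul {i : ℕ} {g : G} {c : C} (hi : c ∈ R.gr i) (hg : c ∈ R.comp g) (d : D) :
    tau R T (c ⊗ₜ d) = T.ρ g (T.sgnPow i d) ⊗ₜ c := by
  change (gradedMap k R.gr (fun i => gradedMap k R.comp fun g =>
    (TensorProduct.mk k D C).flip.compl₂ (T.ρ g ∘ₗ (T.sgnPow i).restrictScalars k)) c) d = _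
  rw [gradedMap_of_mem _ hi, gradedMap_of_mem _ hg]; rfl

theorem tauInv_tmul {i : ℕ} {g : G} {c : C} (hi : c ∈ R.gr i) (hg : c ∈ R.comp g) (d : D) :
    tauInv R T (d ⊗ₜ c) = c ⊗ₜ T.ρ g⁻¹ (T.sgnPow i d) := by
  change (gradedMap k R.gr (fun i => gradedMap k R.comp fun g =>
    (TensorProduct.mk k C D).compl₂ (T.ρ g⁻¹ ∘ₗ (T.sgnPow i).restrictScalars k)) c) d = _
  rw [gradedMap_of_mem _ hi, gradedMap_of_mem _ hg]; rfl

/-- Linear maps out of `C` agree if they agree on all `(C_i)_g`. -/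
theorem bigraded_ext {N : Type*} [AddCommGroup N] [Module k N] {f f' : C →ₗ[k] N}
    (h : ∀ i g c, c ∈ R.gr i → c ∈ R.comp g → f c = f' c) : f = f' :=
  graded_hom_ext R.gr fun i c hc => by
    classical
    rw [← DirectSum.sum_support_decompose R.comp c, map_sum, map_sum]
    exact Finset.sum_congr rfl fun g _ => h i g _ (R.comp_gr i c hc g) (SetLike.coe_mem _)

/-- Linear maps that agree on all `(C_i)_g` agree on `C_g`. -/
theorem bigraded_ext_comp {N : Type*} [AddCommGroup N] [Module k N] {f f' : C →ₗ[k] N} {g : G}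
    (h : ∀ i c, c ∈ R.gr i → c ∈ R.comp g → f c = f' c) {c : C} (hc : c ∈ R.comp g) :
    f c = f' c := by
  let F : G → C →ₗ[k] N := fun a => if a = g then f else 0
  let F' : G → C →ₗ[k] N := fun a => if a = g then f' else 0
  have key : gradedMap k R.comp F = gradedMap k R.comp F' := bigraded_ext (R := R)
    fun i a c hi ha => by
      rw [gradedMap_of_mem _ ha, gradedMap_of_mem _ ha]
      by_cases hag : a = g
      · subst hag; simpa [F, F'] using h i c hi ha
      · simp [F, F', hag]
  have := LinearMap.congr_fun key c
  rw [gradedMap_of_mem _ hc, gradedMap_of_mem _ hc] at this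
  simpa [F, F'] using this

theorem gLeft_gr {i : ℕ} {c : C} (hc : c ∈ R.gr i) (g : G) : gLeft k G C g c ∈ R.gr i :=
  (R.gr i).smul_mem _ hc

theorem gRight_gr {i : ℕ} {c : C} (hc : c ∈ R.gr i) (g : G) : gRight k G C g c ∈ R.gr i :=
  (R.gr i).smul_mem _ hc

theorem sgn_ρ (g : G) (d : D) : T.sgn (T.ρ g d) = T.ρ g (T.sgn d) :=
  LinearMap.congr_fun (f := (T.sgn.restrictScalars k).comp (T.ρ g))
    (g := (T.ρ g).comp (T.sgn.restrictScalars k)) (graded_hom_ext T.gr fun n m hm => by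
      change T.sgn (T.ρ g m) = T.ρ g (T.sgn m)
      rw [T.sgn_of_mem hm, T.sgn_of_mem (T.ρ_gr g n m hm), map_smul]) d

theorem sgnPow_ρ (i : ℕ) (g : G) (d : D) : T.sgnPow i (T.ρ g d) = T.ρ g (T.sgnPow i d) := by
  induction i with
  | zero => rfl
  | succ i ih =>
    change ((T.sgn : Module.End (Env k S) D) ^ (i + 1)) _ = T.ρ g (((T.sgn :
      Module.End (Env k S) D) ^ (i + 1)) d)
    rw [pow_succ', Module.End.mul_apply, Module.End.mul_apply]
    change T.sgn (T.sgnPow i (T.ρ g d)) = _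
    rw [ih, sgn_ρ]; rfl

theorem sgn_comp {g : G} {c : C} (hc : c ∈ R.comp g) : R.sgn c ∈ R.comp g := by
  have := bigraded_ext_comp (R := R) (g := g) (N := C ⧸ R.comp g)
    (f := (R.comp g).mkQ ∘ₗ R.sgn.restrictScalars k) (f' := 0) (fun i c hi hg => by
      change (R.comp g).mkQ (R.sgn c) = 0
      rw [R.sgn_of_mem hi]
      exact (Submodule.Quotient.mk_eq_zero _).2 ((R.comp g).smul_mem _ hg)) hc
  exact (Submodule.Quotient.mk_eq_zero _).1 this

/-- The underlying map of `1 ⊗ τ ⊗ 1` before passing to balanced tensor products. -/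
def preTwist : (C ⊗[k] C) ⊗[k] (D ⊗[k] D) →ₗ[k]
    BTensor k (SkewMonoidAlgebra S G) (TwistedRes R T) (TwistedRes R T) :=
  BTensor.proj k (SkewMonoidAlgebra S G) (TwistedRes R T) (TwistedRes R T) ∘ₗ
    TensorProduct.map (TwistedProduct.of R.toGroupGrading T.toCompatibleAction).toLinearMap
      (TwistedProduct.of R.toGroupGrading T.toCompatibleAction).toLinearMap ∘ₗ
    innerMap C D (tau R T)


theorem preTwist_tmul {i : ℕ} {g : G} {c' : C} (hi : c' ∈ R.gr i) (hg : c' ∈ R.comp g)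
    (c : C) (d d' : D) :
    preTwist (R := R) (T := T) ((c ⊗ₜ c') ⊗ₜ (d ⊗ₜ d')) =
      BTensor.tmul k (SkewMonoidAlgebra S G) (TwistedProduct.mk _ _ c (T.ρ g (T.sgnPow i d))) (TwistedProduct.mk _ _ c' d') := by
  change BTensor.proj k (SkewMonoidAlgebra S G) (TwistedRes R T) (TwistedRes R T) (TensorProduct.map _ _
    (innerMap C D (tau R T) ((c ⊗ₜ c') ⊗ₜ (d ⊗ₜ d')))) = _
  rw [innerMap_tmul _ (tau_tmul hi hg d)]; rfl

theorem tmul_rightG (g : G) (x y : TwistedRes R T) :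
    BTensor.tmul k (SkewMonoidAlgebra S G) (TwistedProduct.rightG _ _ g x) y =
      BTensor.tmul k (SkewMonoidAlgebra S G) x (TwistedProduct.leftG _ _ g y) := by
  rw [← TwistedProduct.rAct_g, BTensor.balanced, MulOpposite.unop_op, TwistedProduct.lAct_g]

theorem tmul_rightS (s : S) (x y : TwistedRes R T) :
    BTensor.tmul k (SkewMonoidAlgebra S G) (TwistedProduct.rightS _ _ s x) y =
      BTensor.tmul k (SkewMonoidAlgebra S G) x (TwistedProduct.leftS _ _ s y) := by
  rw [← TwistedProduct.rAct_s, BTensor.balanced, MulOpposite.unop_op, TwistedProduct.lAct_s]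

theorem ρ_mul (g h : G) (d : D) : T.ρ (g * h) d = T.ρ g (T.ρ h d) := by
  rw [map_mul]; rfl

theorem ρ_inv_ρ (g : G) (d : D) : T.ρ g⁻¹ (T.ρ g d) = d := by
  rw [← ρ_mul, inv_mul_cancel, map_one]; rfl

theorem ρ_ρ_inv (g : G) (d : D) : T.ρ g (T.ρ g⁻¹ d) = d := by
  rw [← ρ_mul, mul_inv_cancel, map_one]; rfl

variable (R T) in
/-- `c' ↦ (1 ⊗ τ ⊗ 1) (c ⊗ c' ⊗ w)`. -/
def preSlot (c : C) (w : D ⊗[k] D) :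
    C →ₗ[k] BTensor k (SkewMonoidAlgebra S G) (TwistedRes R T) (TwistedRes R T) :=
  preTwist ∘ₗ (TensorProduct.mk k (C ⊗[k] C) (D ⊗[k] D)).flip w ∘ₗ TensorProduct.mk k C C c

theorem preTwist_G (a : MonoidAlgebra k G) (c c' : C) (w : D ⊗[k] D) :
    preTwist (R := R) (T := T)
        ((rAct k (MonoidAlgebra k G) C (MulOpposite.op a) c ⊗ₜ c') ⊗ₜ w) =
      preTwist (R := R) (T := T) ((c ⊗ₜ lAct k (MonoidAlgebra k G) C a c') ⊗ₜ w) := by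
  induction w using TensorProduct.induction_on with
  | zero => rw [TensorProduct.tmul_zero, TensorProduct.tmul_zero]
  | add x y hx hy => rw [TensorProduct.tmul_add, TensorProduct.tmul_add, map_add, map_add, hx, hy]
  | tmul d d' =>
  induction a using MonoidAlgebra.induction_on with
  | add x y hx hy =>
    rw [MulOpposite.op_add, map_add, map_add, LinearMap.add_apply, LinearMap.add_apply,
      TensorProduct.add_tmul, TensorProduct.tmul_add, TensorProduct.add_tmul,
      TensorProduct.add_tmul, map_add, map_add, hx, hy]
  | smul r x hx =>
    rw [MulOpposite.op_smul, map_smul, map_smul, LinearMap.smul_apply, LinearMap.smul_apply,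
      ← TensorProduct.smul_tmul', TensorProduct.tmul_smul, ← TensorProduct.smul_tmul',
      ← TensorProduct.smul_tmul', map_smul, map_smul, hx]
  | of g =>
    refine LinearMap.congr_fun (f := preSlot R T (gRight k G C g c) (d ⊗ₜ d'))
      (g := preSlot R T c (d ⊗ₜ d') ∘ₗ gLeft k G C g)
      (bigraded_ext (R := R) fun i h c' hi hh => ?_) c'
    change preTwist (R := R) (T := T) ((gRight k G C g c ⊗ₜ c') ⊗ₜ (d ⊗ₜ d')) =
      preTwist (R := R) (T := T) ((c ⊗ₜ gLeft k G C g c') ⊗ₜ (d ⊗ₜ d'))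
    rw [preTwist_tmul hi hh, preTwist_tmul (gLeft_gr hi g) (R.gLeft_mem hh),
      ← TwistedProduct.leftG_mk, ← tmul_rightG, TwistedProduct.rightG_mk, ρ_mul, ρ_inv_ρ]

theorem preTwist_S (s : S) (z : C ⊗[k] C) (d d' : D) :
    preTwist (R := R) (T := T) (z ⊗ₜ (rAct k S D (MulOpposite.op s) d ⊗ₜ d')) =
      preTwist (R := R) (T := T) (z ⊗ₜ (d ⊗ₜ lAct k S D s d')) := by
  induction z using TensorProduct.induction_on with
  | zero => rw [TensorProduct.zero_tmul, TensorProduct.zero_tmul]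
  | add x y hx hy => rw [TensorProduct.add_tmul, TensorProduct.add_tmul, map_add, map_add, hx, hy]
  | tmul c c' =>
    refine LinearMap.congr_fun
      (f := preSlot R T c (rAct k S D (MulOpposite.op s) d ⊗ₜ d'))
      (g := preSlot R T c (d ⊗ₜ lAct k S D s d'))
      (bigraded_ext (R := R) fun i h c' hi hh => ?_) c'
    change preTwist (R := R) (T := T) ((c ⊗ₜ c') ⊗ₜ (rAct k S D (MulOpposite.op s) d ⊗ₜ d')) =
      preTwist (R := R) (T := T) ((c ⊗ₜ c') ⊗ₜ (d ⊗ₜ lAct k S D s d'))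
    rw [preTwist_tmul hi hh, preTwist_tmul hi hh, map_rAct, T.right_compat,
      ← TwistedProduct.rightS_mk, tmul_rightS, TwistedProduct.leftS_mk hh, inv_smul_smul]

variable (R T)

/-- The map `1 ⊗ τ ⊗ 1 : (C ⊗_{kG} C) ⊗ (D ⊗_S D) → X ⊗_{S ⋊ G} X`. -/
def twist : BTensor k (MonoidAlgebra k G) C C ⊗[k] BTensor k S D D →ₗ[k]
    BTensor k (SkewMonoidAlgebra S G) (TwistedRes R T) (TwistedRes R T) :=
  TensorProduct.lift (BTensor.lift (TensorProduct.curry (BTensor.lift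
      (TensorProduct.curry (TensorProduct.curry (preTwist (R := R) (T := T))))
      fun c a c' => LinearMap.ext fun w => preTwist_G a c c' w).flip)
    fun d s d' => BTensor.hom_ext fun c c' => preTwist_S s (c ⊗ₜ c') d d').flip

variable {R T}

theorem twist_tmul (c c' : C) (d d' : D) :
    twist R T (BTensor.tmul k (MonoidAlgebra k G) c c' ⊗ₜ BTensor.tmul k S d d') =
      preTwist ((c ⊗ₜ c') ⊗ₜ (d ⊗ₜ d')) := rfl

/-- Two linear maps out of `(C ⊗_{kG} C) ⊗ (D ⊗_S D)` agree if they agree on all tensors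
`c ⊗ c' ⊗ d ⊗ d'` with `c'` homogeneous. -/
theorem twist_ext {N : Type*} [AddCommGroup N] [Module k N]
    {f f' : BTensor k (MonoidAlgebra k G) C C ⊗[k] BTensor k S D D →ₗ[k] N}
    (h : ∀ i g c c' d d', c' ∈ R.gr i → c' ∈ R.comp g →
      f (BTensor.tmul k (MonoidAlgebra k G) c c' ⊗ₜ BTensor.tmul k S d d') =
        f' (BTensor.tmul k (MonoidAlgebra k G) c c' ⊗ₜ BTensor.tmul k S d d')) : f = f' := by
  refine TensorProduct.ext (BTensor.hom_ext fun c c' => BTensor.hom_ext fun d d' => ?_)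
  exact LinearMap.congr_fun
    (f := f ∘ₗ (TensorProduct.mk k _ _).flip (BTensor.tmul k S d d') ∘ₗ
      BTensor.mk k (MonoidAlgebra k G) C C c)
    (g := f' ∘ₗ (TensorProduct.mk k _ _).flip (BTensor.tmul k S d d') ∘ₗ
      BTensor.mk k (MonoidAlgebra k G) C C c)
    (bigraded_ext (R := R) fun i g c' hi hg => h i g c c' d d' hi hg) c'


theorem twist_gLeft (g : G) (z : BTensor k (MonoidAlgebra k G) C C) (w : BTensor k S D D) :
    twist R T (lAct k (MonoidAlgebra k G) _ (MonoidAlgebra.of k G g) z ⊗ₜ w) =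
      lAct k (SkewMonoidAlgebra S G) _ (SkewMonoidAlgebra.single g 1) (twist R T (z ⊗ₜ w)) :=
  LinearMap.congr_fun
    (f := twist R T ∘ₗ TensorProduct.map
      (lAct k (MonoidAlgebra k G) _ (MonoidAlgebra.of k G g)) LinearMap.id)
    (g := lAct k (SkewMonoidAlgebra S G) _ (SkewMonoidAlgebra.single g 1) ∘ₗ twist R T)
    (twist_ext (R := R) fun i h c c' d d' hi hh => by
      change twist R T (lAct k (MonoidAlgebra k G) _ (MonoidAlgebra.of k G g)
        (BTensor.tmul k _ c c') ⊗ₜ BTensor.tmul k S d d') = lAct k (SkewMonoidAlgebra S G) _ _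
          (twist R T (BTensor.tmul k _ c c' ⊗ₜ BTensor.tmul k S d d'))
      rw [BTensor.lAct_tmul, twist_tmul, twist_tmul, preTwist_tmul hi hh, preTwist_tmul hi hh,
        BTensor.lAct_tmul, TwistedProduct.lAct_g, TwistedProduct.leftG_mk]; rfl) (z ⊗ₜ w)

theorem twist_rightS (s : S) (z : BTensor k (MonoidAlgebra k G) C C) (w : BTensor k S D D) :
    twist R T (z ⊗ₜ rAct k S _ (MulOpposite.op s) w) =
      rAct k (SkewMonoidAlgebra S G) _ (MulOpposite.op (SkewMonoidAlgebra.single 1 s))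
        (twist R T (z ⊗ₜ w)) :=
  LinearMap.congr_fun
    (f := twist R T ∘ₗ TensorProduct.map LinearMap.id (rAct k S _ (MulOpposite.op s)))
    (g := rAct k (SkewMonoidAlgebra S G) _ (MulOpposite.op (SkewMonoidAlgebra.single 1 s)) ∘ₗ
      twist R T)
    (twist_ext (R := R) fun i h c c' d d' hi hh => by
      change twist R T (BTensor.tmul k _ c c' ⊗ₜ rAct k S _ _ (BTensor.tmul k S d d')) =
        rAct k (SkewMonoidAlgebra S G) _ _
          (twist R T (BTensor.tmul k _ c c' ⊗ₜ BTensor.tmul k S d d'))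
      rw [BTensor.rAct_tmul, twist_tmul, twist_tmul, preTwist_tmul hi hh, preTwist_tmul hi hh,
        BTensor.rAct_tmul, TwistedProduct.rAct_s, TwistedProduct.rightS_mk]) (z ⊗ₜ w)

theorem twist_rightG (g : G) (z : BTensor k (MonoidAlgebra k G) C C) (w : BTensor k S D D) :
    twist R T (rAct k (MonoidAlgebra k G) _ (MulOpposite.op (MonoidAlgebra.of k G g)) z ⊗ₜ
        T.diag g⁻¹ w) =
      rAct k (SkewMonoidAlgebra S G) _ (MulOpposite.op (SkewMonoidAlgebra.single g 1))
        (twist R T (z ⊗ₜ w)) :=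
  LinearMap.congr_fun
    (f := twist R T ∘ₗ TensorProduct.map
      (rAct k (MonoidAlgebra k G) _ (MulOpposite.op (MonoidAlgebra.of k G g))) (T.diag g⁻¹))
    (g := rAct k (SkewMonoidAlgebra S G) _ (MulOpposite.op (SkewMonoidAlgebra.single g 1)) ∘ₗ
      twist R T)
    (twist_ext (R := R) fun i h c c' d d' hi hh => by
      change twist R T (rAct k (MonoidAlgebra k G) _ _ (BTensor.tmul k _ c c') ⊗ₜ
          BTensor.tmul k S (T.ρ g⁻¹ d) (T.ρ g⁻¹ d')) =
        rAct k (SkewMonoidAlgebra S G) _ _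
          (twist R T (BTensor.tmul k _ c c' ⊗ₜ BTensor.tmul k S d d'))
      rw [BTensor.rAct_tmul, twist_tmul, twist_tmul, preTwist_tmul hi hh, BTensor.rAct_tmul,
        TwistedProduct.rAct_g, TwistedProduct.rightG_mk]
      change preTwist ((c ⊗ₜ gRight k G C g c') ⊗ₜ _) = _
      rw [preTwist_tmul (gRight_gr hi g) (R.gRight_mem hh), sgnPow_ρ, ρ_mul, ρ_ρ_inv]) (z ⊗ₜ w)

theorem twist_leftS {h : G} (s : S) {z : BTensor k (MonoidAlgebra k G) C C}
    (hz : z ∈ BTensor.degree k (MonoidAlgebra k G) (· * ·) (fun a => (R.comp a : Set C))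
      (fun b => (R.comp b : Set C)) h) (w : BTensor k S D D) :
    twist R T (z ⊗ₜ lAct k S _ (h⁻¹ • s) w) =
      lAct k (SkewMonoidAlgebra S G) _ (SkewMonoidAlgebra.single 1 s) (twist R T (z ⊗ₜ w)) := by
  induction hz using Submodule.span_induction with
  | zero => rw [TensorProduct.zero_tmul, TensorProduct.zero_tmul, map_zero, map_zero]
  | add x y _ _ hx hy =>
    rw [TensorProduct.add_tmul, TensorProduct.add_tmul, map_add, map_add, map_add, hx, hy]
  | smul r x _ hx =>
    rw [← TensorProduct.smul_tmul', ← TensorProduct.smul_tmul', map_smul (twist R T),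
      map_smul (twist R T), hx, map_smul]
  | mem x hx =>
    obtain ⟨a, b, c, c', hc, hc', hab, rfl⟩ := hx
    induction w using BTensor.induction with
    | h0 => rw [map_zero, TensorProduct.tmul_zero, map_zero, map_zero]
    | h2 x y hx hy =>
      rw [map_add, TensorProduct.tmul_add, TensorProduct.tmul_add, map_add, map_add, map_add,
        hx, hy]
    | h1 d d' =>
      rw [BTensor.lAct_tmul, twist_tmul, twist_tmul]
      refine bigraded_ext_comp (R := R) (f := preSlot R T c (lAct k S D (h⁻¹ • s) d ⊗ₜ d'))
        (f' := lAct k (SkewMonoidAlgebra S G) _ (SkewMonoidAlgebra.single 1 s) ∘ₗ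
          preSlot R T c (d ⊗ₜ d')) (fun i c' hi hb => ?_) hc'
      change preTwist (R := R) (T := T) ((c ⊗ₜ c') ⊗ₜ (lAct k S D (h⁻¹ • s) d ⊗ₜ d')) =
        lAct k (SkewMonoidAlgebra S G) _ _ (preTwist (R := R) (T := T) ((c ⊗ₜ c') ⊗ₜ (d ⊗ₜ d')))
      have hba : b • h⁻¹ • s = a⁻¹ • s := by
        rw [← hab, smul_smul, mul_inv_rev, mul_inv_cancel_left]
      rw [preTwist_tmul hi hb, preTwist_tmul hi hb, BTensor.lAct_tmul, TwistedProduct.lAct_s,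
        TwistedProduct.leftS_mk hc, map_lAct, T.left_compat, hba]

variable (R T)

/-- The diagonal map `Δ_X = (1 ⊗ τ ⊗ 1) (Δ_C ⊗ Δ_D)` of the twisted product. -/
def diagX : TwistedRes R T →ₗ[Env k (SkewMonoidAlgebra S G)]
    BTensor k (SkewMonoidAlgebra S G) (TwistedRes R T) (TwistedRes R T) :=
  TwistedProduct.bimodHom
    (TwistedProduct.ofTensor _ _ <|
      twist R T ∘ₗ TensorProduct.map (R.Δ.restrictScalars k) (T.Δ.restrictScalars k))
    (fun s h c hc d => by
      change twist R T (R.Δ c ⊗ₜ T.Δ (lAct k S D (h⁻¹ • s) d)) =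
        lAct k (SkewMonoidAlgebra S G) _ _ (twist R T (R.Δ c ⊗ₜ T.Δ d))
      rw [map_lAct T.Δ, twist_leftS s (R.Δ_comp h c hc)])
    (fun g c d => by
      change twist R T (R.Δ (lAct k (MonoidAlgebra k G) C _ c) ⊗ₜ T.Δ d) =
        lAct k (SkewMonoidAlgebra S G) _ _ (twist R T (R.Δ c ⊗ₜ T.Δ d))
      rw [map_lAct R.Δ]
      exact twist_gLeft g _ _)
    (fun s c d => by
      change twist R T (R.Δ c ⊗ₜ T.Δ (rAct k S D _ d)) =
        rAct k (SkewMonoidAlgebra S G) _ _ (twist R T (R.Δ c ⊗ₜ T.Δ d))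
      rw [map_rAct T.Δ, twist_rightS])
    (fun g c d => by
      change twist R T (R.Δ (rAct k (MonoidAlgebra k G) C _ c) ⊗ₜ T.Δ (T.ρ g⁻¹ d)) =
        rAct k (SkewMonoidAlgebra S G) _ _ (twist R T (R.Δ c ⊗ₜ T.Δ d))
      rw [map_rAct R.Δ, T.Δ_ρ]
      exact twist_rightG g _ _)

theorem diagX_mk (c : C) (d : D) :
    diagX R T (TwistedProduct.mk _ _ c d) = twist R T (R.Δ c ⊗ₜ T.Δ d) := rfl

/-- The sign map `ε_X = ε_C ⊗ ε_D` of the twisted product, `x ↦ (-1)^|x| x`. -/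
def sgnX : TwistedRes R T →ₗ[Env k (SkewMonoidAlgebra S G)] TwistedRes R T :=
  TwistedProduct.bimodHom
    (TwistedProduct.map _ _ (R.sgn.restrictScalars k) (T.sgn.restrictScalars k))
    (fun s h c hc d => by
      rw [TwistedProduct.map_mk, TwistedProduct.map_mk, TwistedProduct.lAct_s]
      exact (congrArg _ (map_lAct T.sgn _ d)).trans
        (TwistedProduct.leftS_mk (sgn_comp hc) s _).symm)
    (fun g c d => by
      rw [TwistedProduct.map_mk, TwistedProduct.map_mk, TwistedProduct.lAct_g,
        TwistedProduct.leftG_mk]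
      exact congrArg (fun e => TwistedProduct.mk _ _ e (T.sgn d)) (map_lAct R.sgn _ c))
    (fun s c d => by
      rw [TwistedProduct.map_mk, TwistedProduct.map_mk, TwistedProduct.rAct_s,
        TwistedProduct.rightS_mk]
      exact congrArg _ (map_rAct T.sgn _ d))
    (fun g c d => by
      rw [TwistedProduct.map_mk, TwistedProduct.map_mk, TwistedProduct.rAct_g,
        TwistedProduct.rightG_mk]
      exact congrArg₂ (fun e e' => TwistedProduct.mk _ _ e e') (map_rAct R.sgn _ c)
        (sgn_ρ g⁻¹ d))

/-- The map `1 ⊗ τ⁻¹ ⊗ 1 : X ⊗ X → (C ⊗_{kG} C) ⊗ (D ⊗_S D)` before passing to `X ⊗_{S ⋊ G} X`,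
as a bilinear map. -/
def preUntwist : TwistedRes R T →ₗ[k] TwistedRes R T →ₗ[k]
    BTensor k (MonoidAlgebra k G) C C ⊗[k] BTensor k S D D :=
  (TensorProduct.curry (TensorProduct.map (BTensor.proj k (MonoidAlgebra k G) C C)
    (BTensor.proj k S D D) ∘ₗ innerMap C D (tauInv R T))).compl₁₂
    (TwistedProduct.of R.toGroupGrading T.toCompatibleAction).symm.toLinearMap
    (TwistedProduct.of R.toGroupGrading T.toCompatibleAction).symm.toLinearMap

variable {R T}

theorem preUntwist_mk {i : ℕ} {g : G} {c' : C} (hi : c' ∈ R.gr i) (hg : c' ∈ R.comp g)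
    (c : C) (d d' : D) :
    preUntwist R T (TwistedProduct.mk _ _ c d) (TwistedProduct.mk _ _ c' d') =
      BTensor.tmul k (MonoidAlgebra k G) c c' ⊗ₜ
        BTensor.tmul k S (T.ρ g⁻¹ (T.sgnPow i d)) d' := by
  change TensorProduct.map _ _ (innerMap C D (tauInv R T) ((c ⊗ₜ d) ⊗ₜ (c' ⊗ₜ d'))) = _
  rw [innerMap_tmul _ (tauInv_tmul hi hg d)]; rfl

theorem twistedRes_ext₂ {Q : Type*} [AddCommGroup Q] [Module k Q]
    {f f' : TwistedRes R T →ₗ[k] TwistedRes R T →ₗ[k] Q}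
    (h : ∀ i g c c' d d', c' ∈ R.gr i → c' ∈ R.comp g →
      f (TwistedProduct.mk _ _ c d) (TwistedProduct.mk _ _ c' d') =
        f' (TwistedProduct.mk _ _ c d) (TwistedProduct.mk _ _ c' d')) : f = f' :=
  TwistedProduct.hom_ext fun _ c _ d => TensorProduct.ext <|
    bigraded_ext (R := R) fun i g c' hi hg => LinearMap.ext fun d' => h i g c c' d d' hi hg

variable (R T)

/-- The map `1 ⊗ τ⁻¹ ⊗ 1 : X ⊗_{S ⋊ G} X → (C ⊗_{kG} C) ⊗ (D ⊗_S D)`. -/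
def untwist : BTensor k (SkewMonoidAlgebra S G) (TwistedRes R T) (TwistedRes R T) →ₗ[k]
    BTensor k (MonoidAlgebra k G) C C ⊗[k] BTensor k S D D :=
  BTensor.lift (preUntwist R T) <| TwistedProduct.balanced_of _
    (fun s x y => LinearMap.congr_fun₂
      (f := preUntwist R T ∘ₗ TwistedProduct.rightS R.toGroupGrading T.toCompatibleAction s)
      (g := (preUntwist R T).compl₂
        (lAct k (SkewMonoidAlgebra S G) _ (SkewMonoidAlgebra.single 1 s)))
      (twistedRes_ext₂ fun i h c c' d d' hi hh => by
        rw [LinearMap.comp_apply, LinearMap.compl₂_apply, TwistedProduct.lAct_s,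
          TwistedProduct.leftS_mk hh, TwistedProduct.rightS_mk, preUntwist_mk hi hh,
          preUntwist_mk hi hh, map_rAct, T.right_compat, BTensor.balanced,
          MulOpposite.unop_op]) x y)
    (fun g x y => LinearMap.congr_fun₂
      (f := preUntwist R T ∘ₗ TwistedProduct.rightG R.toGroupGrading T.toCompatibleAction g)
      (g := (preUntwist R T).compl₂
        (lAct k (SkewMonoidAlgebra S G) _ (SkewMonoidAlgebra.single g 1)))
      (twistedRes_ext₂ fun i h c c' d d' hi hh => by
        rw [LinearMap.comp_apply, LinearMap.compl₂_apply, TwistedProduct.lAct_g,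
          TwistedProduct.leftG_mk, TwistedProduct.rightG_mk, preUntwist_mk hi hh,
          preUntwist_mk (gLeft_gr hi g) (R.gLeft_mem hh), sgnPow_ρ, ← ρ_mul, ← mul_inv_rev]
        congr 1
        exact BTensor.balanced (k := k) (A := MonoidAlgebra k G) c
          (MulOpposite.op (MonoidAlgebra.of k G g)) c') x y)

variable {R T} in
theorem sgnPow_sgnPow (i : ℕ) (d : D) : T.sgnPow i (T.sgnPow i d) = d := by
  have h : (T.sgn : Module.End (Env k S) D) * T.sgn = 1 := LinearMap.ext fun x =>
    LinearMap.congr_fun (f := (T.sgn.restrictScalars k).comp (T.sgn.restrictScalars k))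
      (g := LinearMap.id) (graded_hom_ext T.gr fun n m hm => by
        change T.sgn (T.sgn m) = m
        rw [T.sgn_of_mem hm, T.sgn_of_mem (Submodule.smul_of_tower_mem _ _ hm), smul_smul,
          ← mul_pow, neg_one_mul, neg_neg, one_pow, one_smul]) x
  have h' : (T.sgn : Module.End (Env k S) D) ^ i * T.sgn ^ i = 1 := by
    rw [← (Commute.refl (T.sgn : Module.End (Env k S) D)).mul_pow, h, one_pow]
  exact LinearMap.congr_fun h' d

/-- `1 ⊗ τ⁻¹ ⊗ 1` is a two-sided inverse of `1 ⊗ τ ⊗ 1`. -/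
theorem untwist_twist : untwist R T ∘ₗ twist R T = LinearMap.id :=
  twist_ext (R := R) fun i g c c' d d' hi hg => by
    rw [LinearMap.comp_apply, twist_tmul, preTwist_tmul hi hg]
    change preUntwist R T _ _ = _
    rw [preUntwist_mk hi hg, sgnPow_ρ, ρ_inv_ρ, sgnPow_sgnPow]; rfl

theorem twist_untwist : twist R T ∘ₗ untwist R T = LinearMap.id :=
  BTensor.hom_ext fun x y => LinearMap.congr_fun₂
    (f := (BTensor.mk k (SkewMonoidAlgebra S G) _ _).compr₂ (twist R T ∘ₗ untwist R T))
    (g := BTensor.mk k (SkewMonoidAlgebra S G) (TwistedRes R T) (TwistedRes R T))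
    (twistedRes_ext₂ fun i g c c' d d' hi hg => by
      change twist R T (preUntwist R T _ _) = _
      rw [preUntwist_mk hi hg, twist_tmul, preTwist_tmul hi hg, sgnPow_ρ, ρ_ρ_inv,
        sgnPow_sgnPow]; rfl) x y

/-- `φ_X = (φ_C ⊗ (μ_D ⊗ 1_D) + (1_C ⊗ μ_C) (ε_C ⊗ 1) ⊗ φ_D) (1 ⊗ τ⁻¹ ⊗ 1)`. -/
def phiX (φC : BTensor k (MonoidAlgebra k G) C C →ₗ[Env k (MonoidAlgebra k G)] C)
    (φD : BTensor k S D D →ₗ[Env k S] D) :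
    BTensor k (SkewMonoidAlgebra S G) (TwistedRes R T) (TwistedRes R T) →ₗ[k] TwistedRes R T :=
  (TwistedProduct.of _ _).toLinearMap ∘ₗ
    (TensorProduct.map (φC.restrictScalars k) ((BTensor.evalLeft T.aug).restrictScalars k) +
      TensorProduct.map
        (((BTensor.evalRight R.aug).comp (BTensor.map R.sgn LinearMap.id)).restrictScalars k)
        (φD.restrictScalars k)) ∘ₗ untwist R T

/-- The differential `∂ ⊗ 1 + ε ⊗ ∂` of `X`: `c ⊗ d ↦ ∂c ⊗ d + (-1)^|c| c ⊗ ∂d`. -/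
def dX : TwistedRes R T →ₗ[k] TwistedRes R T :=
  TwistedProduct.map _ _ (R.d.restrictScalars k) LinearMap.id +
    TwistedProduct.map _ _ (R.sgn.restrictScalars k) (T.d.restrictScalars k)

/-- The component `X_n = ⨁_{i + j = n} C_i ⊗ D_j`. -/
def grX (n : ℕ) : Submodule k (TwistedRes R T) :=
  Submodule.span k {x | ∃ i j c d, c ∈ R.gr i ∧ d ∈ T.gr j ∧ i + j = n ∧
    x = TwistedProduct.mk _ _ c d}

/-- The augmentation `X → S ⋊ G`, `c ⊗ d ↦ μ_C(c) μ_D(d)`, a product in `S ⋊ G ⊇ kG, S`. -/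
def augX : TwistedRes R T →ₗ[k] SkewMonoidAlgebra S G :=
  TwistedProduct.ofTensor _ _ <| TensorProduct.lift
    ((LinearMap.mul k (SkewMonoidAlgebra S G)).compl₁₂
    ((MonoidAlgebra.lift k (SkewMonoidAlgebra S G) G (SkewMonoidAlgebra.of S G)).toLinearMap ∘ₗ
      R.aug.restrictScalars k)
    (SkewMonoidAlgebra.lsingle k 1 ∘ₗ T.aug.restrictScalars k))

/-- `f` is a cocycle in `Hom_{Aᵉ}(X_n, A)`, `A = S ⋊ G`, extended by zero to all of `X`. -/
def IsCocycleX (n : ℕ)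
    (f : TwistedRes R T →ₗ[Env k (SkewMonoidAlgebra S G)] SkewMonoidAlgebra S G) : Prop :=
  (∀ m, m ≠ n → ∀ x ∈ grX R T m, f x = 0) ∧ ∀ x, f (dX R T x) = 0

/-- The map `f ∘_X f'` for a cochain `f'` of degree `m`: the composite
`X → X ⊗ X → X ⊗ (X ⊗ X) → X ⊗ X → X → A` (all tensor products over `A = S ⋊ G`) of `Δ_X`,
`1 ⊗ Δ_X`, `1 ⊗ f' ⊗ 1 : x ⊗ y ⊗ z ↦ (-1)^(|x| m) x ⊗ f'(y) z`, `φ_X` and `f`. -/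
def circX (φC : BTensor k (MonoidAlgebra k G) C C →ₗ[Env k (MonoidAlgebra k G)] C)
    (φD : BTensor k S D D →ₗ[Env k S] D) (m : ℕ)
    (f f' : TwistedRes R T →ₗ[Env k (SkewMonoidAlgebra S G)] SkewMonoidAlgebra S G) :
    TwistedRes R T →ₗ[k] SkewMonoidAlgebra S G :=
  f.restrictScalars k ∘ₗ phiX R T φC φD ∘ₗ
    (BTensor.map ((sgnX R T : Module.End (Env k (SkewMonoidAlgebra S G)) (TwistedRes R T)) ^ m)
      (BTensor.evalLeft f')).restrictScalars k ∘ₗ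
    (BTensor.map LinearMap.id (diagX R T)).restrictScalars k ∘ₗ (diagX R T).restrictScalars k

/-- `[f, f']_X = f ∘_X f' - (-1)^((n-1)(m-1)) f' ∘_X f` for cochains of degrees `n`, `m`. (The
exponent `(n + 1) (m + 1)` has the same parity.) -/
def bracketX (φC : BTensor k (MonoidAlgebra k G) C C →ₗ[Env k (MonoidAlgebra k G)] C)
    (φD : BTensor k S D D →ₗ[Env k S] D) (n m : ℕ)
    (f f' : TwistedRes R T →ₗ[Env k (SkewMonoidAlgebra S G)] SkewMonoidAlgebra S G) :
    TwistedRes R T →ₗ[k] SkewMonoidAlgebra S G :=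
  circX R T φC φD m f f' - (-1 : k) ^ ((n + 1) * (m + 1)) • circX R T φC φD n f' f

/-- The multilinear maps `θₙ : Aⁿ → X_n` are the components of a chain map of bimodules from the
bar resolution of `A = S ⋊ G` to `X` that lifts the identity of `A`. -/
def IsBarComparison (θ : ∀ n : ℕ,
    MultilinearMap k (fun _ : Fin n => SkewMonoidAlgebra S G) (TwistedRes R T)) : Prop :=
  (∀ n a, θ n a ∈ grX R T n) ∧
    (∀ n a, dX R T (θ (n + 1) a) = hochD k (SkewMonoidAlgebra S G) (θ n) a) ∧
    ∀ a, augX R T (θ 0 a) = 1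

/-- A comparison map from the bar resolution of `A = S ⋊ G` to `X`. -/
structure BarComparison where
  /-- The components. -/
  toFun : ∀ n : ℕ, MultilinearMap k (fun _ : Fin n => SkewMonoidAlgebra S G) (TwistedRes R T)
  isBarComparison : IsBarComparison R T toFun

variable {R T}

/-- The Hochschild cochain `F : Aⁿ → A` and the cochain `f` of degree `n` on `X` represent the same
class of Hochschild cohomology, under the identification given by the comparison map `θ`. -/
def SameClass (θ : BarComparison R T) (n : ℕ)
    (f : TwistedRes R T →ₗ[Env k (SkewMonoidAlgebra S G)] SkewMonoidAlgebra S G)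
    (F : (Fin n → SkewMonoidAlgebra S G) → SkewMonoidAlgebra S G) : Prop :=
  IsHochCoboundary k (SkewMonoidAlgebra S G) n fun a => F a - f (θ.toFun n a)

end Twisted

end

/-!
A bimodule map from the bar resolution of `A` to a bimodule `M`, taken in all degrees at once, is a
function of words `List A → M` that is linear in each letter (`BarCochain.Multi`). The Hochschild
differential, the cup product and the circle product become recursions on the first letter of a
word. The classical formula `BarCochain.diff_insertion` says that the circle product `t ∘ F` is a
homotopy for the commutativity of the cup product; `t` may take values in any bimodule.

A chain map from the bar resolution to an acyclic complex is null-homotopic if its composite with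
the augmentation is a coboundary, since the homotopy can be written down with a contraction of the
underlying complex of vector spaces (`BarCochain.exists_homotopy`). The same recursion produces a
comparison map (`nonempty_barComparison`).

The argument for the bracket takes place in a `DiagonalComplex`: an acyclic complex `X` of bimodules
with a counital diagonal `Δ` and a homotopy `φ` from `μ ⊗ 1` to `1 ⊗ μ`. For a cocycle `f'` the map
`ψ = φ (1 ⊗ f' ⊗ 1) (1 ⊗ Δ) Δ` is a homotopy lifting: its commutator with the differential is, up to
sign, `(f' ⊗ 1 - 1 ⊗ f') Δ` (`IsCocycle.d_lifting`). Let `θ` be a comparison map. Inserting `f' θ`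
into `θ` gives a map that satisfies the same equation along `θ`, except that the diagonal `θ ∪ θ` of
the bar resolution takes the place of `Δ θ` (`IsCocycle.d_insertion`). The complex `X ⊗_A X` is
acyclic, so `Δ θ` and `θ ∪ θ` differ by a homotopy `H`. Thus `ψ θ` and the insertion differ by
`(f' ⊗ 1 - 1 ⊗ f') H` up to a null-homotopic map, and `f ψ θ` is the circle product of `f θ` and
`f' θ` up to a coboundary and the term `f (f' ⊗ 1 - 1 ⊗ f') H` (`IsCocycle.lifting_insertion`). Such
a term is antisymmetric in `f` and `f'` up to sign (`IsCocycle.map_comm`), and therefore cancels in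
the bracket (`IsCocycle.bracket_comp`). As the bracket of a cocycle and a coboundary is a coboundary
(`BarCochain.exists_bracket_diff`), the class of the bracket depends only on those of `f` and `f'`
(`IsCocycle.bracket_represents`).

The twisted product `X = C ⊗^G D` is such a complex (`twistedComplex`). The twist `1 ⊗ τ ⊗ 1` is an
isomorphism of complexes from `(C ⊗_{kG} C) ⊗ (D ⊗_S D)` to `X ⊗_A X` (`twist_dZ`), compatible with
the augmentations (`evalLeft_twist`, `evalRight_twist`). So `Δ_X` is a counital chain map and `φ_X` a
homotopy (`phiX_homotopy`), and contractions of `C` and `D` combine to one of `X`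
(`exists_contractionX`). That `φ_X` is a bimodule map if `φ_C` is graded and `φ_D` equivariant
(`phiX_env_smul`) is checked on the actions of `S` and `G` from both sides, as the twist transports
them to actions on the two tensor factors.
-/

noncomputable section

set_option linter.unusedSectionVars false

/-! ### Cochains on the bar resolution as functions of words -/

namespace BarCochain

section Basic

variable {k : Type*} [Field k] {A : Type*} [Ring A] [Algebra k A]
variable {M : Type*} [AddCommGroup M] [Module k M] [Module (Env k A) M]
  [IsScalarTower k (Env k A) M]

variable (k M) in
/-- The cochain `w ↦ t (a :: w)`. -/
def shift (a : A) : (List A → M) →ₗ[k] (List A → M) := LinearMap.funLeft k M (List.cons a)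

@[simp] theorem shift_apply (a : A) (t : List A → M) (w : List A) :
    shift k M a t w = t (a :: w) := rfl

variable (k M) in
/-- The cochain obtained from `t` by letting `a` multiply the first letter of a word from the left,
or the value `t []` from the right if there is no such letter. -/
def headMul (a : A) : (List A → M) →ₗ[k] (List A → M) :=
  LinearMap.pi fun w => match w with
    | [] => (rAct k A M (MulOpposite.op a)).comp (LinearMap.proj [])
    | c :: v => LinearMap.proj ((a * c) :: v)

@[simp] theorem headMul_nil (a : A) (t : List A → M) :
    headMul k M a t [] = rAct k A M (MulOpposite.op a) (t []) := rfl

@[simp] theorem headMul_cons (a c : A) (t : List A → M) (v : List A) :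
    headMul k M a t (c :: v) = t ((a * c) :: v) := rfl

variable (k M) in
/-- The value of `rightDiff` at a given word. -/
def rightDiffAt : List A → (List A → M) →ₗ[k] M
  | [] => 0
  | a :: w => (LinearMap.proj w).comp (headMul k M a) - (rightDiffAt w).comp (shift k M a)

variable (k A M) in
/-- The part of the Hochschild differential that does not involve the left action, with the
opposite sign: `t ↦ ∑ᵢ (-1)ⁱ t (…, aᵢ aᵢ₊₁, …) + (-1)ⁿ t (a₀, …, aₙ₋₁) aₙ`, `0 ≤ i < n`. -/
def rightDiff : (List A → M) →ₗ[k] (List A → M) := LinearMap.pi (rightDiffAt k M)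

@[simp] theorem rightDiff_nil (t : List A → M) : rightDiff k A M t [] = 0 := rfl

theorem rightDiff_cons (t : List A → M) (a : A) (w : List A) :
    rightDiff k A M t (a :: w) = headMul k M a t w - rightDiff k A M (shift k M a t) w := rfl

theorem shift_rightDiff (t : List A → M) (a : A) :
    shift k M a (rightDiff k A M t) = headMul k M a t - rightDiff k A M (shift k M a t) := rfl

variable (k A M) in
/-- The part `(a₀, …, aₙ) ↦ a₀ t (a₁, …, aₙ)` of the Hochschild differential. -/
def leftMul : (List A → M) →ₗ[k] (List A → M) :=
  LinearMap.pi fun w => match w with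
    | [] => 0
    | a :: v => (lAct k A M a).comp (LinearMap.proj v)

@[simp] theorem leftMul_nil (t : List A → M) : leftMul k A M t [] = 0 := rfl

@[simp] theorem leftMul_cons (t : List A → M) (a : A) (w : List A) :
    leftMul k A M t (a :: w) = lAct k A M a (t w) := rfl

theorem shift_leftMul (t : List A → M) (a : A) :
    shift k M a (leftMul k A M t) = lAct k A M a ∘ t := rfl

variable (k A M) in
/-- The Hochschild differential on functions of words. A function of words stands for a bimodule map
from the bar resolution, taken in all degrees at once, and `diff` for composition with the
differential of the bar resolution. -/
def diff : (List A → M) →ₗ[k] (List A → M) := leftMul k A M - rightDiff k A M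

@[simp] theorem diff_nil (t : List A → M) : diff k A M t [] = 0 := sub_self _

theorem diff_cons (t : List A → M) (a : A) (w : List A) :
    diff k A M t (a :: w) = lAct k A M a (t w) - rightDiff k A M t (a :: w) := rfl

theorem diff_eq (t : List A → M) : diff k A M t = leftMul k A M t - rightDiff k A M t := rfl

variable {N : Type*} [AddCommGroup N] [Module k N] [Module (Env k A) N]
  [IsScalarTower k (Env k A) N]

theorem map_rightDiff (f : M →ₗ[k] N) (hf : ∀ b m, f (rAct k A M b m) = rAct k A N b (f m))
    (t : List A → M) (w : List A) :
    f (rightDiff k A M t w) = rightDiff k A N (f ∘ t) w := by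
  induction w generalizing t with
  | nil => simp
  | cons a w ih =>
    rw [rightDiff_cons, rightDiff_cons, map_sub, ih]
    congr 1
    cases w with
    | nil => exact hf _ _
    | cons c v => rfl

theorem rightDiff_lAct (a : A) (t : List A → M) (w : List A) :
    rightDiff k A M (lAct k A M a ∘ t) w = lAct k A M a (rightDiff k A M t w) :=
  (map_rightDiff (lAct k A M a) (fun b m => lAct_rAct a b m) t w).symm

theorem map_diff (f : M →ₗ[Env k A] N) (t : List A → M) (w : List A) :
    f (diff k A M t w) = diff k A N (f ∘ t) w := by
  cases w with
  | nil => simp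
  | cons a w =>
    rw [diff_cons, diff_cons, map_sub, map_lAct]
    exact congrArg _ (map_rightDiff (f.restrictScalars k) (fun b m => map_rAct f b m) t _)

/-- The differential of `t` at a word depends only on the values of `t` at words that are shorter
by one letter. -/
theorem diff_congr {t t' : List A → M} {w : List A}
    (h : ∀ v : List A, v.length + 1 = w.length → t v = t' v) :
    diff k A M t w = diff k A M t' w := by
  have key : ∀ (w : List A) (t t' : List A → M),
      (∀ v : List A, v.length + 1 = w.length → t v = t' v) →
      rightDiff k A M t w = rightDiff k A M t' w := by
    intro w
    induction w with
    | nil => intros; rfl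
    | cons a w ih =>
      intro t t' h
      rw [rightDiff_cons, rightDiff_cons, ih (shift k M a t) (shift k M a t')
        fun v hv => h _ (by simpa using hv)]
      congr 1
      cases w with
      | nil => exact congrArg _ (h [] rfl)
      | cons c v => exact h _ rfl
  cases w with
  | nil => simp
  | cons a w => rw [diff_cons, diff_cons, key _ t t' h, h w rfl]

theorem headMul_headMul (a c : A) (t : List A → M) (w : List A) :
    headMul k M c (headMul k M a t) w = headMul k M (a * c) t w := by
  cases w with
  | nil => simp
  | cons e v => simp [mul_assoc]

theorem shift_headMul (a c : A) (t : List A → M) :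
    shift k M c (headMul k M a t) = shift k M (a * c) t := rfl

theorem headMul_rightDiff (a : A) (t : List A → M) (w : List A) :
    headMul k M a (rightDiff k A M t) w = rightDiff k A M (headMul k M a t) w := by
  cases w with
  | nil => simp
  | cons c v =>
    rw [headMul_cons, rightDiff_cons, rightDiff_cons, headMul_headMul, shift_headMul]

theorem rightDiff_rightDiff (t : List A → M) (w : List A) :
    rightDiff k A M (rightDiff k A M t) w = 0 := by
  induction w generalizing t with
  | nil => simp
  | cons a w ih =>
    rw [rightDiff_cons, shift_rightDiff, map_sub, Pi.sub_apply, ih, headMul_rightDiff]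
    simp

theorem rightDiff_leftMul (t : List A → M) (w : List A) :
    rightDiff k A M (leftMul k A M t) w = leftMul k A M (diff k A M t) w := by
  cases w with
  | nil => simp
  | cons a w =>
    rw [rightDiff_cons, shift_leftMul, rightDiff_lAct, leftMul_cons]
    cases w with
    | nil => simp
    | cons c v => simp [diff_cons]

theorem diff_diff (t : List A → M) (w : List A) : diff k A M (diff k A M t) w = 0 := by
  rw [diff_eq (diff k A M t), Pi.sub_apply, ← rightDiff_leftMul, ← Pi.sub_apply, ← map_sub,
    diff_eq, sub_sub_cancel, rightDiff_rightDiff]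

/-! ### Deconcatenation and the cup product -/

variable (k A M) in
/-- The value of `splitSum` at a word. -/
def splitSumAt : List A → (List A → List A → M) →ₗ[k] M
  | [] => (LinearMap.proj [] : (List A → M) →ₗ[k] M).comp
      (LinearMap.proj [] : (List A → List A → M) →ₗ[k] (List A → M))
  | a :: w => (LinearMap.proj (a :: w) : (List A → M) →ₗ[k] M).comp
      (LinearMap.proj [] : (List A → List A → M) →ₗ[k] (List A → M)) +
      (splitSumAt w).comp (LinearMap.funLeft k (List A → M) (List.cons a))

variable (k A M) in
/-- `(splitSum g) w = ∑ g u v` over all factorisations `w = u v`. -/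
def splitSum : (List A → List A → M) →ₗ[k] (List A → M) := LinearMap.pi (splitSumAt k A M)

@[simp] theorem splitSum_nil (g : List A → List A → M) : splitSum k A M g [] = g [] [] := rfl

theorem splitSum_cons (g : List A → List A → M) (a : A) (w : List A) :
    splitSum k A M g (a :: w) = g [] (a :: w) + splitSum k A M (fun u v => g (a :: u) v) w := rfl

theorem map_splitSum (f : M →ₗ[k] N) (g : List A → List A → M) (w : List A) :
    f (splitSum k A M g w) = splitSum k A N (fun u v => f (g u v)) w := by
  induction w generalizing g with
  | nil => rfl
  | cons a w ih => rw [splitSum_cons, splitSum_cons, map_add, ih]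

theorem splitSum_congr {g g' : List A → List A → M} {w : List A}
    (h : ∀ u v, u ++ v = w → g u v = g' u v) : splitSum k A M g w = splitSum k A M g' w := by
  induction w generalizing g g' with
  | nil => exact h [] [] rfl
  | cons a w ih =>
    rw [splitSum_cons, splitSum_cons, h [] (a :: w) rfl,
      ih fun u v huv => h (a :: u) v (by rw [← huv]; rfl)]

theorem splitSum_smul' (r : k) (g : List A → List A → M) (w : List A) :
    splitSum k A M (fun u v => r • g u v) w = r • splitSum k A M g w :=
  congrFun (map_smul (splitSum k A M) r g) w

theorem splitSum_add' (g g' : List A → List A → M) (w : List A) :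
    splitSum k A M (fun u v => g u v + g' u v) w =
      splitSum k A M g w + splitSum k A M g' w :=
  congrFun (map_add (splitSum k A M) g g') w

theorem splitSum_sub' (g g' : List A → List A → M) (w : List A) :
    splitSum k A M (fun u v => g u v - g' u v) w =
      splitSum k A M g w - splitSum k A M g' w :=
  congrFun (map_sub (splitSum k A M) g g') w

theorem splitSum_neg' (g : List A → List A → M) (w : List A) :
    splitSum k A M (fun u v => - g u v) w = - splitSum k A M g w :=
  congrFun (map_neg (splitSum k A M) g) w

theorem splitSum_zero' (w : List A) :
    splitSum k A M (fun _ _ => (0 : M)) w = 0 :=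
  congrFun (map_zero (splitSum k A M)) w

variable (k A) in
/-- The cup product `(s ∪ t) (w) = ∑ s u ⊗ t v`, `w = u v`, with values in `M ⊗_A N`. -/
def cup (s : List A → M) (t : List A → N) : List A → BTensor k A M N :=
  splitSum k A (BTensor k A M N) fun u v => BTensor.tmul k A (s u) (t v)

variable (k) in
/-- The sign involution `t ↦ (w ↦ (-1)^|w| t w)`; on cochains of degree `n` it is the sign
`(-1)^n`. -/
def wsign (t : List A → M) : List A → M := fun w => (-1 : k) ^ w.length • t w

@[simp] theorem wsign_nil (t : List A → M) : wsign k t [] = t [] := by simp [wsign]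

theorem wsign_cons (t : List A → M) (a : A) (w : List A) :
    wsign k t (a :: w) = - wsign k (shift k M a t) w := by
  simp [wsign, pow_succ]

end Basic
end BarCochain

/-! ### Calculus in balanced tensor products -/

section BTensorLemmas

variable {k : Type*} [Field k] {A : Type*} [Ring A] [Algebra k A]
variable {M : Type*} [AddCommGroup M] [Module k M] [Module (Env k A) M]
  [IsScalarTower k (Env k A) M]
variable {N : Type*} [AddCommGroup N] [Module k N] [Module (Env k A) N]
  [IsScalarTower k (Env k A) N]
variable {Q : Type*} [AddCommGroup Q] [Module k Q] [Module (Env k A) Q]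
  [IsScalarTower k (Env k A) Q]

theorem BTensor.tmul_add (m : M) (n n' : N) : BTensor.tmul k A m (n + n') =
    BTensor.tmul k A m n + BTensor.tmul k A m n' := map_add (BTensor.mk k A M N m) n n'

theorem BTensor.tmul_sub (m : M) (n n' : N) : BTensor.tmul k A m (n - n') =
    BTensor.tmul k A m n - BTensor.tmul k A m n' := map_sub (BTensor.mk k A M N m) n n'

theorem BTensor.add_tmul (m m' : M) (n : N) : BTensor.tmul k A (m + m') n =
    BTensor.tmul k A m n + BTensor.tmul k A m' n := LinearMap.map_add₂ (BTensor.mk k A M N) m m' n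

theorem BTensor.sub_tmul (m m' : M) (n : N) : BTensor.tmul k A (m - m') n =
    BTensor.tmul k A m n - BTensor.tmul k A m' n := LinearMap.map_sub₂ (BTensor.mk k A M N) m m' n

theorem BTensor.neg_tmul (m : M) (n : N) : BTensor.tmul k A (-m) n =
    - BTensor.tmul k A m n := LinearMap.map_neg₂ (BTensor.mk k A M N) m n

theorem BTensor.zero_tmul (n : N) : BTensor.tmul k A (0 : M) n = 0 :=
  LinearMap.map_zero₂ (BTensor.mk k A M N) n

theorem BTensor.tmul_zero (m : M) : BTensor.tmul k A m (0 : N) = 0 :=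
  map_zero (BTensor.mk k A M N m)

theorem BTensor.smul_tmul (r : k) (m : M) (n : N) : BTensor.tmul k A (r • m) n =
    r • BTensor.tmul k A m n := LinearMap.map_smul₂ (BTensor.mk k A M N) r m n

theorem BTensor.tmul_smul (r : k) (m : M) (n : N) : BTensor.tmul k A m (r • n) =
    r • BTensor.tmul k A m n := map_smul (BTensor.mk k A M N m) r n

theorem BTensor.envHom_ext {f g : BTensor k A M N →ₗ[Env k A] Q}
    (h : ∀ m n, f (BTensor.tmul k A m n) = g (BTensor.tmul k A m n)) : f = g :=
  LinearMap.ext fun z => LinearMap.congr_fun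
    (BTensor.hom_ext (f := f.restrictScalars k) (g := g.restrictScalars k) h) z

theorem envMap_smul (f : M →ₗ[Env k A] N) (r : k) (m : M) : f (r • m) = r • f m :=
  (f.restrictScalars k).map_smul r m

theorem neg_one_pow_smul_smul {V : Type*} [AddCommGroup V] [Module k V] (m : ℕ) (v : V) :
    (-1 : k) ^ m • (-1 : k) ^ m • v = v := by
  rw [smul_smul, ← mul_pow]; simp

end BTensorLemmas

namespace BarCochain

section Cup

variable {k : Type*} [Field k] {A : Type*} [Ring A] [Algebra k A]
variable {M : Type*} [AddCommGroup M] [Module k M] [Module (Env k A) M]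
  [IsScalarTower k (Env k A) M]
variable {N : Type*} [AddCommGroup N] [Module k N] [Module (Env k A) N]
  [IsScalarTower k (Env k A) N]

@[simp] theorem cup_nil (s : List A → M) (t : List A → N) :
    cup k A s t [] = BTensor.tmul k A (s []) (t []) := rfl

theorem cup_cons (s : List A → M) (t : List A → N) (a : A) (w : List A) :
    cup k A s t (a :: w) =
      BTensor.tmul k A (s []) (t (a :: w)) + cup k A (shift k M a s) t w := rfl

theorem cup_sub_left (s s' : List A → M) (t : List A → N) (w : List A) :
    cup k A (s - s') t w = cup k A s t w - cup k A s' t w := by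
  simp only [cup, ← splitSum_sub', Pi.sub_apply, BTensor.sub_tmul]

theorem cup_neg_left (s : List A → M) (t : List A → N) (w : List A) :
    cup k A (-s) t w = - cup k A s t w := by
  simp only [cup, ← splitSum_neg', Pi.neg_apply, BTensor.neg_tmul]

theorem leftMul_cup (s : List A → M) (t : List A → N) (w : List A) :
    leftMul k A _ (cup k A s t) w = cup k A (leftMul k A M s) t w := by
  cases w with
  | nil => simp [BTensor.zero_tmul]
  | cons a w =>
    rw [leftMul_cons, cup_cons, leftMul_nil, BTensor.zero_tmul, zero_add, shift_leftMul]
    rw [cup, map_splitSum]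
    simp only [BTensor.lAct_tmul]
    rfl

theorem headMul_cup (a : A) (s : List A → M) (t : List A → N) (w : List A) :
    headMul k _ a (cup k A s t) w = cup k A (headMul k M a s) t w
      - BTensor.tmul k A (s []) (lAct k A N a (t w))
      + BTensor.tmul k A (s []) (headMul k N a t w) := by
  cases w with
  | nil => simp [BTensor.balanced]
  | cons c v =>
    rw [headMul_cons, headMul_cons, cup_cons, cup_cons, shift_headMul, headMul_nil,
      BTensor.balanced, MulOpposite.unop_op]
    abel

theorem wsign_cons' (t : List A → M) (a : A) :
    shift k M a (wsign k t) = - wsign k (shift k M a t) :=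
  funext fun w => wsign_cons t a w

theorem rightDiff_cup (s : List A → M) (t : List A → N) (w : List A) :
    rightDiff k A _ (cup k A s t) w =
      cup k A (rightDiff k A M s) t w - cup k A (wsign k s) (diff k A N t) w := by
  induction w generalizing s with
  | nil => simp [BTensor.zero_tmul, BTensor.tmul_zero]
  | cons a w ih =>
    have h1 : shift k _ a (cup k A s t) =
        BTensor.mk k A M N (s []) ∘ shift k N a t + cup k A (shift k M a s) t := rfl
    have h2 : rightDiff k A _ (BTensor.mk k A M N (s []) ∘ shift k N a t) w =
        BTensor.tmul k A (s []) (rightDiff k A N (shift k N a t) w) :=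
      (map_rightDiff (BTensor.mk k A M N (s []))
        (fun b n => (BTensor.rAct_tmul b (s []) n).symm) (shift k N a t) w).symm
    rw [rightDiff_cons, h1, map_add, Pi.add_apply, h2, ih, headMul_cup, cup_cons, cup_cons,
      rightDiff_nil, BTensor.zero_tmul, zero_add, shift_rightDiff, cup_sub_left, wsign_cons',
      cup_neg_left, diff_cons, rightDiff_cons, wsign_nil, BTensor.tmul_sub, BTensor.tmul_sub]
    abel

/-- The Leibniz rule for the Hochschild differential and the cup product. -/
theorem diff_cup (s : List A → M) (t : List A → N) (w : List A) :
    diff k A _ (cup k A s t) w =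
      cup k A (diff k A M s) t w + cup k A (wsign k s) (diff k A N t) w := by
  rw [diff_eq, Pi.sub_apply, leftMul_cup, rightDiff_cup, diff_eq s, cup_sub_left]
  abel

end Cup

/-! ### Insertion of a cochain into a cochain -/

section Insertion

variable {k : Type*} [Field k] {A : Type*} [Ring A] [Algebra k A]
variable {M : Type*} [AddCommGroup M] [Module k M] [Module (Env k A) M]
  [IsScalarTower k (Env k A) M]

variable (k M) in
/-- Insertion of `F` in the first slot: `t ↦ (w ↦ ∑ t (F u :: v))`, `w = u v`. -/
def insertHead (F : List A → A) : (List A → M) →ₗ[k] (List A → M) :=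
  (splitSum k A M).comp
    (LinearMap.pi fun u => LinearMap.funLeft k M fun v => F u :: v)

theorem insertHead_apply (F : List A → A) (t : List A → M) (w : List A) :
    insertHead k M F t w = splitSum k A M (fun u v => t (F u :: v)) w := rfl

@[simp] theorem insertHead_nil (F : List A → A) (t : List A → M) :
    insertHead k M F t [] = t [F []] := rfl

theorem insertHead_cons (F : List A → A) (t : List A → M) (a : A) (w : List A) :
    insertHead k M F t (a :: w) =
      t (F [] :: a :: w) + insertHead k M (fun u => F (a :: u)) t w := rfl

variable (k M) in
/-- The value of `insertion` at a word. -/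
def insertionAt (F : List A → A) (σ : k) : List A → (List A → M) →ₗ[k] M
  | [] => (LinearMap.proj []).comp (insertHead k M F)
  | a :: w => (LinearMap.proj (a :: w)).comp (insertHead k M F) +
      σ • (insertionAt F σ w).comp (shift k M a)

variable (k M) in
/-- The circle product `t ↦ t ∘ F`, the sum over all insertions of a value of `F` into `t`, in which
`σ ^ i` is the sign of the insertion behind `i` letters. For `F` of degree `m` the sign is
`σ = (-1)^(m-1)`. -/
def insertion (F : List A → A) (σ : k) : (List A → M) →ₗ[k] (List A → M) :=
  LinearMap.pi (insertionAt k M F σ)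

@[simp] theorem insertion_nil (F : List A → A) (σ : k) (t : List A → M) :
    insertion k M F σ t [] = t [F []] := rfl

theorem insertion_cons (F : List A → A) (σ : k) (t : List A → M) (a : A) (w : List A) :
    insertion k M F σ t (a :: w) =
      insertHead k M F t (a :: w) + σ • insertion k M F σ (shift k M a t) w := rfl

theorem shift_insertion (F : List A → A) (σ : k) (t : List A → M) (a : A) :
    shift k M a (insertion k M F σ t) =
      shift k M a (insertHead k M F t) + σ • insertion k M F σ (shift k M a t) := rfl

/-- The cochain `t` is linear in each letter of a word. -/
def Multi (k : Type*) [Field k] {A : Type*} [Ring A] [Algebra k A] {M : Type*} [AddCommGroup M]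
    [Module k M] (t : List A → M) : Prop :=
  ∀ u v : List A, IsLinearMap k fun x => t (u ++ x :: v)

theorem Multi.shift {t : List A → M} (ht : Multi k t) (a : A) : Multi k (shift k M a t) :=
  fun u v => ht (a :: u) v

theorem Multi.head {t : List A → M} (ht : Multi k t) (v : List A) :
    IsLinearMap k fun x => t (x :: v) := ht [] v

theorem Multi.head_zero {t : List A → M} (ht : Multi k t) (v : List A) : t (0 :: v) = 0 :=
  (ht.head v).map_zero

theorem Multi.head_add {t : List A → M} (ht : Multi k t) (x y : A) (v : List A) :
    t ((x + y) :: v) = t (x :: v) + t (y :: v) := (ht.head v).map_add x y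

theorem Multi.head_sub {t : List A → M} (ht : Multi k t) (x y : A) (v : List A) :
    t ((x - y) :: v) = t (x :: v) - t (y :: v) := (ht.head v).map_sub x y

theorem Multi.head_smul {t : List A → M} (ht : Multi k t) (r : k) (y : A) (v : List A) :
    t ((r • y) :: v) = r • t (y :: v) := (ht.head v).map_smul r y

theorem isLinearMap_add {V W : Type*} [AddCommGroup V] [Module k V] [AddCommGroup W] [Module k W]
    {f g : V → W} (hf : IsLinearMap k f) (hg : IsLinearMap k g) :
    IsLinearMap k fun x => f x + g x :=
  (hf.mk' f + hg.mk' g).isLinear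

theorem isLinearMap_sub {V W : Type*} [AddCommGroup V] [Module k V] [AddCommGroup W] [Module k W]
    {f g : V → W} (hf : IsLinearMap k f) (hg : IsLinearMap k g) :
    IsLinearMap k fun x => f x - g x :=
  (hf.mk' f - hg.mk' g).isLinear

theorem isLinearMap_comp {V W U : Type*} [AddCommGroup V] [Module k V] [AddCommGroup W]
    [Module k W] [AddCommGroup U] [Module k U]
    (g : W →ₗ[k] U) {f : V → W} (hf : IsLinearMap k f) : IsLinearMap k fun x => g (f x) :=
  (g.comp (hf.mk' f)).isLinear

theorem isLinearMap_pi {V ι : Type*} {W : ι → Type*} [AddCommGroup V] [Module k V]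
    [∀ i, AddCommGroup (W i)] [∀ i, Module k (W i)] {f : V → ∀ i, W i}
    (hf : ∀ i, IsLinearMap k fun x => f x i) : IsLinearMap k f :=
  (LinearMap.pi fun i => (hf i).mk' _).isLinear

theorem Multi.shift_linear {t : List A → M} (ht : Multi k t) :
    IsLinearMap k fun a => BarCochain.shift k M a t :=
  isLinearMap_pi fun w => ht.head w

theorem Multi.add {t s : List A → M} (ht : Multi k t) (hs : Multi k s) : Multi k (t + s) :=
  fun u v => isLinearMap_add (ht u v) (hs u v)

theorem Multi.sub {t s : List A → M} (ht : Multi k t) (hs : Multi k s) : Multi k (t - s) :=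
  fun u v => isLinearMap_sub (ht u v) (hs u v)

theorem Multi.comp {N : Type*} [AddCommGroup N] [Module k N] {t : List A → M} (ht : Multi k t)
    (f : M →ₗ[k] N) : Multi k (f ∘ t) :=
  fun u v => isLinearMap_comp f (ht u v)

theorem Multi.smul {t : List A → M} (ht : Multi k t) (r : k) : Multi k (r • t) :=
  ht.comp (r • (LinearMap.id : M →ₗ[k] M))

theorem Multi.zero : Multi k (0 : List A → M) := fun _ _ => (0 : A →ₗ[k] M).isLinear

theorem Multi.headMul {t : List A → M} (ht : Multi k t) (a : A) : Multi k (headMul k M a t) := by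
  intro u v
  cases u with
  | nil =>
    exact ((ht.head v).mk' _ ∘ₗ LinearMap.mulLeft k a).isLinear
  | cons c u => exact ht ((a * c) :: u) v

theorem Multi.headMul_linear {t : List A → M} (ht : Multi k t) (w : List A) :
    IsLinearMap k fun a => BarCochain.headMul k M a t w := by
  cases w with
  | nil => exact (((rAct k A M).toLinearMap ∘ₗ
      (MulOpposite.opLinearEquiv k).toLinearMap).flip (t [])).isLinear
  | cons c v => exact ((ht.head v).mk' _ ∘ₗ LinearMap.mulRight k c).isLinear

theorem Multi.rightDiff {t : List A → M} (ht : Multi k t) : Multi k (rightDiff k A M t) := by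
  intro u v
  induction u generalizing t with
  | nil =>
    exact isLinearMap_sub (ht.headMul_linear v)
      (isLinearMap_comp (rightDiffAt k M v) ht.shift_linear)
  | cons a u ih =>
    exact isLinearMap_sub (ht.headMul a u v) (ih (ht.shift a))

theorem Multi.leftMul {t : List A → M} (ht : Multi k t) : Multi k (leftMul k A M t) := by
  intro u v
  cases u with
  | nil => exact ((lAct k A M).toLinearMap.flip (t v)).isLinear
  | cons a u => exact isLinearMap_comp (lAct k A M a) (ht u v)

theorem Multi.diff {t : List A → M} (ht : Multi k t) : Multi k (diff k A M t) :=
  ht.leftMul.sub ht.rightDiff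

theorem Multi.splitSum {g : List A → List A → M} (h₁ : ∀ v, Multi k fun u => g u v)
    (h₂ : ∀ u, Multi k (g u)) : Multi k (splitSum k A M g) := by
  intro u v
  induction u generalizing g with
  | nil =>
    exact isLinearMap_add ((h₂ []).head v) (isLinearMap_comp (splitSumAt k A M v)
      (isLinearMap_pi fun u' => isLinearMap_pi fun v' => (h₁ v').head u'))
  | cons a u ih =>
    exact isLinearMap_add (h₂ [] (a :: u) v)
      (ih (fun v' => (h₁ v').shift a) fun u' => h₂ (a :: u'))

theorem Multi.insertHead {F : List A → A} {t : List A → M} (hF : Multi k F) (ht : Multi k t) :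
    Multi k (insertHead k M F t) :=
  Multi.splitSum (fun v => hF.comp ((ht.head v).mk' _)) fun u => ht.shift (F u)

theorem Multi.insertion {F : List A → A} {t : List A → M} (hF : Multi k F) (ht : Multi k t)
    (σ : k) : Multi k (insertion k M F σ t) := by
  intro u v
  induction u generalizing t with
  | nil =>
    exact isLinearMap_add ((hF.insertHead ht).head v)
      (isLinearMap_comp (σ • insertionAt k M F σ v) ht.shift_linear)
  | cons a u ih =>
    exact isLinearMap_add (hF.insertHead ht (a :: u) v)
      (isLinearMap_comp (σ • LinearMap.id) (ih (ht.shift a)))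

theorem insertHead_sub {t : List A → M} (ht : Multi k t) (F F' : List A → A) (w : List A) :
    insertHead k M (F - F') t w = insertHead k M F t w - insertHead k M F' t w := by
  simp only [insertHead_apply, ← splitSum_sub', Pi.sub_apply, ht.head_sub]

theorem insertHead_neg {t : List A → M} (ht : Multi k t) (F : List A → A) (w : List A) :
    insertHead k M (-F) t w = - insertHead k M F t w := by
  simp only [insertHead_apply, ← splitSum_neg', Pi.neg_apply, (ht.head _).map_neg]

theorem headMul_insertHead (F : List A → A) (t : List A → M) (a : A) (w : List A) :
    headMul k M a (insertHead k M F t) w =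
      insertHead k M (headMul k A a F) t w - t ((F [] * a) :: w) +
        headMul k M a (shift k M (F []) t) w := by
  cases w with
  | nil => simp [rAct_self]
  | cons c v =>
    rw [headMul_cons, headMul_cons, insertHead_cons, insertHead_cons, headMul_nil, rAct_self]
    simp [add_comm]

/-- The commutator of `rightDiff` with the insertion of `F` in the first slot. -/
theorem rightDiff_insertHead (F : List A → A) {t : List A → M} (ht : Multi k t) (w : List A) :
    rightDiff k A M (insertHead k M F t) w =
      insertHead k M (rightDiff k A A F) t w +
        rAct k A M (MulOpposite.op (wsign k F w)) (t []) -
        insertHead k M (wsign k F) (rightDiff k A M t) w := by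
  induction w generalizing F with
  | nil => simp [ht.head_zero, rightDiff_cons]
  | cons a w ih =>
    have h1 : shift k M a (insertHead k M F t) =
        shift k M a (shift k M (F []) t) + insertHead k M (fun u => F (a :: u)) t := rfl
    have h2 : (fun u => rightDiff k A A F (a :: u)) =
        headMul k A a F - rightDiff k A A (fun u => F (a :: u)) := rfl
    have h3 : (fun u => wsign k F (a :: u)) = - wsign k (fun u => F (a :: u)) :=
      wsign_cons' F a
    rw [rightDiff_cons, h1, map_add, Pi.add_apply, ih, headMul_insertHead, insertHead_cons,
      insertHead_cons, rightDiff_nil, ht.head_zero, h2, h3, insertHead_sub ht,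
      wsign_cons, wsign_nil, rightDiff_cons, headMul_cons, rightDiff_cons]
    have h4 : insertHead k M (-wsign k fun u => F (a :: u)) (rightDiff k A M t) w =
        - insertHead k M (wsign k fun u => F (a :: u)) (rightDiff k A M t) w :=
      insertHead_neg ht.rightDiff _ _
    rw [h4, MulOpposite.op_neg, map_neg, LinearMap.neg_apply]
    change _ = _ + - (rAct k A M (MulOpposite.op (wsign k (fun u => F (a :: u)) w))) (t []) - _
    abel

theorem map_insertHead {N : Type*} [AddCommGroup N] [Module k N] [Module (Env k A) N]
    [IsScalarTower k (Env k A) N] (f : M →ₗ[k] N) (F : List A → A) (t : List A → M) (w : List A) :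
    f (insertHead k M F t w) = insertHead k N F (f ∘ t) w :=
  map_splitSum f _ w

theorem map_insertion {N : Type*} [AddCommGroup N] [Module k N] [Module (Env k A) N]
    [IsScalarTower k (Env k A) N] (f : M →ₗ[k] N) (F : List A → A) (σ : k) (t : List A → M)
    (w : List A) : f (insertion k M F σ t w) = insertion k N F σ (f ∘ t) w := by
  induction w generalizing t with
  | nil => rfl
  | cons a w ih =>
    rw [insertion_cons, insertion_cons, map_add, map_smul, ih, map_insertHead]
    rfl

variable (k) in
/-- The product `(F, t) ↦ ∑ F u · t v`, `w = u v`. -/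
def leftCup (F : List A → A) (t : List A → M) : List A → M :=
  splitSum k A M fun u v => lAct k A M (F u) (t v)

variable (k) in
/-- The product `(t, F) ↦ ∑ ρ^|u| t u · F v`, `w = u v`. -/
def rightCup (ρ : k) (t : List A → M) (F : List A → A) : List A → M :=
  splitSum k A M fun u v => ρ ^ u.length • rAct k A M (MulOpposite.op (F v)) (t u)

theorem rightCup_cons (ρ : k) (t : List A → M) (F : List A → A) (a : A) (w : List A) :
    rightCup k ρ t F (a :: w) = rAct k A M (MulOpposite.op (F (a :: w))) (t []) +
      ρ • rightCup k ρ (shift k M a t) F w := by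
  rw [rightCup, splitSum_cons, rightCup, ← splitSum_smul']
  simp [pow_succ', mul_smul]

theorem insertion_leftMul (F : List A → A) (σ : k) (t : List A → M) (w : List A) :
    insertion k M F σ (leftMul k A M t) w =
      leftCup k F t w + σ • leftMul k A M (insertion k M F σ t) w := by
  cases w with
  | nil => simp [leftCup]
  | cons a w =>
    rw [insertion_cons, shift_leftMul, leftMul_cons, map_insertion]
    rfl

theorem insertion_headMul (F : List A → A) (σ : k) (t : List A → M) (a : A) (w : List A) :
    insertion k M F σ (headMul k M a t) w = headMul k M a (insertion k M F σ t) w +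
      insertHead k M F (headMul k M a t) w - headMul k M a (insertHead k M F t) w := by
  cases w with
  | nil => simp
  | cons c v =>
    rw [insertion_cons, headMul_cons, headMul_cons, insertion_cons, shift_headMul]
    abel

theorem insertHead_headMul {t : List A → M} (ht : Multi k t) (F : List A → A) (a : A)
    (w : List A) : insertHead k M F (headMul k M a t) w =
      insertHead k M (leftMul k A A F) t (a :: w) := by
  rw [insertHead_cons, leftMul_nil, ht.head_zero, zero_add]
  simp only [leftMul_cons, lAct_self]
  rfl

/-- The part of `diff_insertion` that concerns `rightDiff`. On the left hand side the value of `F`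
is multiplied with the letters next to it, which completes the inner products in the words to which
`F` is applied to the differential of `F`, and, if it is the last letter, with the value of `t`,
which gives `rightCup`. -/
theorem insertion_rightDiff {F : List A → A} {t : List A → M} (ht : Multi k t) {ρ : k}
    (hρ : ρ * ρ = 1) (hF : ∀ u, wsign k F u = ρ • F u) (w : List A) :
    insertion k M F (-ρ) (rightDiff k A M t) w =
      -ρ • rightDiff k A M (insertion k M F (-ρ) t) w + rightCup k ρ t F w -
        ρ • insertion k M (diff k A A F) ρ t w := by
  induction w generalizing t with
  | nil => simp [rightCup, rightDiff_cons, ht.head_zero]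
  | cons a w ih =>
    have hF' : wsign k F = ρ • F := funext hF
    have h1 := rightDiff_insertHead F ht (a :: w)
    have h2 : insertHead k M (ρ • F) (rightDiff k A M t) (a :: w) =
        ρ • insertHead k M F (rightDiff k A M t) (a :: w) := by
      simp only [insertHead_apply, ← splitSum_smul', Pi.smul_apply, ht.rightDiff.head_smul]
    rw [hF', h2, Pi.smul_apply, MulOpposite.op_smul, map_smul, LinearMap.smul_apply,
      rightDiff_cons] at h1
    have h3 : insertHead k M (diff k A A F) t (a :: w) = insertHead k M F (headMul k M a t) w -
        insertHead k M (rightDiff k A A F) t (a :: w) := by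
      rw [insertHead_headMul ht, diff_eq, insertHead_sub ht]
    rw [insertion_cons, shift_rightDiff, map_sub, Pi.sub_apply, ih (ht.shift a),
      insertion_headMul, rightDiff_cons, shift_insertion, map_add, map_smul, Pi.add_apply,
      Pi.smul_apply, rightCup_cons, insertion_cons, h3]
    have h4 : insertHead k M (rightDiff k A A F) t (a :: w) =
      headMul k M a (insertHead k M F t) w - rightDiff k A M (shift k M a (insertHead k M F t)) w -
      ρ • rAct k A M (MulOpposite.op (F (a :: w))) (t []) +
      ρ • insertHead k M F (rightDiff k A M t) (a :: w) := by
      rw [h1]; abel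
    rw [h4]
    simp only [smul_sub, smul_add, smul_smul, neg_smul, neg_mul, hρ, one_smul]
    abel

/-- The differential of a circle product `t ∘ F`, where `F` has the parity recorded by `ρ`. It shows
that, up to sign, the circle product is a homotopy for the commutativity of the cup product. -/
theorem diff_insertion {F : List A → A} {t : List A → M} (ht : Multi k t) {ρ : k}
    (hρ : ρ * ρ = 1) (hF : ∀ u, wsign k F u = ρ • F u) (w : List A) :
    ρ • diff k A M (insertion k M F (-ρ) t) w =
      leftCup k F t w - insertion k M F (-ρ) (diff k A M t) w - rightCup k ρ t F w +
        ρ • insertion k M (diff k A A F) ρ t w := by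
  rw [diff_eq, diff_eq t, map_sub, Pi.sub_apply, Pi.sub_apply, insertion_leftMul,
    insertion_rightDiff ht hρ hF]
  simp only [smul_sub, neg_smul]
  abel

end Insertion
end BarCochain

/-! ### Comparison with multilinear cochains -/

namespace BarCochain

section Multilinear

variable {k : Type*} [Field k] {A : Type*} [Ring A] [Algebra k A]
variable {M : Type*} [AddCommGroup M] [Module k M] [Module (Env k A) M]
  [IsScalarTower k (Env k A) M]

theorem rightDiff_ofFn (t : List A → M) {n : ℕ} (a : Fin (n + 1) → A) :
    rightDiff k A M t (List.ofFn a) =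
      ∑ i : Fin n, (-1 : k) ^ (i : ℕ) • t (List.ofFn (Fin.contractNth i.castSucc (· * ·) a)) +
      (-1 : k) ^ n • rAct k A M (MulOpposite.op (a (Fin.last n))) (t (List.ofFn (Fin.init a))) := by
  induction n generalizing t with
  | zero => simp [rightDiff_cons]
  | succ n ih =>
    have h0 : List.ofFn a = a 0 :: List.ofFn (Fin.tail a) := List.ofFn_succ
    have h1 : headMul k M (a 0) t (List.ofFn (Fin.tail a)) =
        t (List.ofFn (Fin.contractNth (0 : Fin (n + 2)) (· * ·) a)) := by
      rw [List.ofFn_succ, headMul_cons, List.ofFn_succ]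
      congr 2
    have h2 (i : Fin n) : List.ofFn (Fin.contractNth i.succ.castSucc (· * ·) a) =
        a 0 :: List.ofFn (Fin.contractNth i.castSucc (· * ·) (Fin.tail a)) := by
      rw [List.ofFn_succ]
      congr 2
      funext j
      simp only [Fin.contractNth, Fin.tail, Fin.val_succ, Fin.val_castSucc,
        Nat.add_lt_add_iff_right, Nat.add_right_cancel_iff]
      split_ifs <;> rfl
    have h3 : List.ofFn (Fin.init a) = a 0 :: List.ofFn (Fin.init (Fin.tail a)) := by
      rw [List.ofFn_succ]; rfl
    rw [h0, rightDiff_cons, h1, ih, Fin.sum_univ_succ, h3]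
    simp only [h2, Fin.val_zero, pow_zero, one_smul, Fin.val_succ, pow_succ, mul_neg, mul_one,
      neg_smul, Finset.sum_neg_distrib, shift_apply, Fin.castSucc_zero]
    rw [show Fin.tail a (Fin.last n) = a (Fin.last (n + 1)) from rfl]
    abel

theorem diff_ofFn (t : List A → M) {n : ℕ} (a : Fin (n + 1) → A) :
    diff k A M t (List.ofFn a) = hochD k A (fun b : Fin n → A => t (List.ofFn b)) a := by
  have h0 : List.ofFn a = a 0 :: List.ofFn (Fin.tail a) := List.ofFn_succ
  rw [h0, diff_cons, ← h0, rightDiff_ofFn, hochD]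
  simp only [pow_succ, mul_neg, mul_one, neg_smul, Finset.sum_neg_distrib]
  abel

/-- A function of `n` variables, as a function of words that vanishes on words of length other than
`n`. -/
def ofFun {n : ℕ} (F : (Fin n → A) → M) : List A → M := fun w =>
  if h : w.length = n then F fun i => w[(i : ℕ)]'(h ▸ i.isLt) else 0

theorem ofFun_of_length_ne {n : ℕ} (F : (Fin n → A) → M) {w : List A} (h : w.length ≠ n) :
    ofFun F w = 0 := dif_neg h

theorem ofFun_ofFn {n : ℕ} (F : (Fin n → A) → M) (a : Fin n → A) :
    ofFun F (List.ofFn a) = F a := by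
  rw [ofFun, dif_pos (List.length_ofFn)]
  simp

/-- Functions of words agree if they agree on words of each length, written as tuples. -/
theorem ext_ofFn {t t' : List A → M} (h : ∀ n (a : Fin n → A), t (List.ofFn a) = t' (List.ofFn a))
    (w : List A) : t w = t' w := by
  have := h w.length w.get
  rwa [List.ofFn_get] at this

theorem wsign_ofFun {n : ℕ} (F : (Fin n → A) → M) (w : List A) :
    wsign k (ofFun F) w = (-1 : k) ^ n • ofFun F w := by
  by_cases h : w.length = n
  · rw [wsign, h]
  · rw [wsign, ofFun_of_length_ne F h, smul_zero, smul_zero]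

theorem diff_ofFun {n : ℕ} (F : (Fin n → A) → M) :
    diff k A M (ofFun F) = ofFun (hochD k A F) := by
  funext w
  refine ext_ofFn (fun l a => ?_) w
  by_cases h : l = n + 1
  · subst h
    rw [diff_ofFn, ofFun_ofFn]
    simp only [ofFun_ofFn]
  · rw [ofFun_of_length_ne _ (by rwa [List.length_ofFn]), diff_congr (t' := 0) fun v hv => ?_]
    · rw [map_zero]; rfl
    · rw [List.length_ofFn] at hv
      rw [ofFun_of_length_ne _ (by omega)]; rfl

theorem multi_ofFun {n : ℕ} (F : MultilinearMap k (fun _ : Fin n => A) M) :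
    Multi k (ofFun F) := by
  intro u v
  by_cases h : u.length + (v.length + 1) = n
  · subst h
    let i : Fin (u.length + (v.length + 1)) := ⟨u.length, by omega⟩
    let m : Fin (u.length + (v.length + 1)) → A := fun i => (u ++ 0 :: v)[(i : ℕ)]'(by simp)
    have key (x : A) : ofFun F (u ++ x :: v) = F (Function.update m i x) := by
      rw [ofFun, dif_pos (by simp)]
      congr 1
      funext j
      by_cases hj : j = i
      · subst hj; simp [i]
      · rw [Function.update_of_ne hj]
        have hj' : (j : ℕ) ≠ u.length := fun h => hj (Fin.ext h)
        simp only [m, List.getElem_append]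
        split_ifs with h1
        · rfl
        · rw [List.getElem_cons, List.getElem_cons, dif_neg (by omega), dif_neg (by omega)]
    simp only [key]
    exact (F.toLinearMap m i).isLinear
  · have (x : A) : ofFun F (u ++ x :: v) = 0 := ofFun_of_length_ne _ (by simpa using h)
    simp only [this]
    exact (0 : A →ₗ[k] M).isLinear

/-- The component of degree `n` of a cochain that is linear in each letter. -/
def Multi.toMultilinear {t : List A → M} (ht : Multi k t) (n : ℕ) :
    MultilinearMap k (fun _ : Fin n => A) M :=
  have key (inst : DecidableEq (Fin n)) (m : Fin n → A) (i : Fin n) (x : A) :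
      List.ofFn (Function.update m i x) =
        (List.ofFn m).take i ++ x :: (List.ofFn m).drop (i + 1) := by
    have h : List.ofFn (Function.update m i x) = (List.ofFn m).set i x :=
      List.ext_getElem (by simp) fun j h₁ h₂ => by
        simp [List.getElem_set, Function.update_apply, Fin.ext_iff, eq_comm]
    rw [h, List.set_eq_take_append_cons_drop, if_pos (by simp)]
  { toFun := fun a => t (List.ofFn a)
    map_update_add' := fun m i x y => by
      rw [key, key, key]
      exact (ht _ _).map_add x y
    map_update_smul' := fun m i r x => by
      rw [key, key]
      exact (ht _ _).map_smul r x }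

theorem isHochCoboundary_of_diff {n : ℕ} {F : (Fin n → A) → A} {H : List A → A} (hH : Multi k H)
    (h : ∀ a, F a = diff k A A H (List.ofFn a)) : IsHochCoboundary k A n F := by
  cases n with
  | zero => exact funext fun a => (h a).trans (diff_nil H)
  | succ n => exact ⟨hH.toMultilinear n, funext fun a => (h a).trans (diff_ofFn H a)⟩

theorem exists_of_isHochCoboundary {n : ℕ} {F : (Fin n → A) → A}
    (h : IsHochCoboundary k A n F) : ∃ H : List A → A, Multi k H ∧
      (∀ w, wsign k H w = (-1 : k) ^ (n + 1) • H w) ∧ (∀ w, w.length + 1 ≠ n → H w = 0) ∧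
      ofFun F = diff k A A H := by
  cases n with
  | zero =>
    refine ⟨0, Multi.zero, fun w => by simp [wsign], fun _ _ => rfl, ?_⟩
    rw [map_zero, show F = 0 from h]
    funext w
    simp [ofFun]
  | succ n =>
    obtain ⟨H, rfl⟩ := h
    refine ⟨ofFun H, multi_ofFun H, fun w => ?_, fun w hw => ofFun_of_length_ne _ (by omega),
      (diff_ofFun _).symm⟩
    rw [wsign_ofFun]; simp [pow_succ]

theorem splitSum_eq_sum (g : List A → List A → M) (w : List A) :
    splitSum k A M g w = ∑ i ∈ Finset.range (w.length + 1), g (w.take i) (w.drop i) := by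
  induction w generalizing g with
  | nil => simp
  | cons a w ih =>
    rw [splitSum_cons, ih, List.length_cons, Finset.sum_range_succ' _ (w.length + 1), add_comm]
    rfl

theorem insertHead_ofFun {m : ℕ} (F : (Fin m → A) → A) {t : List A → M}
    (ht : ∀ v, t (0 :: v) = 0) (w : List A) :
    insertHead k M (ofFun F) t w =
      if m ≤ w.length then t (ofFun F (w.take m) :: w.drop m) else 0 := by
  rw [insertHead_apply, splitSum_eq_sum]
  split_ifs with h
  · refine Finset.sum_eq_single_of_mem m (by simp; omega) fun i hi him => ?_
    rw [ofFun_of_length_ne _ (by simp at hi ⊢; omega), ht]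
  · refine Finset.sum_eq_zero fun i hi => ?_
    rw [ofFun_of_length_ne _ (by simp at hi ⊢; omega), ht]

theorem insertion_eq_sum (F : List A → A) (σ : k) (t : List A → M) (w : List A) :
    insertion k M F σ t w = ∑ i ∈ Finset.range (w.length + 1),
      σ ^ i • insertHead k M F (fun v => t (w.take i ++ v)) (w.drop i) := by
  induction w generalizing t with
  | nil => simp
  | cons a w ih =>
    rw [insertion_cons, ih, List.length_cons, Finset.sum_range_succ' _ (w.length + 1), add_comm,
      Finset.smul_sum]
    congr 1
    · refine Finset.sum_congr rfl fun i _ => ?_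
      rw [smul_smul, ← pow_succ']
      rfl
    · simp

theorem insertion_eq_zero (F : List A → A) (σ : k) {t : List A → M} (ht : ∀ a w, t (a :: w) = 0)
    (w : List A) : insertion k M F σ t w = 0 := by
  rw [insertion_eq_sum]
  refine Finset.sum_eq_zero fun i _ => ?_
  rw [insertHead_apply]
  refine (congrArg _ ?_).trans (smul_zero _)
  refine (splitSum_congr fun u v _ => ?_).trans (splitSum_zero' (A := A) _)
  obtain ⟨a, v', hv⟩ := List.exists_cons_of_ne_nil
    (List.append_ne_nil_of_right_ne_nil (w.take i) (List.cons_ne_nil (F u) v))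
  rw [hv, ht]

theorem insertion_zero (σ : k) {t : List A → M} (ht : Multi k t) (w : List A) :
    insertion k M (0 : List A → A) σ t w = 0 := by
  rw [insertion_eq_sum]
  refine Finset.sum_eq_zero fun i _ => ?_
  rw [insertHead_apply]
  refine (congrArg _ ?_).trans (smul_zero _)
  refine (splitSum_congr fun u v _ => ?_).trans (splitSum_zero' (A := A) _)
  exact (ht _ v).map_zero

theorem insertion_ofFn {n m l : ℕ} (h : n + m = l + 1)
    (F : MultilinearMap k (fun _ : Fin n => A) A) (F' : (Fin m → A) → A) (a : Fin l → A) :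
    insertion k A (ofFun F') (-(-1) ^ m) (ofFun F) (List.ofFn a) = circ k h F F' a := by
  have hF : Multi k (ofFun F) := multi_ofFun F
  have h0 (i : ℕ) (v : List A) : ofFun F ((List.ofFn a).take i ++ 0 :: v) = 0 :=
    (hF _ v).map_zero
  rw [insertion_eq_sum, circ, List.length_ofFn, Finset.sum_fin_eq_sum_range]
  symm
  refine Finset.sum_subset_zero_on_sdiff (Finset.range_mono (by omega)) (fun i hi => ?_)
    fun i hi => ?_
  · rw [Finset.mem_sdiff, Finset.mem_range, Finset.mem_range] at hi
    rw [insertHead_ofFun F' (h0 i), if_neg (by simp; omega), smul_zero]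
  · rw [Finset.mem_range] at hi
    rw [dif_pos hi, insertHead_ofFun F' (h0 i), if_pos (by simp; omega)]
    congr 1
    · rw [pow_mul, pow_succ]; simp
    · rw [ofFun, dif_pos (by simp; omega)]
      congr 1
      funext j
      have hj := j.isLt
      rw [List.getElem_append]
      simp only [List.length_take, List.length_ofFn, List.getElem_take, List.getElem_ofFn]
      have h1' : (j : ℕ) < min i l ↔ (j : ℕ) < i := by omega
      simp only [h1']
      by_cases h1 : (j : ℕ) < i
      · rw [dif_pos h1, dif_pos h1]
      · rw [dif_neg h1, dif_neg h1, List.getElem_cons]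
        have h2' : (j : ℕ) - min i l = 0 ↔ (j : ℕ) = i := by omega
        simp only [h2']
        by_cases h2 : (j : ℕ) = i
        · rw [dif_pos h2, dif_pos h2, ofFun, dif_pos (by simp; omega)]
          simp
        · rw [dif_neg h2, dif_neg h2]
          simp only [List.drop_drop, List.getElem_drop, List.getElem_ofFn]
          congr 2
          omega

end Multilinear

/-! ### Lifting along acyclic complexes -/

section Homotopy

variable {k : Type*} [Field k] {A : Type*} [Ring A] [Algebra k A]
variable {Y : Type*} [AddCommGroup Y] [Module k Y] [Module (Env k A) Y]
  [IsScalarTower k (Env k A) Y]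

/-- Over an acyclic complex, vector space sections of the differential and of the augmentation. -/
theorem exists_section {d : Y →ₗ[Env k A] Y} {μ : Y →ₗ[Env k A] A}
    (hex : ∀ y, d y = 0 → μ y = 0 → ∃ z, d z = y) {y₀ : Y} (hd : d y₀ = 0) (hμ : μ y₀ = 1) :
    ∃ (s : Y →ₗ[k] Y) (σ : A →ₗ[k] Y), (∀ y, d y = 0 → μ y = 0 → d (s y) = y) ∧
      (∀ y, μ (s y) = 0) ∧ (∀ a, σ a = lAct k A Y a y₀) ∧ (∀ a, d (σ a) = 0) ∧
      ∀ a, μ (σ a) = a := by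
  let σ : A →ₗ[k] Y := (lAct k A Y).toLinearMap.flip y₀
  have hσ₁ (a : A) : d (σ a) = 0 := by
    change d (lAct k A Y a y₀) = 0
    rw [map_lAct, hd, map_zero]
  have hσ₂ (a : A) : μ (σ a) = a := by
    change μ (lAct k A Y a y₀) = a
    rw [map_lAct, hμ, lAct_self, mul_one]
  let d' : Y →ₗ[k] Y := d.restrictScalars k
  obtain ⟨g, hg⟩ := d'.rangeRestrict.exists_rightInverse_of_surjective d'.range_rangeRestrict
  obtain ⟨p, hp⟩ := (LinearMap.range d').exists_isCompl
  let pr : Y →ₗ[k] LinearMap.range d' := Submodule.projectionOnto _ p hp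
  let s₀ : Y →ₗ[k] Y := g ∘ₗ pr
  refine ⟨s₀ - σ ∘ₗ μ.restrictScalars k ∘ₗ s₀, σ, fun y h1 h2 => ?_, fun y => ?_,
    fun _ => rfl, hσ₁, hσ₂⟩
  · obtain ⟨z, rfl⟩ := hex y h1 h2
    change d (s₀ (d z) - σ (μ (s₀ (d z)))) = d z
    rw [map_sub, hσ₁, sub_zero]
    have h3 : pr (d z) = ⟨d z, z, rfl⟩ :=
      Submodule.projectionOnto_apply_left hp ⟨d z, z, rfl⟩
    have h4 := congrArg Subtype.val (LinearMap.congr_fun hg ⟨d z, z, rfl⟩)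
    change d (g (pr (d z))) = d z
    rw [h3]
    exact h4
  · change μ (s₀ y - σ (μ (s₀ y))) = 0
    rw [map_sub, hσ₂, sub_self]

/-- A (twisted) chain map `η` from the bar resolution to a complex with a contraction `s` is
null-homotopic if its composite with the augmentation is a coboundary. -/
theorem exists_homotopy_of_section {d : Y →ₗ[Env k A] Y} {μ : Y →ₗ[Env k A] A}
    {s : Y →ₗ[k] Y} {σ : A →ₗ[k] Y} (hs : ∀ y, d y = 0 → μ y = 0 → d (s y) = y)
    (hμs : ∀ y, μ (s y) = 0) (hdσ : ∀ a, d (σ a) = 0) (hμσ : ∀ a, μ (σ a) = a)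
    {κ : k} {η : List A → Y} (hη : Multi k η)
    (hd : ∀ w, d (η w) = κ • diff k A Y η w) {c : List A → A} (hc : Multi k c)
    (hμ : ∀ w, μ (η w) = κ • diff k A A c w) :
    ∃ h : List A → Y, Multi k h ∧ (∀ w, d (h w) + κ • diff k A Y h w = η w) ∧
      (∀ w, μ (h w) = c w) ∧ ∀ w, h w = s (η w - κ • diff k A Y h w) + σ (c w) := by
  -- the homotopy on words of length at most `n`, by recursion on `n`
  let step (h : List A → Y) : List A → Y := s ∘ (η - κ • diff k A Y h) + σ ∘ c
  let H (n : ℕ) : List A → Y := Nat.rec 0 (fun _ h => step h) n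
  have hH : ∀ n, Multi k (H n) := fun n => Nat.rec Multi.zero
    (fun _ ih => ((hη.sub (ih.diff.smul κ)).comp s).add (hc.comp σ)) n
  have stab : ∀ (w : List A) (n : ℕ), w.length < n → H n w = H (w.length + 1) w := by
    intro w
    induction hw : w.length using Nat.strong_induction_on generalizing w with
    | _ l ih =>
      intro n hn
      obtain ⟨n, rfl⟩ : ∃ n', n = n' + 1 := ⟨n - 1, by omega⟩
      change s (η w - κ • diff k A Y (H n) w) + σ (c w) =
        s (η w - κ • diff k A Y (H l) w) + σ (c w)
      rw [diff_congr (t' := H l) fun v hv => ?_]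
      rw [ih v.length (by omega) v rfl n (by omega), ih v.length (by omega) v rfl l (by omega)]
  let h : List A → Y := fun w => H (w.length + 1) w
  have hh (w : List A) : h w = s (η w - κ • diff k A Y h w) + σ (c w) := by
    change s (η w - κ • diff k A Y (H w.length) w) + σ (c w) = _
    rw [diff_congr (t' := h) fun v hv => stab v _ (by omega)]
  have hmulti : Multi k h := fun u v => by
    have : (fun x => h (u ++ x :: v)) = fun x => H (u.length + v.length + 2) (u ++ x :: v) := by
      funext x
      simp only [h, List.length_append, List.length_cons]
      rfl
    rw [this]
    exact hH (u.length + v.length + 2) u v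
  have hμh (w : List A) : μ (h w) = c w := by rw [hh, map_add, hμs, hμσ, zero_add]
  refine ⟨h, hmulti, fun w => ?_, hμh, hh⟩
  induction hw : w.length using Nat.strong_induction_on generalizing w with
  | _ l ih =>
    have h1 : μ (η w - κ • diff k A Y h w) = 0 := by
      rw [map_sub, envMap_smul, map_diff, hμ, sub_eq_zero]
      rw [show (μ ∘ h : List A → A) = c from funext hμh]
    have h2 : d (η w - κ • diff k A Y h w) = 0 := by
      rw [map_sub, envMap_smul, map_diff, hd, sub_eq_zero]
      have h3 : diff k A Y (d ∘ h) w = diff k A Y (η - κ • diff k A Y h) w :=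
        diff_congr fun v hv => by
          rw [Pi.sub_apply, Pi.smul_apply, ← ih v.length (by omega) v rfl, add_sub_cancel_right]
          rfl
      rw [h3, map_sub, map_smul, Pi.sub_apply, Pi.smul_apply, diff_diff, smul_zero, sub_zero]
    rw [hh w, map_add, hs _ h2 h1, hdσ, add_zero, sub_add_cancel]

/-- A (twisted) chain map `η` from the bar resolution to an acyclic complex is null-homotopic if its
composite with the augmentation is a coboundary. -/
theorem exists_homotopy {d : Y →ₗ[Env k A] Y} {μ : Y →ₗ[Env k A] A}
    (hex : ∀ y, d y = 0 → μ y = 0 → ∃ z, d z = y) {y₀ : Y} (hd₀ : d y₀ = 0) (hμ₀ : μ y₀ = 1)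
    {κ : k} {η : List A → Y} (hη : Multi k η)
    (hd : ∀ w, d (η w) = κ • diff k A Y η w) {c : List A → A} (hc : Multi k c)
    (hμ : ∀ w, μ (η w) = κ • diff k A A c w) :
    ∃ h : List A → Y, Multi k h ∧ ∀ w, d (h w) + κ • diff k A Y h w = η w := by
  obtain ⟨s, σ, hs, hμs, -, hdσ, hμσ⟩ := exists_section hex hd₀ hμ₀
  obtain ⟨h, h1, h2, -⟩ := exists_homotopy_of_section hs hμs hdσ hμσ hη hd hc hμ
  exact ⟨h, h1, h2⟩

end Homotopy
end BarCochain

/-! ### Complexes with a diagonal map and a homotopy -/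

/-- An acyclic bimodule complex over `A` with a counital diagonal map and a homotopy `φ` between
the two maps `X ⊗_A X → X` given by the augmentation. Only the parity of degrees is recorded, by the
sign map `ε`. -/
structure DiagonalComplex (k A X : Type*) [Field k] [Ring A] [Algebra k A] [AddCommGroup X]
    [Module k X] [Module (Env k A) X] [IsScalarTower k (Env k A) X] where
  /-- The differential. -/
  d : X →ₗ[Env k A] X
  /-- The sign map `x ↦ (-1)^|x| x`. -/
  ε : X →ₗ[Env k A] X
  /-- The augmentation. -/
  aug : X →ₗ[Env k A] A
  /-- The diagonal map. -/
  Δ : X →ₗ[Env k A] BTensor k A X X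
  /-- The homotopy. -/
  φ : BTensor k A X X →ₗ[Env k A] X
  d_ε : ∀ x, d (ε x) = - ε (d x)
  ε_ε : ∀ x, ε (ε x) = x
  aug_d : ∀ x, aug (d x) = 0
  aug_ε : ∀ x, aug (ε x) = aug x
  Δ_d : ∀ x, Δ (d x) = BTensor.map d LinearMap.id (Δ x) + BTensor.map ε d (Δ x)
  Δ_ε : ∀ x, Δ (ε x) = BTensor.map ε ε (Δ x)
  counit_left : ∀ x, BTensor.evalLeft aug (Δ x) = x
  counit_right : ∀ x, BTensor.evalRight aug (Δ x) = x
  homotopy : ∀ z, d (φ z) + φ (BTensor.map d LinearMap.id z + BTensor.map ε d z) =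
    BTensor.evalLeft aug z - BTensor.evalRight aug z
  aug_φ : ∀ z, aug (φ z) = 0
  exact : ∀ x, d x = 0 → aug x = 0 → ∃ y, d y = x
  exists_one : ∃ x, d x = 0 ∧ aug x = 1

namespace DiagonalComplex

open BarCochain

variable {k A X : Type*} [Field k] [Ring A] [Algebra k A] [AddCommGroup X]
    [Module k X] [Module (Env k A) X] [IsScalarTower k (Env k A) X] (P : DiagonalComplex k A X)

/-- The differential of `X ⊗_A X`. -/
def dT : BTensor k A X X →ₗ[Env k A] BTensor k A X X :=
  BTensor.map P.d LinearMap.id + BTensor.map P.ε P.d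

theorem dT_tmul (x y : X) : P.dT (BTensor.tmul k A x y) =
    BTensor.tmul k A (P.d x) y + BTensor.tmul k A (P.ε x) (P.d y) := rfl

/-- The differential of `X ⊗_A (X ⊗_A X)`. -/
def dTT : BTensor k A X (BTensor k A X X) →ₗ[Env k A] BTensor k A X (BTensor k A X X) :=
  BTensor.map P.d LinearMap.id + BTensor.map P.ε P.dT

theorem dTT_tmul (x : X) (y : BTensor k A X X) : P.dTT (BTensor.tmul k A x y) =
    BTensor.tmul k A (P.d x) y + BTensor.tmul k A (P.ε x) (P.dT y) := rfl

theorem Δ_d' (x : X) : P.Δ (P.d x) = P.dT (P.Δ x) := P.Δ_d x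

theorem homotopy' (z : BTensor k A X X) : P.d (P.φ z) + P.φ (P.dT z) =
    BTensor.evalLeft P.aug z - BTensor.evalRight P.aug z := P.homotopy z

/-- The map `(ε ⊗ φ) (Δ ⊗ 1)`. -/
def contraction : BTensor k A X X →ₗ[k] BTensor k A X X :=
  (BTensor.map P.ε P.φ).restrictScalars k ∘ₗ BTensor.assoc k A X X X ∘ₗ
    (BTensor.map P.Δ LinearMap.id).restrictScalars k

theorem assoc_dT (z : BTensor k A X X) (y : X) :
    BTensor.assoc k A X X X (BTensor.tmul k A (P.dT z) y) +
      BTensor.assoc k A X X X (BTensor.tmul k A (BTensor.map P.ε P.ε z) (P.d y)) =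
    P.dTT (BTensor.assoc k A X X X (BTensor.tmul k A z y)) := by
  induction z using BTensor.induction with
  | h0 => simp [BTensor.zero_tmul]
  | h1 m n =>
    rw [dT_tmul, BTensor.add_tmul, map_add, BTensor.map_tmul]
    simp only [BTensor.assoc_tmul, dTT_tmul, dT_tmul, BTensor.tmul_add]
    abel
  | h2 a b ha hb =>
    simp only [map_add, BTensor.add_tmul] at ha hb ⊢
    rw [← ha, ← hb]
    abel

theorem contraction_tmul (x y : X) : P.contraction (BTensor.tmul k A x y) =
    BTensor.map P.ε P.φ (BTensor.assoc k A X X X (BTensor.tmul k A (P.Δ x) y)) := rfl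

theorem map_ε_φ_dTT (z : BTensor k A X (BTensor k A X X)) :
    P.dT (BTensor.map P.ε P.φ z) + BTensor.map P.ε P.φ (P.dTT z) =
      BTensor.map LinearMap.id (BTensor.evalLeft P.aug) z -
        BTensor.map LinearMap.id (BTensor.evalRight P.aug) z := by
  induction z using BTensor.induction with
  | h0 => simp
  | h1 x z =>
    rw [BTensor.map_tmul, dT_tmul, dTT_tmul, map_add, BTensor.map_tmul, BTensor.map_tmul,
      BTensor.map_tmul, BTensor.map_tmul, P.d_ε, P.ε_ε, BTensor.neg_tmul, ← BTensor.tmul_sub,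
      ← P.homotopy', BTensor.tmul_add, LinearMap.id_apply]
    abel
  | h2 a b ha hb =>
    simp only [map_add]
    rw [add_sub_add_comm, ← ha, ← hb]
    abel

theorem assoc_evalLeft (z : BTensor k A X X) (y : X) :
    BTensor.map LinearMap.id (BTensor.evalLeft P.aug)
      (BTensor.assoc k A X X X (BTensor.tmul k A z y)) =
    BTensor.tmul k A (BTensor.evalRight P.aug z) y := by
  induction z using BTensor.induction with
  | h0 => simp [BTensor.zero_tmul]
  | h1 m n =>
    rw [BTensor.assoc_tmul, BTensor.map_tmul, BTensor.evalLeft_tmul, BTensor.evalRight_tmul,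
      BTensor.balanced]
    rfl
  | h2 a b ha hb => simp only [map_add, BTensor.add_tmul, ha, hb]

theorem assoc_evalRight (z : BTensor k A X X) (y : X) :
    BTensor.map LinearMap.id (BTensor.evalRight P.aug)
      (BTensor.assoc k A X X X (BTensor.tmul k A z y)) =
    rAct k A _ (MulOpposite.op (P.aug y)) z := by
  induction z using BTensor.induction with
  | h0 => simp [BTensor.zero_tmul]
  | h1 m n =>
    rw [BTensor.assoc_tmul, BTensor.map_tmul, BTensor.evalRight_tmul, BTensor.rAct_tmul]
    rfl
  | h2 a b ha hb => simp only [map_add, BTensor.add_tmul, ha, hb]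

/-- `(ε ⊗ φ) (Δ ⊗ 1)` is a homotopy between the identity of `X ⊗_A X` and `Δ (1 ⊗ μ)`, so that
`1 ⊗ μ` is a homotopy equivalence and `X ⊗_A X` is acyclic. -/
theorem contraction_homotopy (z : BTensor k A X X) :
    P.dT (P.contraction z) + P.contraction (P.dT z) =
      z - P.Δ (BTensor.evalRight P.aug z) := by
  induction z using BTensor.induction with
  | h0 => simp
  | h1 x y =>
    have := P.map_ε_φ_dTT (BTensor.assoc k A X X X (BTensor.tmul k A (P.Δ x) y))
    rw [assoc_evalLeft, assoc_evalRight, P.counit_right, ← map_rAct, ← assoc_dT, map_add,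
      ← P.Δ_d', ← P.Δ_ε] at this
    rw [dT_tmul, map_add, contraction_tmul, contraction_tmul, contraction_tmul, this,
      BTensor.evalRight_tmul]
  | h2 a b ha hb =>
    simp only [map_add]
    rw [add_sub_add_comm, ← ha, ← hb]
    abel

/-- The augmentation `μ ⊗ μ` of `X ⊗_A X`. -/
def augT : BTensor k A X X →ₗ[Env k A] A := P.aug.comp (BTensor.evalRight P.aug)

theorem evalRight_dT (z : BTensor k A X X) :
    BTensor.evalRight P.aug (P.dT z) = P.d (BTensor.evalRight P.aug z) := by
  refine LinearMap.congr_fun (f := (BTensor.evalRight P.aug).comp P.dT)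
    (g := P.d.comp (BTensor.evalRight P.aug)) (BTensor.envHom_ext fun x y => ?_) z
  change BTensor.evalRight P.aug (P.dT _) = P.d (BTensor.evalRight P.aug _)
  rw [dT_tmul, map_add, BTensor.evalRight_tmul, BTensor.evalRight_tmul, BTensor.evalRight_tmul,
    P.aug_d, map_rAct]
  simp

theorem exact_tensor (z : BTensor k A X X) (h : P.dT z = 0) (h' : P.augT z = 0) :
    ∃ y, P.dT y = z := by
  obtain ⟨x, hx⟩ := P.exact (BTensor.evalRight P.aug z)
    (by rw [← evalRight_dT, h, map_zero]) h'
  have := P.contraction_homotopy z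
  rw [h, map_zero, add_zero, ← hx, P.Δ_d'] at this
  exact ⟨P.contraction z + P.Δ x, by rw [map_add, this, sub_add_cancel]⟩

/-! ### The homotopy lifting of a cocycle -/

/-- `f` is a cocycle whose degree has the parity of `n`. -/
structure IsCocycle (n : ℕ) (f : X →ₗ[Env k A] A) : Prop where
  map_d : ∀ x, f (P.d x) = 0
  map_ε : ∀ x, f (P.ε x) = (-1 : k) ^ n • f x

/-- The power `ε ^ m` of the sign map. -/
def εpow (m : ℕ) : X →ₗ[Env k A] X := (P.ε : Module.End (Env k A) X) ^ m

theorem εpow_succ (m : ℕ) (x : X) : P.εpow (m + 1) x = P.ε (P.εpow m x) := by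
  rw [εpow, pow_succ', Module.End.mul_apply]; rfl

theorem ε_εpow (m : ℕ) (x : X) : P.ε (P.εpow m x) = P.εpow m (P.ε x) := by
  rw [← εpow_succ, εpow, pow_succ, Module.End.mul_apply]; rfl

theorem d_εpow (m : ℕ) (x : X) : P.d (P.εpow m x) = (-1 : k) ^ m • P.εpow m (P.d x) := by
  induction m with
  | zero => simp [εpow]
  | succ m ih => rw [εpow_succ, P.d_ε, ih, εpow_succ, envMap_smul, pow_succ]; simp

theorem aug_εpow (m : ℕ) (x : X) : P.aug (P.εpow m x) = P.aug x := by
  induction m with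
  | zero => rfl
  | succ m ih => rw [εpow_succ, P.aug_ε, ih]

variable {P} in
theorem IsCocycle.map_εpow {n : ℕ} {f : X →ₗ[Env k A] A} (hf : P.IsCocycle n f) (m : ℕ) (x : X) :
    f (P.εpow m x) = (-1 : k) ^ (n * m) • f x := by
  induction m with
  | zero => simp [εpow]
  | succ m ih => rw [εpow_succ, hf.map_ε, ih, smul_smul, mul_add, mul_one, pow_add, mul_comm]

/-- The commutator `f ⊗ 1 - 1 ⊗ f : X ⊗_A X → X` with a cochain of degree `m`. -/
def comm (m : ℕ) (f : X →ₗ[Env k A] A) : BTensor k A X X →ₗ[Env k A] X :=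
  BTensor.evalLeft f - (BTensor.evalRight f).comp (BTensor.map (P.εpow m) LinearMap.id)

theorem comm_tmul (m : ℕ) (f : X →ₗ[Env k A] A) (x y : X) :
    P.comm m f (BTensor.tmul k A x y) = lAct k A X (f x) y -
      rAct k A X (MulOpposite.op (f y)) (P.εpow m x) := rfl

/-- The homotopy lifting `φ (1 ⊗ f ⊗ 1) (1 ⊗ Δ) Δ` of a cochain `f` of degree `m`. -/
def lifting (m : ℕ) (f : X →ₗ[Env k A] A) : X →ₗ[Env k A] X :=
  P.φ.comp ((BTensor.map (P.εpow m) (BTensor.evalLeft f)).comp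
    ((BTensor.map LinearMap.id P.Δ).comp P.Δ))

theorem lifting_apply (m : ℕ) (f : X →ₗ[Env k A] A) (x : X) :
    P.lifting m f x = P.φ (BTensor.map (P.εpow m) (BTensor.evalLeft f)
      (BTensor.map LinearMap.id P.Δ (P.Δ x))) := rfl

variable {P} {m : ℕ} {f : X →ₗ[Env k A] A}

theorem IsCocycle.evalLeft_dT (hf : P.IsCocycle m f) (z : BTensor k A X X) :
    BTensor.evalLeft f (P.dT z) = (-1 : k) ^ m • P.d (BTensor.evalLeft f z) := by
  induction z using BTensor.induction with
  | h0 => simp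
  | h1 x y =>
    rw [dT_tmul, map_add, BTensor.evalLeft_tmul, BTensor.evalLeft_tmul, BTensor.evalLeft_tmul,
      hf.map_d, hf.map_ε, map_zero, map_smul, map_lAct]
    simp
  | h2 a b ha hb => simp only [map_add, smul_add, ha, hb]

theorem IsCocycle.comm_dT (hf : P.IsCocycle m f) (z : BTensor k A X X) :
    P.comm m f (P.dT z) = (-1 : k) ^ m • P.d (P.comm m f z) := by
  induction z using BTensor.induction with
  | h0 => simp
  | h1 x y =>
    rw [dT_tmul, map_add, comm_tmul, comm_tmul, comm_tmul, hf.map_d, hf.map_ε, hf.map_d, map_sub,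
      map_lAct, map_rAct, d_εpow]
    simp only [map_zero, MulOpposite.op_zero, LinearMap.zero_apply, map_smul, LinearMap.smul_apply,
      smul_sub, neg_one_pow_smul_smul]
    abel
  | h2 a b ha hb => simp only [map_add, smul_add, ha, hb]

theorem IsCocycle.map_dTT (hf : P.IsCocycle m f) (z : BTensor k A X (BTensor k A X X)) :
    BTensor.map (P.εpow m) (BTensor.evalLeft f) (P.dTT z) =
      (-1 : k) ^ m • P.dT (BTensor.map (P.εpow m) (BTensor.evalLeft f) z) := by
  induction z using BTensor.induction with
  | h0 => simp
  | h1 x y =>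
    rw [dTT_tmul, map_add, BTensor.map_tmul, BTensor.map_tmul, BTensor.map_tmul, dT_tmul,
      hf.evalLeft_dT, d_εpow, BTensor.smul_tmul, BTensor.tmul_smul, smul_add,
      neg_one_pow_smul_smul, ε_εpow]
  | h2 a b ha hb => simp only [map_add, smul_add, ha, hb]

theorem map_Δ_dT (z : BTensor k A X X) :
    BTensor.map LinearMap.id P.Δ (P.dT z) = P.dTT (BTensor.map LinearMap.id P.Δ z) := by
  induction z using BTensor.induction with
  | h0 => simp
  | h1 x y =>
    rw [dT_tmul, map_add, BTensor.map_tmul, BTensor.map_tmul, BTensor.map_tmul, dTT_tmul, P.Δ_d']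
    rfl
  | h2 a b ha hb => simp only [map_add, ha, hb]

theorem evalLeft_aug_map (z : BTensor k A X X) :
    BTensor.evalLeft P.aug (BTensor.map (P.εpow m) (BTensor.evalLeft f)
      (BTensor.map LinearMap.id P.Δ z)) =
      BTensor.evalLeft f (P.Δ (BTensor.evalLeft P.aug z)) := by
  induction z using BTensor.induction with
  | h0 => simp
  | h1 x y =>
    rw [BTensor.map_tmul, BTensor.map_tmul, BTensor.evalLeft_tmul, BTensor.evalLeft_tmul,
      aug_εpow, map_lAct, map_lAct]
    rfl
  | h2 a b ha hb => simp only [map_add, ha, hb]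

theorem aug_evalLeft (z : BTensor k A X X) :
    P.aug (BTensor.evalLeft f z) = f (BTensor.evalRight P.aug z) := by
  induction z using BTensor.induction with
  | h0 => simp
  | h1 x y =>
    rw [BTensor.evalLeft_tmul, BTensor.evalRight_tmul, map_lAct, map_rAct, lAct_self, rAct_self,
      MulOpposite.unop_op]
  | h2 a b ha hb => simp only [map_add, ha, hb]

theorem evalRight_aug_map (z : BTensor k A X X) :
    BTensor.evalRight P.aug (BTensor.map (P.εpow m) (BTensor.evalLeft f)
      (BTensor.map LinearMap.id P.Δ z)) =
      BTensor.evalRight f (BTensor.map (P.εpow m) LinearMap.id z) := by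
  induction z using BTensor.induction with
  | h0 => simp
  | h1 x y =>
    rw [BTensor.map_tmul, BTensor.map_tmul, BTensor.evalRight_tmul, BTensor.map_tmul,
      BTensor.evalRight_tmul, aug_evalLeft, P.counit_right]
    rfl
  | h2 a b ha hb => simp only [map_add, ha, hb]

/-- The equation of a homotopy lifting: up to sign, the commutator of `lifting m f` with the
differential is `(f ⊗ 1 - 1 ⊗ f) Δ`. -/
theorem IsCocycle.d_lifting (hf : P.IsCocycle m f) (x : X) :
    P.d (P.lifting m f x) =
      P.comm m f (P.Δ x) - (-1 : k) ^ m • P.lifting m f (P.d x) := by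
  have := P.homotopy' (BTensor.map (P.εpow m) (BTensor.evalLeft f)
    (BTensor.map LinearMap.id P.Δ (P.Δ x)))
  rw [evalLeft_aug_map, evalRight_aug_map, P.counit_left] at this
  rw [lifting_apply, lifting_apply, P.Δ_d', map_Δ_dT, hf.map_dTT, envMap_smul,
    neg_one_pow_smul_smul]
  exact eq_sub_of_add_eq this

variable {n : ℕ} {f' : X →ₗ[Env k A] A}

/-- The commutators with two cocycles, composed with the other cocycle, agree up to sign: they are
both given by the commutator of the cup product. -/
theorem IsCocycle.map_comm (hf : P.IsCocycle n f) (hf' : P.IsCocycle m f') (z : BTensor k A X X) :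
    f (P.comm m f' z) = - (-1 : k) ^ (n * m) • f' (P.comm n f z) := by
  induction z using BTensor.induction with
  | h0 => simp
  | h1 x y =>
    rw [comm_tmul, comm_tmul, map_sub, map_sub, map_lAct, map_lAct, map_rAct, map_rAct,
      hf.map_εpow, hf'.map_εpow, lAct_self, lAct_self, rAct_self, rAct_self, MulOpposite.unop_op,
      MulOpposite.unop_op, smul_mul_assoc, smul_mul_assoc, mul_comm m n, smul_sub, neg_smul,
      neg_smul, neg_one_pow_smul_smul]
    abel
  | h2 a b ha hb => simp only [map_add, smul_add, ha, hb]

variable (P) in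
/-- The bracket of cochains of degrees `n` and `m`. The exponent `(n + 1) * (m + 1)` has the parity
of `(n - 1) (m - 1)` and avoids truncated subtraction. -/
def bracket (n m : ℕ) (f f' : X →ₗ[Env k A] A) : X →ₗ[Env k A] A :=
  f.comp (P.lifting m f') - (-1 : k) ^ ((n + 1) * (m + 1)) • f'.comp (P.lifting n f)

theorem bracket_apply (x : X) : P.bracket n m f f' x =
    f (P.lifting m f' x) - (-1 : k) ^ ((n + 1) * (m + 1)) • f' (P.lifting n f x) := rfl

theorem bracket_sign (n m : ℕ) :
    (-1 : k) ^ ((n + 1) * (m + 1)) * (-1) ^ n = - (-1) ^ m * (-1) ^ (n * m) := by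
  rw [show (n + 1) * (m + 1) = n * m + n + m + 1 by ring, pow_succ, pow_add, pow_add]
  have : (-1 : k) ^ n * (-1) ^ n = 1 := by rw [← mul_pow]; simp
  linear_combination (-(-1 : k) ^ (n * m) * (-1) ^ m) * this

theorem IsCocycle.map_lifting_d (hf : P.IsCocycle n f) (hf' : P.IsCocycle m f') (x : X) :
    f (P.lifting m f' (P.d x)) = (-1 : k) ^ m • f (P.comm m f' (P.Δ x)) := by
  have h := congrArg f (hf'.d_lifting x)
  rw [hf.map_d, map_sub, envMap_smul, eq_comm, sub_eq_zero] at h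
  rw [h, neg_one_pow_smul_smul]

theorem IsCocycle.bracket_d (hf : P.IsCocycle n f) (hf' : P.IsCocycle m f') (x : X) :
    P.bracket n m f f' (P.d x) = 0 := by
  rw [bracket_apply, hf.map_lifting_d hf', hf'.map_lifting_d hf, hf.map_comm hf', smul_smul,
    smul_smul, bracket_sign, ← sub_smul]
  simp

end DiagonalComplex

/-! ### The bracket on the bar resolution -/

namespace DiagonalComplex

open BarCochain

variable {k A X : Type*} [Field k] [Ring A] [Algebra k A] [AddCommGroup X]
    [Module k X] [Module (Env k A) X] [IsScalarTower k (Env k A) X] {P : DiagonalComplex k A X}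

variable (P) in
/-- `θ` is a chain map from the bar resolution of `A` to `X` that lifts the identity of `A`. -/
structure IsComparison (θ : List A → X) : Prop where
  multi : Multi k θ
  map_d : ∀ w, P.d (θ w) = diff k A X θ w
  map_ε : ∀ w, P.ε (θ w) = wsign k θ w
  aug_nil : P.aug (θ []) = 1
  aug_cons : ∀ a w, P.aug (θ (a :: w)) = 0

variable {θ : List A → X} {n m : ℕ} {f f' : X →ₗ[Env k A] A}

theorem IsComparison.d_comp (h : P.IsComparison θ) : P.d ∘ θ = diff k A X θ :=
  funext h.map_d

theorem IsCocycle.diff_comp (hf : P.IsCocycle n f) (h : P.IsComparison θ) :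
    diff k A A (f ∘ θ) = 0 := by
  funext w
  rw [← map_diff, ← h.map_d, hf.map_d]; rfl

theorem IsCocycle.wsign_comp (hf : P.IsCocycle n f) (h : P.IsComparison θ) (w : List A) :
    wsign k (f ∘ θ) w = (-1 : k) ^ n • (f ∘ θ) w := by
  rw [Function.comp_apply, ← hf.map_ε, h.map_ε]
  exact (envMap_smul f _ _).symm

theorem multi_comp (f : X →ₗ[Env k A] A) {t : List A → X} (ht : Multi k t) : Multi k (f ∘ t) :=
  ht.comp (f.restrictScalars k)

/-- The pullbacks of a cocycle along two comparison maps are cohomologous, since comparison maps are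
homotopic. -/
theorem IsCocycle.comparison_unique (hf : P.IsCocycle n f) (h : P.IsComparison θ)
    {θ' : List A → X} (h' : P.IsComparison θ') :
    ∃ K : List A → A, Multi k K ∧ ∀ w, f (θ w) - f (θ' w) = diff k A A K w := by
  obtain ⟨x₀, hx₀, hx₀'⟩ := P.exists_one
  obtain ⟨K, hK, hK'⟩ := exists_homotopy P.exact hx₀ hx₀' (κ := (1 : k)) (η := θ - θ')
    (h.multi.sub h'.multi)
    (fun w => by
      rw [Pi.sub_apply, map_sub, h.map_d, h'.map_d, map_sub, one_smul]; rfl)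
    (c := 0) Multi.zero
    (fun w => by
      rw [Pi.sub_apply, map_sub, map_zero]
      cases w with
      | nil => rw [h.aug_nil, h'.aug_nil]; simp
      | cons a w => rw [h.aug_cons, h'.aug_cons]; simp)
  refine ⟨f ∘ K, multi_comp f hK, fun w => ?_⟩
  have := congrArg f (hK' w)
  rw [map_add, hf.map_d, zero_add, one_smul, map_diff] at this
  rw [this, Pi.sub_apply, map_sub]

theorem IsComparison.evalLeft_cup (h : P.IsComparison θ) (w : List A) :
    BTensor.evalLeft P.aug (cup k A θ θ w) = θ w := by
  refine (map_splitSum ((BTensor.evalLeft P.aug).restrictScalars k) _ w).trans ?_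
  change splitSum k A X (fun u v => lAct k A X (P.aug (θ u)) (θ v)) w = _
  cases w with
  | nil => rw [splitSum_nil, h.aug_nil, map_one]; rfl
  | cons a w =>
    rw [splitSum_cons, h.aug_nil, map_one]
    simp only [h.aug_cons, map_zero, LinearMap.zero_apply]
    rw [splitSum_zero', add_zero]; rfl

theorem IsComparison.evalRight_cup (h : P.IsComparison θ) (w : List A) :
    BTensor.evalRight P.aug (cup k A θ θ w) = θ w := by
  refine (map_splitSum ((BTensor.evalRight P.aug).restrictScalars k) _ w).trans ?_
  change splitSum k A X (fun u v => rAct k A X (MulOpposite.op (P.aug (θ v))) (θ u)) w = _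
  have h0 : ∀ v : List A, v ≠ [] → P.aug (θ v) = 0 := fun v hv => by
    obtain ⟨a, v, rfl⟩ := List.exists_cons_of_ne_nil hv
    exact h.aug_cons a v
  rw [splitSum_eq_sum, Finset.sum_eq_single_of_mem w.length (by simp) fun i hi hne => ?_]
  · rw [List.drop_length, h.aug_nil, MulOpposite.op_one, map_one, List.take_length]; rfl
  · rw [Finset.mem_range] at hi
    rw [h0 _ fun h' => by rw [List.drop_eq_nil_iff] at h'; omega]
    simp

/-- The maps `Δ θ` and `θ ∪ θ` to `X ⊗_A X` are chain maps. -/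
theorem IsComparison.dT_sub_cup (h : P.IsComparison θ) (w : List A) :
    P.dT ((P.Δ ∘ θ - cup k A θ θ) w) = diff k A _ (P.Δ ∘ θ - cup k A θ θ) w := by
  have h1 : P.dT (cup k A θ θ w) = diff k A _ (cup k A θ θ) w := by
    rw [diff_cup, ← h.d_comp, ← show P.ε ∘ θ = wsign k θ from funext h.map_ε]
    refine (map_splitSum (P.dT.restrictScalars k) _ w).trans ?_
    exact splitSum_add' (A := A) (fun u v => BTensor.tmul k A (P.d (θ u)) (θ v))
      (fun u v => BTensor.tmul k A (P.ε (θ u)) (P.d (θ v))) w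
  rw [map_sub, Pi.sub_apply, Pi.sub_apply, map_sub, h1, Function.comp_apply, ← P.Δ_d', h.map_d,
    map_diff]

theorem IsComparison.multi_sub_cup (h : P.IsComparison θ) :
    Multi k (P.Δ ∘ θ - cup k A θ θ) :=
  (h.multi.comp (P.Δ.restrictScalars k)).sub <| Multi.splitSum
    (fun v => h.multi.comp ((BTensor.mk k A X X).flip (θ v)))
    fun u => h.multi.comp (BTensor.mk k A X X (θ u))

/-- `θ` is compatible with the diagonal maps of `X` and of the bar resolution up to homotopy. -/
theorem IsComparison.exists_diagonal_homotopy (h : P.IsComparison θ) :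
    ∃ H : List A → BTensor k A X X, Multi k H ∧
      ∀ w, P.dT (H w) + diff k A _ H w = P.Δ (θ w) - cup k A θ θ w := by
  obtain ⟨x₀, hx₀, hx₀'⟩ := P.exists_one
  obtain ⟨H, hH, hH'⟩ := exists_homotopy P.exact_tensor (y₀ := P.Δ x₀)
    (by rw [← P.Δ_d', hx₀, map_zero])
    (by rw [augT, LinearMap.comp_apply, P.counit_right, hx₀'])
    (κ := (1 : k)) (η := P.Δ ∘ θ - cup k A θ θ) h.multi_sub_cup
    (fun w => by rw [one_smul, h.dT_sub_cup])
    (c := 0) Multi.zero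
    (fun w => by
      rw [Pi.sub_apply, map_sub, augT, LinearMap.comp_apply, LinearMap.comp_apply,
        h.evalRight_cup, Function.comp_apply, P.counit_right]
      simp)
  exact ⟨H, hH, fun w => by simpa using hH' w⟩

theorem IsComparison.εpow_apply (h : P.IsComparison θ) (m : ℕ) (u : List A) :
    P.εpow m (θ u) = (-1 : k) ^ (m * u.length) • θ u := by
  induction m with
  | zero => simp [εpow]
  | succ m ih =>
    rw [εpow_succ, ih, envMap_smul, h.map_ε, wsign, smul_smul, ← pow_add, add_mul, one_mul]

theorem aug_comm (m : ℕ) (f : X →ₗ[Env k A] A) (z : BTensor k A X X) :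
    P.aug (P.comm m f z) =
      - f (BTensor.evalLeft P.aug z - BTensor.evalRight P.aug z) := by
  induction z using BTensor.induction with
  | h0 => simp
  | h1 x y =>
    rw [comm_tmul, BTensor.evalLeft_tmul, BTensor.evalRight_tmul, map_sub, map_sub, map_lAct,
      map_lAct, map_rAct, map_rAct, aug_εpow]
    simp only [lAct_self, rAct_self, MulOpposite.unop_op]
    abel
  | h2 a b ha hb =>
    simp only [map_add, ha, hb, map_sub]
    abel

/-- Inserting the pullback of `f'` into `θ` satisfies the equation of a homotopy lifting along `θ`,
with `θ ∪ θ` in place of `Δ θ`. -/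
theorem IsCocycle.d_insertion (hf' : P.IsCocycle m f') (h : P.IsComparison θ) (w : List A) :
    P.d (insertion k X (f' ∘ θ) (-(-1) ^ m) θ w) =
      P.comm m f' (cup k A θ θ w) -
        (-1 : k) ^ m • diff k A X (insertion k X (f' ∘ θ) (-(-1) ^ m) θ) w := by
  have h1 := diff_insertion h.multi (ρ := (-1 : k) ^ m) (by rw [← mul_pow]; simp)
    (hf'.wsign_comp h) w
  have h2 := insertion_zero ((-1 : k) ^ m) h.multi w
  have h3 : P.comm m f' (cup k A θ θ w) =
      leftCup k (f' ∘ θ) θ w - rightCup k ((-1) ^ m) θ (f' ∘ θ) w := by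
    refine (map_splitSum ((P.comm m f').restrictScalars k) _ w).trans
      ((splitSum_congr fun u v _ => ?_).trans (splitSum_sub' _ _ w))
    change P.comm m f' (BTensor.tmul k A (θ u) (θ v)) = _
    have h4 : P.εpow m (θ u) = ((-1 : k) ^ m) ^ u.length • θ u := by
      rw [h.εpow_apply, pow_mul]
    rw [comm_tmul, h4, map_smul]
    rfl
  rw [hf'.diff_comp h, h2, smul_zero, add_zero] at h1
  rw [h1, h3, ← h.d_comp]
  have h5 := map_insertion (P.d.restrictScalars k) (f' ∘ θ) (-(-1) ^ m) θ w
  change P.d _ = insertion k X (f' ∘ θ) (-(-1) ^ m) (P.d ∘ θ) w at h5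
  rw [h5]
  abel

/-- Up to a coboundary, `f` takes the same values on the homotopy lifting of `f'` and on the
insertion of `f'`, except for a term given by the diagonal homotopy `H`. -/
theorem IsCocycle.lifting_insertion (hf : P.IsCocycle n f) (hf' : P.IsCocycle m f')
    (h : P.IsComparison θ) {H : List A → BTensor k A X X} (hH : Multi k H)
    (hH' : ∀ w, P.dT (H w) + diff k A _ H w = P.Δ (θ w) - cup k A θ θ w) :
    ∃ K : List A → A, Multi k K ∧ ∀ w,
      f (P.lifting m f' (θ w)) - insertion k A (f' ∘ θ) (-(-1) ^ m) (f ∘ θ) w =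
        (-1 : k) ^ m • f (P.comm m f' (H w)) + diff k A A K w := by
  obtain ⟨x₀, hx₀, hx₀'⟩ := P.exists_one
  -- `φ (Δ θ - θ ∪ θ)` is a chain map of degree `1`, hence null-homotopic
  obtain ⟨v, hv, hv'⟩ := exists_homotopy P.exact hx₀ hx₀' (κ := (-1 : k))
    (η := P.φ ∘ (P.Δ ∘ θ - cup k A θ θ)) (h.multi_sub_cup.comp (P.φ.restrictScalars k))
    (fun w => by
      have h1 := P.homotopy' ((P.Δ ∘ θ - cup k A θ θ) w)
      rw [h.dT_sub_cup, map_diff] at h1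
      rw [Pi.sub_apply, map_sub (BTensor.evalLeft P.aug), map_sub (BTensor.evalRight P.aug),
        h.evalLeft_cup, h.evalRight_cup, Function.comp_apply, P.counit_left, P.counit_right,
        sub_self] at h1
      rw [neg_one_smul]
      exact eq_neg_of_add_eq_zero_left h1)
    (c := 0) Multi.zero (fun w => by rw [Function.comp_apply, P.aug_φ]; simp)
  have hv'' (w : List A) : f' (P.φ (P.Δ (θ w) - cup k A θ θ w)) = - diff k A A (f' ∘ v) w := by
    have := congrArg f' (hv' w)
    rw [map_add, hf'.map_d, envMap_smul, map_diff, zero_add, neg_one_smul] at this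
    exact this.symm
  let I : List A → X := insertion k X (f' ∘ θ) (-(-1) ^ m) θ
  let U : List A → X := P.comm m f' ∘ H
  have hI : Multi k I := (multi_comp f' h.multi).insertion h.multi _
  have hU : Multi k U := hH.comp ((P.comm m f').restrictScalars k)
  have hL : Multi k (P.lifting m f' ∘ θ) := h.multi.comp ((P.lifting m f').restrictScalars k)
  have hc : Multi k (f' ∘ v + f' ∘ P.φ ∘ H) :=
    (multi_comp f' hv).add (multi_comp f' (hH.comp (P.φ.restrictScalars k)))
  -- the equations for lifting and insertion differ in the commutator of `Δ θ - θ ∪ θ`, which is the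
  -- boundary of `H`; with the commutator `U` of `H` subtracted, the difference of lifting and
  -- insertion is a chain map up to sign, and its augmentation is a coboundary
  obtain ⟨K, hK, hK'⟩ := exists_homotopy P.exact hx₀ hx₀' (κ := -(-1 : k) ^ m)
    (η := P.lifting m f' ∘ θ - I - (-1 : k) ^ m • U) ((hL.sub hI).sub (hU.smul _))
    (fun w => by
      have h1 := hf'.comm_dT (H w)
      rw [eq_sub_of_add_eq (hH' w), map_sub, map_sub, map_diff] at h1
      simp only [Pi.sub_apply, Pi.smul_apply, map_sub, map_smul, Function.comp_apply]
      rw [hf'.d_lifting, hf'.d_insertion h, h.map_d, map_diff, envMap_smul]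
      change _ - (-1 : k) ^ m • P.d (P.comm m f' (H w)) = _
      rw [← h1]
      simp only [smul_sub, neg_smul, neg_one_pow_smul_smul]
      change _ = _ - - diff k A X (P.comm m f' ∘ H) w
      abel)
    hc
    (fun w => by
      have h0 : P.aug (I w) = 0 :=
        (map_insertion (P.aug.restrictScalars k) (f' ∘ θ) (-(-1) ^ m) θ w).trans
          (insertion_eq_zero _ _ h.aug_cons w)
      have h2 : P.aug (P.lifting m f' (θ w)) = 0 := P.aug_φ _
      simp only [Pi.sub_apply, Pi.smul_apply, map_sub, Function.comp_apply]
      rw [h0, h2, envMap_smul]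
      change 0 - 0 - (-1 : k) ^ m • P.aug (P.comm m f' (H w)) = _
      rw [aug_comm, ← P.homotopy', eq_sub_of_add_eq (hH' w), map_add f', hf'.map_d, map_sub P.φ,
        map_sub f', hv'', map_diff, map_diff, map_add, Pi.add_apply]
      simp only [smul_sub, neg_smul, smul_neg, smul_add, smul_zero]
      abel)
  refine ⟨-(-1 : k) ^ m • (f ∘ K), (multi_comp f hK).smul _, fun w => ?_⟩
  have := congrArg f (hK' w)
  rw [map_add, hf.map_d, zero_add, envMap_smul, map_diff] at this
  rw [map_smul, Pi.smul_apply, this]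
  have h5 := map_insertion (f.restrictScalars k) (f' ∘ θ) (-(-1) ^ m) θ w
  change f _ = insertion k A (f' ∘ θ) (-(-1) ^ m) (f ∘ θ) w at h5
  simp only [Pi.sub_apply, Pi.smul_apply, map_sub, envMap_smul, Function.comp_apply]
  rw [← h5]
  change _ = (-1 : k) ^ m • f (P.comm m f' (H w)) + (_ - _ - (-1 : k) ^ m • f (P.comm m f' (H w)))
  change f (P.lifting m f' (θ w)) - f (I w) = _
  abel

end DiagonalComplex

namespace BarCochain

section Bracket

variable {k : Type*} [Field k] {A : Type*} [Ring A] [Algebra k A]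

/-- The Gerstenhaber bracket of cochains of degrees `n` and `m`, as functions of words. The signs
`-(-1)^m` and `-(-1)^n` of the insertions are `(-1)^(m-1)` and `(-1)^(n-1)`. -/
def bracket (k : Type*) [Field k] [Algebra k A] (n m : ℕ) (F F' : List A → A) : List A → A :=
  insertion k A F' (-(-1) ^ m) F - (-1 : k) ^ ((n + 1) * (m + 1)) • insertion k A F (-(-1) ^ n) F'

variable {F F' H : List A → A} {n m : ℕ}

theorem insertHead_add {t : List A → A} (ht : Multi k t) (F F' : List A → A) (w : List A) :
    insertHead k A (F + F') t w = insertHead k A F t w + insertHead k A F' t w := by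
  simp only [insertHead_apply, ← splitSum_add', Pi.add_apply, ht.head_add]

theorem insertion_add (σ : k) {t : List A → A} (ht : Multi k t) (F F' : List A → A) :
    insertion k A (F + F') σ t = insertion k A F σ t + insertion k A F' σ t := by
  funext w
  induction w generalizing t with
  | nil => exact ht.head_add _ _ _
  | cons a w ih =>
    rw [Pi.add_apply, insertion_cons, insertion_cons, insertion_cons, ih (ht.shift a),
      insertHead_add ht, Pi.add_apply, smul_add]
    abel

theorem bracket_add_right (hF : Multi k F) (H : List A → A) :
    bracket k n m F (F' + H) = bracket k n m F F' + bracket k n m F H := by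
  rw [bracket, bracket, bracket, insertion_add _ hF, map_add, smul_add]
  abel

theorem bracket_symm (n m : ℕ) (F F' : List A → A) :
    bracket k n m F F' = (-1 : k) ^ ((n + 1) * (m + 1) + 1) • bracket k m n F' F := by
  rw [bracket, bracket, mul_comm (m + 1), pow_succ, smul_sub, smul_smul]
  have : (-1 : k) ^ ((n + 1) * (m + 1)) * (-1) ^ ((n + 1) * (m + 1)) = 1 := by
    rw [← mul_pow]; simp
  simp only [mul_neg_one, neg_mul, this, neg_smul, one_smul]
  abel

/-- The two products of cochains with values in `A` agree up to sign if `t` has the parity of `p`. -/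
theorem rightCup_eq {p q : ℕ} {t s : List A → A} (ht : ∀ w, wsign k t w = (-1 : k) ^ p • t w)
    (w : List A) :
    rightCup k ((-1 : k) ^ q) t s w = (-1 : k) ^ (p * q) • leftCup k t s w := by
  rw [rightCup, leftCup, ← splitSum_smul']
  refine splitSum_congr fun u v _ => ?_
  have h1 : ((-1 : k) ^ q) ^ u.length • t u = (-1 : k) ^ (p * q) • t u := by
    rw [← pow_mul]
    induction q with
    | zero => simp
    | succ q ih =>
      rw [add_mul, one_mul, pow_add, mul_smul, mul_add, mul_one, pow_add, mul_smul, ← ht u, wsign,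
        smul_comm, ih, smul_comm]
  rw [← map_smul, h1, map_smul, rAct_self, lAct_self]
  rfl

/-- The bracket of a cocycle `F` and a coboundary `dH` is a coboundary, namely that of the bracket
of `F` and `H`. -/
theorem exists_bracket_diff (hF : Multi k F) (hFd : diff k A A F = 0)
    (hFs : ∀ w, wsign k F w = (-1 : k) ^ n • F w) (hH : Multi k H)
    (hHs : ∀ w, wsign k H w = (-1 : k) ^ (m + 1) • H w) :
    ∃ K : List A → A, Multi k K ∧ bracket k n m F (diff k A A H) = diff k A A K := by
  refine ⟨insertion k A H (-(-1) ^ (m + 1)) F + ((-1 : k) ^ ((n + 1) * (m + 1)) * (-1) ^ n) •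
    insertion k A F (-(-1) ^ n) H, (hH.insertion hF _).add ((hF.insertion hH _).smul _), ?_⟩
  funext w
  have h1 := diff_insertion hF (ρ := (-1 : k) ^ (m + 1)) (by rw [← mul_pow]; simp) hHs w
  have h2 := diff_insertion hH (ρ := (-1 : k) ^ n) (by rw [← mul_pow]; simp) hFs w
  rw [hFd, map_zero, Pi.zero_apply, rightCup_eq hFs, sub_zero] at h1
  rw [hFd, insertion_zero _ hH, smul_zero, add_zero, rightCup_eq hHs] at h2
  have h1' : insertion k A (diff k A A H) (-(-1) ^ m) F w =
      diff k A A (insertion k A H (-(-1) ^ (m + 1)) F) w - (-1 : k) ^ (m + 1) •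
        (leftCup k H F w - (-1 : k) ^ (n * (m + 1)) • leftCup k F H w) := by
    have h3 := congrArg (fun z => (-1 : k) ^ (m + 1) • z) h1
    simp only [smul_add, neg_one_pow_smul_smul] at h3
    rw [h3, show -(-1 : k) ^ m = (-1) ^ (m + 1) by rw [pow_succ]; ring]
    abel
  have h2' : insertion k A F (-(-1) ^ n) (diff k A A H) w =
      leftCup k F H w - (-1 : k) ^ ((m + 1) * n) • leftCup k H F w -
        (-1 : k) ^ n • diff k A A (insertion k A F (-(-1) ^ n) H) w := by
    rw [h2]; abel
  have h4 : (-1 : k) ^ ((n + 1) * (m + 1)) * (-1) ^ ((m + 1) * n) = (-1) ^ (m + 1) := by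
    rw [← pow_add, show (n + 1) * (m + 1) + (m + 1) * n = 2 * (n * (m + 1)) + (m + 1) by ring,
      pow_add, pow_mul]
    simp
  have h5 : (-1 : k) ^ ((n + 1) * (m + 1)) = (-1) ^ (m + 1) * (-1) ^ (n * (m + 1)) := by
    rw [← pow_add]; congr 1; ring
  rw [bracket, Pi.sub_apply, Pi.smul_apply, h1', h2', map_add, map_smul, Pi.add_apply,
    Pi.smul_apply]
  simp only [smul_sub, smul_smul]
  rw [h4, h5]
  abel

end Bracket
end BarCochain

namespace DiagonalComplex

open BarCochain

variable {k A X : Type*} [Field k] [Ring A] [Algebra k A] [AddCommGroup X]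
    [Module k X] [Module (Env k A) X] [IsScalarTower k (Env k A) X] {P : DiagonalComplex k A X}
variable {θ : List A → X} {n m : ℕ} {f f' : X →ₗ[Env k A] A}

/-- The bracket of two cocycles on `X` corresponds to the Gerstenhaber bracket of their composites
with a comparison map: the error terms of `lifting_insertion` for `f ∘ f'` and `f' ∘ f` cancel by
`map_comm`. -/
theorem IsCocycle.bracket_comp (hf : P.IsCocycle n f) (hf' : P.IsCocycle m f')
    (h : P.IsComparison θ) : ∃ K : List A → A, Multi k K ∧
      ∀ w, BarCochain.bracket k n m (f ∘ θ) (f' ∘ θ) w - P.bracket n m f f' (θ w) =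
        diff k A A K w := by
  obtain ⟨H, hH, hH'⟩ := h.exists_diagonal_homotopy
  obtain ⟨K₁, hK₁, h₁⟩ := hf.lifting_insertion hf' h hH hH'
  obtain ⟨K₂, hK₂, h₂⟩ := hf'.lifting_insertion hf h hH hH'
  refine ⟨(-1 : k) ^ ((n + 1) * (m + 1)) • K₂ - K₁, (hK₂.smul _).sub hK₁, fun w => ?_⟩
  rw [map_sub, map_smul, Pi.sub_apply, Pi.smul_apply, ← sub_eq_of_eq_add' (h₁ w),
    ← sub_eq_of_eq_add' (h₂ w), hf.map_comm hf', bracket_apply, BarCochain.bracket, Pi.sub_apply,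
    Pi.smul_apply]
  simp only [smul_sub, smul_smul]
  rw [bracket_sign]
  simp only [neg_mul, mul_neg]
  abel

/-- The bracket of two cocycles on `X` represents the Gerstenhaber bracket of their classes. -/
theorem IsCocycle.bracket_represents (hf : P.IsCocycle n f) (hf' : P.IsCocycle m f')
    (h : P.IsComparison θ) {F F' H H' : List A → A} (hF : Multi k F)
    (hFs : ∀ w, wsign k F w = (-1 : k) ^ n • F w) (hH : Multi k H)
    (hHs : ∀ w, wsign k H w = (-1 : k) ^ (n + 1) • H w) (hFH : F = f ∘ θ + diff k A A H)
    (hH' : Multi k H') (hHs' : ∀ w, wsign k H' w = (-1 : k) ^ (m + 1) • H' w)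
    (hFH' : F' = f' ∘ θ + diff k A A H') : ∃ K : List A → A, Multi k K ∧
      ∀ w, BarCochain.bracket k n m F F' w - P.bracket n m f f' (θ w) = diff k A A K w := by
  have hFd : diff k A A F = 0 := by
    funext w
    rw [hFH, map_add, hf.diff_comp h, zero_add, diff_diff]; rfl
  obtain ⟨K₁, hK₁, h₁⟩ := exists_bracket_diff (m := m) hF hFd hFs hH' hHs'
  obtain ⟨K₂, hK₂, h₂⟩ := exists_bracket_diff (m := n) (multi_comp f' h.multi) (hf'.diff_comp h)
    (hf'.wsign_comp h) hH hHs
  obtain ⟨K₃, hK₃, h₃⟩ := hf.bracket_comp hf' h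
  refine ⟨K₁ + (-1 : k) ^ ((n + 1) * (m + 1) + 1) • K₂ + K₃,
    (hK₁.add (hK₂.smul _)).add hK₃, fun w => ?_⟩
  rw [hFH', bracket_add_right hF, bracket_symm n m F, hFH,
    bracket_add_right (multi_comp f' h.multi), smul_add, ← bracket_symm, h₂, ← hFH, h₁, map_add,
    map_add, map_smul, Pi.add_apply, Pi.add_apply, Pi.add_apply, Pi.add_apply, ← h₃ w]
  abel

end DiagonalComplex

/-! ### Signs and contractions of resolutions -/

namespace BimodResolution

variable {k : Type*} [Field k] {A : Type*} [Ring A] [Algebra k A]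
variable {P : Type*} [AddCommGroup P] [Module k P] [Module (Env k A) P]
  [IsScalarTower k (Env k A) P] (R : BimodResolution k A P)

theorem sgn_sgn (x : P) : R.sgn (R.sgn x) = x :=
  LinearMap.congr_fun (f := (R.sgn.restrictScalars k) ∘ₗ (R.sgn.restrictScalars k))
    (g := LinearMap.id) (graded_hom_ext R.gr fun n m hm => by
      change R.sgn (R.sgn m) = m
      rw [R.sgn_of_mem hm, envMap_smul, R.sgn_of_mem hm,
        neg_one_pow_smul_smul]) x

theorem d_sgn (x : P) : R.d (R.sgn x) = - R.sgn (R.d x) :=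
  LinearMap.congr_fun (f := (R.d.restrictScalars k) ∘ₗ (R.sgn.restrictScalars k))
    (g := - (R.sgn.restrictScalars k) ∘ₗ (R.d.restrictScalars k))
    (graded_hom_ext R.gr fun n m hm => by
      change R.d (R.sgn m) = - R.sgn (R.d m)
      rw [R.sgn_of_mem hm, envMap_smul]
      cases n with
      | zero => rw [R.d_zero m hm]; simp
      | succ n => rw [R.sgn_of_mem (R.d_mem n m hm), pow_succ]; simp) x

theorem aug_sgn (x : P) : R.aug (R.sgn x) = R.aug x :=
  LinearMap.congr_fun (f := (R.aug.restrictScalars k) ∘ₗ (R.sgn.restrictScalars k))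
    (g := R.aug.restrictScalars k) (graded_hom_ext R.gr fun n m hm => by
      change R.aug (R.sgn m) = R.aug m
      rw [R.sgn_of_mem hm, envMap_smul]
      cases n with
      | zero => simp
      | succ n => rw [R.aug_pos n m hm, smul_zero]) x

theorem sgn_mem {n : ℕ} {x : P} (hx : x ∈ R.gr n) : R.sgn x ∈ R.gr n := by
  rw [R.sgn_of_mem hx]
  exact Submodule.smul_of_tower_mem _ _ hx

theorem map_sgn_of_mem {n : ℕ} {z : BTensor k A P P} (hz : z ∈ R.grTensor n) :
    BTensor.map R.sgn R.sgn z = (-1 : k) ^ n • z := by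
  induction hz using Submodule.span_induction with
  | zero => simp
  | add x y _ _ hx hy => rw [map_add, hx, hy, smul_add]
  | smul r x _ hx => rw [envMap_smul, hx, smul_comm]
  | mem x hx =>
    obtain ⟨i, j, m, n, hm, hn, rfl, rfl⟩ := hx
    rw [BTensor.map_tmul, R.sgn_of_mem hm, R.sgn_of_mem hn, BTensor.smul_tmul, BTensor.tmul_smul,
      smul_smul, ← pow_add]

/-- Linear maps out of `P ⊗_A P` agree if they agree on homogeneous elements. -/
theorem tensor_ext {N : Type*} [AddCommGroup N] [Module k N] {f g : BTensor k A P P →ₗ[k] N}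
    (h : ∀ n, ∀ z ∈ R.grTensor n, f z = g z) : f = g :=
  BTensor.hom_ext fun x y => LinearMap.congr_fun₂ (f := (BTensor.mk k A P P).compr₂ f)
    (g := (BTensor.mk k A P P).compr₂ g)
    (graded_hom_ext R.gr fun i x hx => graded_hom_ext R.gr fun j y hy =>
      h (i + j) _ (Submodule.subset_span ⟨i, j, x, y, hx, hy, rfl, rfl⟩)) x y

end BimodResolution

theorem DGCoalgResolution.Δ_sgn {k : Type*} [Field k] {A : Type*} [Ring A] [Algebra k A]
    {P : Type*} [AddCommGroup P] [Module k P] [Module (Env k A) P]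
    [IsScalarTower k (Env k A) P] (R : DGCoalgResolution k A P) (x : P) :
    R.Δ (R.sgn x) = BTensor.map R.sgn R.sgn (R.Δ x) :=
  LinearMap.congr_fun (f := (R.Δ.restrictScalars k) ∘ₗ (R.sgn.restrictScalars k))
    (g := ((BTensor.map R.sgn R.sgn).restrictScalars k) ∘ₗ (R.Δ.restrictScalars k))
    (graded_hom_ext R.gr fun n m hm => by
      change R.Δ (R.sgn m) = BTensor.map R.sgn R.sgn (R.Δ m)
      rw [R.sgn_of_mem hm, envMap_smul, R.map_sgn_of_mem (R.Δ_degree n m hm)]) x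

namespace IsCounitHomotopy

variable {k : Type*} [Field k] {A : Type*} [Ring A] [Algebra k A]
variable {P : Type*} [AddCommGroup P] [Module k P] [Module (Env k A) P]
  [IsScalarTower k (Env k A) P] {R : BimodResolution k A P} {φ : BTensor k A P P →ₗ[Env k A] P}

theorem map_sgn (h : IsCounitHomotopy R φ) (z : BTensor k A P P) :
    φ (BTensor.map R.sgn R.sgn z) = - R.sgn (φ z) :=
  LinearMap.congr_fun
    (f := (φ.restrictScalars k) ∘ₗ ((BTensor.map R.sgn R.sgn).restrictScalars k))
    (g := - (R.sgn.restrictScalars k) ∘ₗ (φ.restrictScalars k))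
    (R.tensor_ext fun n z hz => by
      change φ (BTensor.map R.sgn R.sgn z) = - R.sgn (φ z)
      rw [R.map_sgn_of_mem hz, envMap_smul, R.sgn_of_mem (h.degree n z hz), pow_succ]
      simp) z

theorem aug_map (h : IsCounitHomotopy R φ) (z : BTensor k A P P) : R.aug (φ z) = 0 :=
  LinearMap.congr_fun (f := (R.aug.restrictScalars k) ∘ₗ (φ.restrictScalars k)) (g := 0)
    (R.tensor_ext fun n z hz => R.aug_pos n _ (h.degree n z hz)) z

end IsCounitHomotopy

namespace BimodResolution

variable {k : Type*} [Field k] {A : Type*} [Ring A] [Algebra k A]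
variable {P : Type*} [AddCommGroup P] [Module k P] [Module (Env k A) P]
  [IsScalarTower k (Env k A) P] (R : BimodResolution k A P)

/-- The projection to the component of degree `n`. -/
def pr (n : ℕ) : P →ₗ[k] P := gradedMap k R.gr fun i => if i = n then LinearMap.id else 0

theorem pr_of_mem {n : ℕ} {x : P} (hx : x ∈ R.gr n) : R.pr n x = x := by
  rw [pr, gradedMap_of_mem _ hx, if_pos rfl]; rfl

theorem pr_of_mem_ne {n i : ℕ} {x : P} (hx : x ∈ R.gr i) (h : i ≠ n) : R.pr n x = 0 := by
  rw [pr, gradedMap_of_mem _ hx, if_neg h]; rfl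

theorem pr_eq (n : ℕ) (x : P) : R.pr n x = (DirectSum.decompose R.gr x n : P) := by
  induction x using DirectSum.Decomposition.inductionOn R.gr with
  | zero => simp
  | add x y hx hy => simp [hx, hy]
  | @homogeneous i m =>
    by_cases h : i = n
    · subst h; rw [R.pr_of_mem m.2, DirectSum.decompose_of_mem_same _ m.2]
    · rw [R.pr_of_mem_ne m.2 h, DirectSum.decompose_of_mem_ne _ m.2 h]

theorem pr_mem (n : ℕ) (x : P) : R.pr n x ∈ R.gr n := by
  rw [pr_eq]; exact SetLike.coe_mem _

theorem d_pr (n : ℕ) (x : P) : R.d (R.pr (n + 1) x) = R.pr n (R.d x) :=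
  LinearMap.congr_fun (f := (R.d.restrictScalars k) ∘ₗ R.pr (n + 1))
    (g := R.pr n ∘ₗ (R.d.restrictScalars k)) (graded_hom_ext R.gr fun i m hm => by
      change R.d (R.pr (n + 1) m) = R.pr n (R.d m)
      cases i with
      | zero => rw [R.d_zero m hm, R.pr_of_mem_ne hm (by omega), map_zero, map_zero]
      | succ i =>
        by_cases h : i = n
        · subst h; rw [R.pr_of_mem hm, R.pr_of_mem (R.d_mem i m hm)]
        · rw [R.pr_of_mem_ne hm (by omega), R.pr_of_mem_ne (R.d_mem i m hm) h, map_zero]) x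

theorem aug_pr (x : P) : R.aug (R.pr 0 x) = R.aug x :=
  LinearMap.congr_fun (f := (R.aug.restrictScalars k) ∘ₗ R.pr 0)
    (g := R.aug.restrictScalars k) (graded_hom_ext R.gr fun i m hm => by
      change R.aug (R.pr 0 m) = R.aug m
      cases i with
      | zero => rw [R.pr_of_mem hm]
      | succ i => rw [R.pr_of_mem_ne hm (by omega), map_zero, R.aug_pos i m hm]) x

/-- The total complex is exact, since it is exact in each degree. -/
theorem exact (x : P) (h : R.d x = 0) (h' : R.aug x = 0) : ∃ y, R.d y = x := by
  classical
  have key (n : ℕ) : ∃ y, R.d y = R.pr n x := by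
    cases n with
    | zero =>
      obtain ⟨y, -, hy⟩ := R.exact_zero _ (R.pr_mem 0 x) (by rw [R.aug_pr, h'])
      exact ⟨y, hy⟩
    | succ n =>
      obtain ⟨y, -, hy⟩ := R.exact_succ n _ (R.pr_mem _ x) (by rw [R.d_pr, h, map_zero])
      exact ⟨y, hy⟩
  choose y hy using key
  refine ⟨∑ n ∈ (DirectSum.decompose R.gr x).support, y n, ?_⟩
  rw [map_sum]
  conv_rhs => rw [← DirectSum.sum_support_decompose R.gr x]
  exact Finset.sum_congr rfl fun n _ => (hy n).trans (R.pr_eq n x)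

theorem exists_one : ∃ x ∈ R.gr 0, R.aug x = 1 := by
  obtain ⟨x, hx⟩ := R.aug_surjective 1
  exact ⟨R.pr 0 x, R.pr_mem 0 x, (R.aug_pr x).trans hx⟩

/-- A resolution over a field has a homogeneous contraction as a complex of vector spaces. -/
theorem exists_contraction : ∃ (s : P →ₗ[k] P) (σ : A →ₗ[k] P),
    (∀ n, ∀ x ∈ R.gr n, s x ∈ R.gr (n + 1)) ∧ (∀ a, σ a ∈ R.gr 0) ∧ (∀ a, R.aug (σ a) = a) ∧
      ∀ x, R.d (s x) + s (R.d x) = x - σ (R.aug x) := by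
  obtain ⟨x₀, hx₀, hx₀'⟩ := R.exists_one
  obtain ⟨s, σ, hs, hμs, hσ, hdσ, hμσ⟩ :=
    BarCochain.exists_section R.exact (R.d_zero x₀ hx₀) hx₀'
  have hσ₀ (a : A) : σ a ∈ R.gr 0 := by
    rw [hσ]; exact (R.gr 0).smul_mem _ hx₀
  let d' : P →ₗ[k] P := R.d.restrictScalars k
  -- `h` is a contraction; it is made homogeneous below
  let h : P →ₗ[k] P := s ∘ₗ (LinearMap.id - σ ∘ₗ R.aug.restrictScalars k - s ∘ₗ d')
  have hh (x : P) : R.d (h x) + h (R.d x) = x - σ (R.aug x) := by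
    have h1 : R.d (s (R.d x)) = R.d x := hs _ (R.d_d x) (R.aug_d x)
    change R.d (s (x - σ (R.aug x) - s (R.d x))) +
      s (R.d x - σ (R.aug (R.d x)) - s (R.d (R.d x))) = _
    rw [hs _ (by rw [map_sub, map_sub, hdσ, h1]; simp)
      (by rw [map_sub, map_sub, hμσ, hμs]; simp), R.aug_d, R.d_d]
    simp
  let h' : P →ₗ[k] P := gradedMap k R.gr fun n => R.pr (n + 1) ∘ₗ h
  have h'_mem {n : ℕ} {x : P} (hx : x ∈ R.gr n) : h' x = R.pr (n + 1) (h x) :=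
    gradedMap_of_mem _ hx
  have key : d' ∘ₗ h' + h' ∘ₗ d' = LinearMap.id - σ ∘ₗ R.aug.restrictScalars k :=
    graded_hom_ext R.gr fun n x hx => by
      change R.d (h' x) + h' (R.d x) = x - σ (R.aug x)
      rw [h'_mem hx, R.d_pr]
      cases n with
      | zero =>
        have h1 := hh x
        rw [R.d_zero x hx, map_zero, add_zero] at h1
        rw [R.d_zero x hx, map_zero, add_zero, h1, map_sub, R.pr_of_mem hx, R.pr_of_mem (hσ₀ _)]
      | succ n =>
        rw [h'_mem (R.d_mem n x hx), ← map_add, hh, R.aug_pos n x hx, map_zero, sub_zero,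
          R.pr_of_mem hx]
  refine ⟨h', σ, fun n x hx => by rw [h'_mem hx]; exact R.pr_mem _ _, hσ₀, hμσ, fun x => ?_⟩
  have hx := LinearMap.congr_fun key x
  exact hx

end BimodResolution

/-! ### The twisted product as a complex -/

section TwistedComplex

variable {k G : Type*} [Field k] [Group G] [DecidableEq G]
variable {C : Type*} [AddCommGroup C] [Module k C] [Module (Env k (MonoidAlgebra k G)) C]
  [IsScalarTower k (Env k (MonoidAlgebra k G)) C]
variable {S : Type*} [Ring S] [Algebra k S] [MulSemiringAction G S] [SMulCommClass G k S]
variable {D : Type*} [AddCommGroup D] [Module k D] [Module (Env k S) D]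
  [IsScalarTower k (Env k S) D]
variable (R : GroupGradedResolution k G C) (T : EquivariantResolution k G S D)

variable {R T} in
/-- Linear maps out of the twisted product agree if they agree on homogeneous tensors. -/
theorem twistedRes_ext {N : Type*} [AddCommGroup N] [Module k N] {f f' : TwistedRes R T →ₗ[k] N}
    (h : ∀ i j g c d, c ∈ R.gr i → c ∈ R.comp g → d ∈ T.gr j →
      f (TwistedProduct.mk _ _ c d) = f' (TwistedProduct.mk _ _ c d)) : f = f' :=
  TensorProduct.ext <| bigraded_ext (R := R) fun i g c hi hg =>
    graded_hom_ext T.gr fun j d hd => h i j g c d hi hg hd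

theorem dX_mk (c : C) (d : D) : dX R T (TwistedProduct.mk _ _ c d) =
    TwistedProduct.mk _ _ (R.d c) d + TwistedProduct.mk _ _ (R.sgn c) (T.d d) := rfl

theorem sgnX_mk (c : C) (d : D) : sgnX R T (TwistedProduct.mk _ _ c d) =
    TwistedProduct.mk _ _ (R.sgn c) (T.sgn d) := rfl

/-- The differential of the twisted product as a bimodule map. -/
def dXHom : TwistedRes R T →ₗ[Env k (SkewMonoidAlgebra S G)] TwistedRes R T :=
  TwistedProduct.bimodHom (dX R T)
    (fun s h c hc d => by
      rw [dX_mk, dX_mk, TwistedProduct.lAct_s, map_add, TwistedProduct.leftS_mk (R.d_comp h c hc),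
        TwistedProduct.leftS_mk (sgn_comp hc), map_lAct])
    (fun g c d => by
      rw [dX_mk, dX_mk, TwistedProduct.lAct_g, map_add, TwistedProduct.leftG_mk,
        TwistedProduct.leftG_mk]
      exact congrArg₂ (fun e e' => TwistedProduct.mk _ _ e d + TwistedProduct.mk _ _ e' (T.d d))
        (map_lAct R.d _ c) (map_lAct R.sgn _ c))
    (fun s c d => by
      rw [dX_mk, dX_mk, TwistedProduct.rAct_s, map_add, TwistedProduct.rightS_mk,
        TwistedProduct.rightS_mk, map_rAct])
    (fun g c d => by
      rw [dX_mk, dX_mk, TwistedProduct.rAct_g, map_add, TwistedProduct.rightG_mk,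
        TwistedProduct.rightG_mk, T.ρ_d]
      exact congrArg₂ (fun e e' => TwistedProduct.mk _ _ e (T.ρ g⁻¹ d) +
        TwistedProduct.mk _ _ e' (T.ρ g⁻¹ (T.d d))) (map_rAct R.d _ c) (map_rAct R.sgn _ c))

variable (k G S) in
/-- The inclusion `kG → S ⋊ G`. -/
def groupIncl : MonoidAlgebra k G →ₐ[k] SkewMonoidAlgebra S G :=
  MonoidAlgebra.lift k (SkewMonoidAlgebra S G) G (SkewMonoidAlgebra.of S G)

theorem groupIncl_single (g : G) (r : k) : groupIncl k G S (MonoidAlgebra.single g r) =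
    r • SkewMonoidAlgebra.single g 1 :=
  MonoidAlgebra.lift_single _ _ _

theorem groupIncl_of (g : G) : groupIncl k G S (MonoidAlgebra.of k G g) =
    SkewMonoidAlgebra.single g 1 :=
  MonoidAlgebra.lift_of _ _

theorem augX_mk (c : C) (d : D) : augX R T (TwistedProduct.mk _ _ c d) =
    groupIncl k G S (R.aug c) * SkewMonoidAlgebra.single 1 (T.aug d) := rfl

theorem skew_single_mul_single (s t : S) (g : G) :
    (SkewMonoidAlgebra.single 1 s * SkewMonoidAlgebra.single g t : SkewMonoidAlgebra S G) =
      SkewMonoidAlgebra.single g (s * t) := by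
  rw [SkewMonoidAlgebra.single_mul_single]; simp

theorem skew_single_comm (s : S) (g : G) :
    (SkewMonoidAlgebra.single 1 s * SkewMonoidAlgebra.single g 1 : SkewMonoidAlgebra S G) =
      SkewMonoidAlgebra.single g 1 * SkewMonoidAlgebra.single 1 (g⁻¹ • s) := by
  rw [SkewMonoidAlgebra.single_mul_single, SkewMonoidAlgebra.single_mul_single]; simp

/-- The augmentation of the twisted product as a bimodule map. -/
def augXHom : TwistedRes R T →ₗ[Env k (SkewMonoidAlgebra S G)] SkewMonoidAlgebra S G :=
  TwistedProduct.bimodHom (augX R T)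
    (fun s h c hc d => by
      obtain ⟨r, hr⟩ := R.aug_comp h c hc
      rw [augX_mk, augX_mk, hr, groupIncl_single, map_lAct, lAct_self, lAct_self,
        smul_mul_assoc r, smul_mul_assoc r, mul_smul_comm r, ← mul_assoc, skew_single_comm,
        mul_assoc, skew_single_mul_single])
    (fun g c d => by
      have h : R.aug (gLeft k G C g c) = MonoidAlgebra.of k G g * R.aug c :=
        (map_lAct R.aug _ c).trans (lAct_self _ _ _ _)
      rw [augX_mk, augX_mk, h, map_mul, groupIncl_of, lAct_self, mul_assoc])
    (fun s c d => by
      rw [augX_mk, augX_mk, map_rAct, rAct_self, rAct_self, MulOpposite.unop_op,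
        MulOpposite.unop_op, mul_assoc, skew_single_mul_single])
    (fun g c d => by
      have h : R.aug (gRight k G C g c) = R.aug c * MonoidAlgebra.of k G g :=
        (map_rAct R.aug _ c).trans (rAct_self _ _ _ _)
      rw [augX_mk, augX_mk, h, map_mul, groupIncl_of, rAct_self, MulOpposite.unop_op, T.aug_ρ,
        mul_assoc, mul_assoc, skew_single_comm])

theorem augXHom_apply (x : TwistedRes R T) : augXHom R T x = augX R T x := rfl

theorem lAct_groupIncl (a : MonoidAlgebra k G) (c : C) (d : D) :
    lAct k (SkewMonoidAlgebra S G) (TwistedRes R T) (groupIncl k G S a)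
      (TwistedProduct.mk _ _ c d) =
        TwistedProduct.mk _ _ (lAct k (MonoidAlgebra k G) C a c) d := by
  induction a using MonoidAlgebra.induction_on with
  | of g => rw [groupIncl_of, TwistedProduct.lAct_g, TwistedProduct.leftG_mk]; rfl
  | add a b ha hb =>
    simp only [map_add, LinearMap.add_apply, ha, hb]
  | smul r a ha =>
    simp only [map_smul, LinearMap.smul_apply, ha]

theorem rAct_groupIncl (g : G) (r : k) (c : C) (d : D) :
    rAct k (SkewMonoidAlgebra S G) (TwistedRes R T)
      (MulOpposite.op (groupIncl k G S (MonoidAlgebra.single g r))) (TwistedProduct.mk _ _ c d) =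
        TwistedProduct.mk _ _ (rAct k (MonoidAlgebra k G) C
          (MulOpposite.op (MonoidAlgebra.single g r)) c) (T.ρ g⁻¹ d) := by
  have h : (MonoidAlgebra.single g r : MonoidAlgebra k G) = r • MonoidAlgebra.of k G g := by simp
  rw [groupIncl_single, h, MulOpposite.op_smul, MulOpposite.op_smul, map_smul, map_smul,
    LinearMap.smul_apply, LinearMap.smul_apply, TwistedProduct.rAct_g, TwistedProduct.rightG_mk,
    map_smul, LinearMap.smul_apply]
  rfl

theorem dX_sgnX (x : TwistedRes R T) : dX R T (sgnX R T x) = - sgnX R T (dX R T x) :=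
  eq_neg_of_add_eq_zero_left <| LinearMap.congr_fun
    (f := dX R T ∘ₗ (sgnX R T).restrictScalars k + (sgnX R T).restrictScalars k ∘ₗ dX R T)
    (g := 0) (twistedRes_ext fun i j g c d hi hg hj => by
      change dX R T (sgnX R T (TwistedProduct.mk _ _ c d)) +
        sgnX R T (dX R T (TwistedProduct.mk _ _ c d)) = 0
      rw [dX_mk, map_add, sgnX_mk, sgnX_mk, sgnX_mk, dX_mk, R.d_sgn, T.d_sgn, R.sgn_sgn]
      simp only [map_neg, LinearMap.neg_apply]
      abel) x

theorem sgnX_sgnX (x : TwistedRes R T) : sgnX R T (sgnX R T x) = x :=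
  LinearMap.congr_fun (f := (sgnX R T).restrictScalars k ∘ₗ (sgnX R T).restrictScalars k)
    (g := LinearMap.id) (twistedRes_ext fun i j g c d hi hg hj => by
      change sgnX R T (sgnX R T _) = TwistedProduct.mk _ _ c d
      rw [sgnX_mk, sgnX_mk, R.sgn_sgn, T.sgn_sgn]) x

theorem augX_dX (x : TwistedRes R T) : augX R T (dX R T x) = 0 :=
  LinearMap.congr_fun (f := augX R T ∘ₗ dX R T)
    (g := 0) (twistedRes_ext fun i j g c d hi hg hj => by
      change augX R T (dX R T _) = 0
      rw [dX_mk, map_add, augX_mk, augX_mk, R.aug_d, T.aug_d]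
      simp) x

theorem augX_sgnX (x : TwistedRes R T) : augX R T (sgnX R T x) = augX R T x :=
  LinearMap.congr_fun (f := augX R T ∘ₗ (sgnX R T).restrictScalars k)
    (g := augX R T) (twistedRes_ext fun i j g c d hi hg hj => by
      change augX R T (sgnX R T _) = augX R T _
      rw [sgnX_mk, augX_mk, augX_mk, R.aug_sgn, T.aug_sgn]) x

/-- The differential of `X ⊗_A X`. -/
def dXT : BTensor k (SkewMonoidAlgebra S G) (TwistedRes R T) (TwistedRes R T)
    →ₗ[Env k (SkewMonoidAlgebra S G)]
      BTensor k (SkewMonoidAlgebra S G) (TwistedRes R T) (TwistedRes R T) :=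
  BTensor.map (dXHom R T) LinearMap.id + BTensor.map (sgnX R T) (dXHom R T)

/-- The differential of `(C ⊗_{kG} C) ⊗ (D ⊗_S D)`. -/
def dZ : BTensor k (MonoidAlgebra k G) C C ⊗[k] BTensor k S D D →ₗ[k]
    BTensor k (MonoidAlgebra k G) C C ⊗[k] BTensor k S D D :=
  TensorProduct.map (R.dTensor.restrictScalars k) LinearMap.id +
    TensorProduct.map ((BTensor.map R.sgn R.sgn).restrictScalars k) (T.dTensor.restrictScalars k)

variable {R T}

theorem sgnPow_succ (i : ℕ) (d : D) : T.sgnPow (i + 1) d = T.sgn (T.sgnPow i d) := by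
  rw [EquivariantResolution.sgnPow, pow_succ', Module.End.mul_apply]; rfl

theorem sgnPow_succ' (i : ℕ) (d : D) : T.sgnPow (i + 1) d = T.sgnPow i (T.sgn d) := by
  rw [EquivariantResolution.sgnPow, pow_succ, Module.End.mul_apply]; rfl

theorem d_sgnPow (i : ℕ) (d : D) : T.d (T.sgnPow i d) = (-1 : k) ^ i • T.sgnPow i (T.d d) := by
  induction i with
  | zero => simp [EquivariantResolution.sgnPow]
  | succ i ih => rw [sgnPow_succ, T.d_sgn, ih, envMap_smul, ← sgnPow_succ, pow_succ]; simp

theorem aug_sgnPow (i : ℕ) (d : D) : T.aug (T.sgnPow i d) = T.aug d := by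
  induction i with
  | zero => rfl
  | succ i ih => rw [sgnPow_succ, T.aug_sgn, ih]

/-- The value of `1 ⊗ τ ⊗ 1` on a tensor. -/
theorem twist_of_mem {i : ℕ} {g : G} {c' : C} (hi : c' ∈ R.gr i) (hg : c' ∈ R.comp g)
    (c : C) (d d' : D) :
    twist R T (BTensor.tmul k (MonoidAlgebra k G) c c' ⊗ₜ BTensor.tmul k S d d') =
      BTensor.tmul k (SkewMonoidAlgebra S G)
        (TwistedProduct.mk _ _ c (T.ρ g (T.sgnPow i d)) : TwistedRes R T)
        (TwistedProduct.mk _ _ c' d') :=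
  preTwist_tmul hi hg c d d'

theorem twist_dZ_tmul {i : ℕ} {g : G} {c' : C} (hi : c' ∈ R.gr i) (hg : c' ∈ R.comp g)
    (c : C) (d d' : D) :
    twist R T (dZ R T (BTensor.tmul k (MonoidAlgebra k G) c c' ⊗ₜ BTensor.tmul k S d d')) =
      dXT R T (twist R T
        (BTensor.tmul k (MonoidAlgebra k G) c c' ⊗ₜ BTensor.tmul k S d d')) := by
  have h1 : dZ R T (BTensor.tmul k (MonoidAlgebra k G) c c' ⊗ₜ BTensor.tmul k S d d') =
    BTensor.tmul k (MonoidAlgebra k G) (R.d c) c' ⊗ₜ BTensor.tmul k S d d' +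
    BTensor.tmul k (MonoidAlgebra k G) (R.sgn c) (R.d c') ⊗ₜ BTensor.tmul k S d d' +
    (BTensor.tmul k (MonoidAlgebra k G) (R.sgn c) (R.sgn c') ⊗ₜ BTensor.tmul k S (T.d d) d' +
    BTensor.tmul k (MonoidAlgebra k G) (R.sgn c) (R.sgn c') ⊗ₜ
      BTensor.tmul k S (T.sgn d) (T.d d')) := by
    rw [← TensorProduct.add_tmul, ← TensorProduct.tmul_add]
    rfl
  have h2 (x y : TwistedRes R T) : dXT R T (BTensor.tmul k (SkewMonoidAlgebra S G) x y) =
    BTensor.tmul k (SkewMonoidAlgebra S G) (dX R T x) y +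
    BTensor.tmul k (SkewMonoidAlgebra S G) (sgnX R T x) (dX R T y) := rfl
  have h3 : twist R T (BTensor.tmul k (MonoidAlgebra k G) (R.sgn c) (R.d c') ⊗ₜ
      BTensor.tmul k S d d') = BTensor.tmul k (SkewMonoidAlgebra S G)
        (TwistedProduct.mk _ _ (R.sgn c) (T.ρ g (T.sgnPow (i + 1) d)) : TwistedRes R T)
        (TwistedProduct.mk _ _ (R.d c') d') := by
    -- `d c'` has degree `i - 1`, which has the parity of `i + 1`
    cases i with
    | zero =>
      rw [R.d_zero c' hi, map_zero, LinearMap.zero_apply, BTensor.tmul_zero, BTensor.tmul_zero,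
        TensorProduct.zero_tmul, map_zero]
    | succ i =>
      rw [twist_of_mem (R.d_mem i c' hi) (R.d_comp g c' hg), sgnPow_succ, sgnPow_succ, T.sgn_sgn]
  rw [h1, map_add, map_add, map_add, h3, twist_of_mem hi hg, twist_of_mem hi hg,
    twist_of_mem (R.sgn_mem hi) (sgn_comp hg), twist_of_mem (R.sgn_mem hi) (sgn_comp hg), h2,
    dX_mk, dX_mk, sgnX_mk, BTensor.add_tmul, BTensor.tmul_add, T.ρ_d, d_sgnPow, sgn_ρ,
    ← sgnPow_succ, sgnPow_succ', R.sgn_of_mem hi]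
  simp only [map_smul, LinearMap.smul_apply, BTensor.smul_tmul, BTensor.tmul_smul]
  abel

/-- `1 ⊗ τ ⊗ 1` is a chain map. -/
theorem twist_dZ (z : BTensor k (MonoidAlgebra k G) C C ⊗[k] BTensor k S D D) :
    twist R T (dZ R T z) = dXT R T (twist R T z) :=
  LinearMap.congr_fun (f := twist R T ∘ₗ dZ R T) (g := (dXT R T).restrictScalars k ∘ₗ twist R T)
    (twist_ext (R := R) fun _ _ c _ d d' hi hg => twist_dZ_tmul hi hg c d d') z

theorem twist_sgn (z : BTensor k (MonoidAlgebra k G) C C ⊗[k] BTensor k S D D) :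
    twist R T (TensorProduct.map ((BTensor.map R.sgn R.sgn).restrictScalars k)
      ((BTensor.map T.sgn T.sgn).restrictScalars k) z) =
        BTensor.map (sgnX R T) (sgnX R T) (twist R T z) :=
  LinearMap.congr_fun (f := twist R T ∘ₗ TensorProduct.map
      ((BTensor.map R.sgn R.sgn).restrictScalars k) ((BTensor.map T.sgn T.sgn).restrictScalars k))
    (g := (BTensor.map (sgnX R T) (sgnX R T)).restrictScalars k ∘ₗ twist R T)
    (twist_ext (R := R) fun i g c c' d d' hi hg => by
      change twist R T (BTensor.tmul k _ (R.sgn c) (R.sgn c') ⊗ₜ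
          BTensor.tmul k S (T.sgn d) (T.sgn d')) =
        BTensor.map (sgnX R T) (sgnX R T) (twist R T _)
      rw [twist_of_mem hi hg, twist_of_mem (R.sgn_mem hi) (sgn_comp hg), BTensor.map_tmul, sgnX_mk,
        sgnX_mk, sgn_ρ, ← sgnPow_succ, sgnPow_succ']) z

/-- `Δ_X` is a chain map. -/
theorem diagX_dX (x : TwistedRes R T) : diagX R T (dX R T x) = dXT R T (diagX R T x) :=
  LinearMap.congr_fun (f := (diagX R T).restrictScalars k ∘ₗ dX R T)
    (g := (dXT R T).restrictScalars k ∘ₗ (diagX R T).restrictScalars k)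
    (twistedRes_ext fun i j g c d hi hg hj => by
      change diagX R T (dX R T _) = dXT R T (diagX R T _)
      rw [dX_mk, map_add, diagX_mk, diagX_mk, diagX_mk, ← twist_dZ, ← map_add, R.Δ_d, T.Δ_d,
        R.Δ_sgn]
      rfl) x

theorem diagX_sgnX (x : TwistedRes R T) :
    diagX R T (sgnX R T x) = BTensor.map (sgnX R T) (sgnX R T) (diagX R T x) :=
  LinearMap.congr_fun (f := (diagX R T).restrictScalars k ∘ₗ (sgnX R T).restrictScalars k)
    (g := (BTensor.map (sgnX R T) (sgnX R T)).restrictScalars k ∘ₗ (diagX R T).restrictScalars k)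
    (twistedRes_ext fun i j g c d hi hg hj => by
      change diagX R T (sgnX R T _) = BTensor.map (sgnX R T) (sgnX R T) (diagX R T _)
      rw [sgnX_mk, diagX_mk, diagX_mk, R.Δ_sgn, T.Δ_sgn, ← twist_sgn]
      rfl) x

/-- Under `1 ⊗ τ ⊗ 1`, the map `μ_X ⊗ 1` is `(μ_C ⊗ 1) ⊗ (μ_D ⊗ 1)`. -/
theorem evalLeft_twist (z : BTensor k (MonoidAlgebra k G) C C ⊗[k] BTensor k S D D) :
    BTensor.evalLeft (augXHom R T) (twist R T z) =
      TwistedProduct.of _ _ (TensorProduct.map ((BTensor.evalLeft R.aug).restrictScalars k)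
        ((BTensor.evalLeft T.aug).restrictScalars k) z) :=
  LinearMap.congr_fun
    (f := (BTensor.evalLeft (augXHom R T)).restrictScalars k ∘ₗ twist R T)
    (g := (TwistedProduct.of R.toGroupGrading T.toCompatibleAction).toLinearMap ∘ₗ
      TensorProduct.map ((BTensor.evalLeft R.aug).restrictScalars k)
        ((BTensor.evalLeft T.aug).restrictScalars k))
    (twist_ext (R := R) fun i g c c' d d' hi hg => by
      change BTensor.evalLeft (augXHom R T) (twist R T _) = TwistedProduct.mk _ _
        (lAct k (MonoidAlgebra k G) C (R.aug c) c') (lAct k S D (T.aug d) d')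
      rw [twist_of_mem hi hg, BTensor.evalLeft_tmul, augXHom_apply, augX_mk, map_mul,
        Module.End.mul_apply, TwistedProduct.lAct_s, TwistedProduct.leftS_mk hg, lAct_groupIncl,
        T.aug_ρ, inv_smul_smul, aug_sgnPow]) z

/-- Under `1 ⊗ τ ⊗ 1`, the map `1 ⊗ μ_X` is `(1 ⊗ μ_C) ⊗ (1 ⊗ μ_D)`. -/
theorem evalRight_twist (z : BTensor k (MonoidAlgebra k G) C C ⊗[k] BTensor k S D D) :
    BTensor.evalRight (augXHom R T) (twist R T z) =
      TwistedProduct.of _ _ (TensorProduct.map ((BTensor.evalRight R.aug).restrictScalars k)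
        ((BTensor.evalRight T.aug).restrictScalars k) z) :=
  LinearMap.congr_fun
    (f := (BTensor.evalRight (augXHom R T)).restrictScalars k ∘ₗ twist R T)
    (g := (TwistedProduct.of R.toGroupGrading T.toCompatibleAction).toLinearMap ∘ₗ
      TensorProduct.map ((BTensor.evalRight R.aug).restrictScalars k)
        ((BTensor.evalRight T.aug).restrictScalars k))
    (twist_ext (R := R) fun i g c c' d d' hi hg => by
      change BTensor.evalRight (augXHom R T) (twist R T _) = TwistedProduct.mk _ _
        (rAct k (MonoidAlgebra k G) C (MulOpposite.op (R.aug c')) c)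
          (rAct k S D (MulOpposite.op (T.aug d')) d)
      rw [twist_of_mem hi hg, BTensor.evalRight_tmul, augXHom_apply, augX_mk, MulOpposite.op_mul,
        map_mul, Module.End.mul_apply]
      cases i with
      | zero =>
        obtain ⟨r, hr⟩ := R.aug_comp g c' hg
        rw [hr, rAct_groupIncl, ρ_inv_ρ, TwistedProduct.rAct_s, TwistedProduct.rightS_mk]
        rfl
      | succ i =>
        rw [R.aug_pos i c' hi]
        simp) z

theorem counitX_left (x : TwistedRes R T) :
    BTensor.evalLeft (augXHom R T) (diagX R T x) = x :=
  LinearMap.congr_fun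
    (f := (BTensor.evalLeft (augXHom R T)).restrictScalars k ∘ₗ (diagX R T).restrictScalars k)
    (g := LinearMap.id)
    (twistedRes_ext fun i j g c d hi hg hj => by
      change BTensor.evalLeft (augXHom R T) (diagX R T _) = TwistedProduct.mk _ _ c d
      rw [diagX_mk, evalLeft_twist]
      change TwistedProduct.mk _ _ (BTensor.evalLeft R.aug (R.Δ c))
        (BTensor.evalLeft T.aug (T.Δ d)) = _
      rw [R.counit_left, T.counit_left]) x

theorem counitX_right (x : TwistedRes R T) :
    BTensor.evalRight (augXHom R T) (diagX R T x) = x :=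
  LinearMap.congr_fun
    (f := (BTensor.evalRight (augXHom R T)).restrictScalars k ∘ₗ (diagX R T).restrictScalars k)
    (g := LinearMap.id)
    (twistedRes_ext fun i j g c d hi hg hj => by
      change BTensor.evalRight (augXHom R T) (diagX R T _) = TwistedProduct.mk _ _ c d
      rw [diagX_mk, evalRight_twist]
      change TwistedProduct.mk _ _ (BTensor.evalRight R.aug (R.Δ c))
        (BTensor.evalRight T.aug (T.Δ d)) = _
      rw [R.counit_right, T.counit_right]) x

end TwistedComplex

/-! ### The twisted product as a complex with a diagonal map -/

namespace BimodResolution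

variable {k : Type*} [Field k] {A : Type*} [Ring A] [Algebra k A]
variable {P : Type*} [AddCommGroup P] [Module k P] [Module (Env k A) P]
  [IsScalarTower k (Env k A) P] (R : BimodResolution k A P)

theorem evalLeft_dTensor (z : BTensor k A P P) :
    BTensor.evalLeft R.aug (R.dTensor z) = R.d (BTensor.evalLeft R.aug z) :=
  LinearMap.congr_fun
    (f := (BTensor.evalLeft R.aug).restrictScalars k ∘ₗ R.dTensor.restrictScalars k)
    (g := R.d.restrictScalars k ∘ₗ (BTensor.evalLeft R.aug).restrictScalars k)
    (BTensor.hom_ext fun x y => by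
      change lAct k A P (R.aug (R.d x)) y + lAct k A P (R.aug (R.sgn x)) (R.d y) =
        R.d (lAct k A P (R.aug x) y)
      rw [R.aug_d, R.aug_sgn, map_lAct, map_zero, LinearMap.zero_apply, zero_add]) z

theorem evalRight_dTensor (z : BTensor k A P P) :
    BTensor.evalRight R.aug (R.dTensor z) = R.d (BTensor.evalRight R.aug z) :=
  LinearMap.congr_fun
    (f := (BTensor.evalRight R.aug).restrictScalars k ∘ₗ R.dTensor.restrictScalars k)
    (g := R.d.restrictScalars k ∘ₗ (BTensor.evalRight R.aug).restrictScalars k)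
    (BTensor.hom_ext fun x y => by
      change rAct k A P (MulOpposite.op (R.aug y)) (R.d x) +
        rAct k A P (MulOpposite.op (R.aug (R.d y))) (R.sgn x) =
          R.d (rAct k A P (MulOpposite.op (R.aug y)) x)
      rw [R.aug_d, map_rAct, MulOpposite.op_zero, map_zero, LinearMap.zero_apply, add_zero]) z

theorem evalRight_map_sgn (z : BTensor k A P P) :
    BTensor.evalRight R.aug (BTensor.map R.sgn R.sgn z) = R.sgn (BTensor.evalRight R.aug z) :=
  LinearMap.congr_fun
    (f := (BTensor.evalRight R.aug).restrictScalars k ∘ₗ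
      (BTensor.map R.sgn R.sgn).restrictScalars k)
    (g := R.sgn.restrictScalars k ∘ₗ (BTensor.evalRight R.aug).restrictScalars k)
    (BTensor.hom_ext fun x y => by
      change rAct k A P (MulOpposite.op (R.aug (R.sgn y))) (R.sgn x) =
          R.sgn (rAct k A P (MulOpposite.op (R.aug y)) x)
      rw [R.aug_sgn, map_rAct]) z

theorem evalRight_map_sgn_id (z : BTensor k A P P) :
    BTensor.evalRight R.aug (BTensor.map R.sgn LinearMap.id z) =
      R.sgn (BTensor.evalRight R.aug z) :=
  LinearMap.congr_fun
    (f := (BTensor.evalRight R.aug).restrictScalars k ∘ₗ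
      (BTensor.map R.sgn LinearMap.id).restrictScalars k)
    (g := R.sgn.restrictScalars k ∘ₗ (BTensor.evalRight R.aug).restrictScalars k)
    (BTensor.hom_ext fun x y => by
      change rAct k A P (MulOpposite.op (R.aug y)) (R.sgn x) =
          R.sgn (rAct k A P (MulOpposite.op (R.aug y)) x)
      rw [map_rAct]) z

end BimodResolution

section TwistedComplex

variable {k G : Type*} [Field k] [Group G] [DecidableEq G]
variable {C : Type*} [AddCommGroup C] [Module k C] [Module (Env k (MonoidAlgebra k G)) C]
  [IsScalarTower k (Env k (MonoidAlgebra k G)) C]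
variable {S : Type*} [Ring S] [Algebra k S] [MulSemiringAction G S] [SMulCommClass G k S]
variable {D : Type*} [AddCommGroup D] [Module k D] [Module (Env k S) D]
  [IsScalarTower k (Env k S) D]
variable {R : GroupGradedResolution k G C} {T : EquivariantResolution k G S D}
variable {φC : BTensor k (MonoidAlgebra k G) C C →ₗ[Env k (MonoidAlgebra k G)] C}
variable {φD : BTensor k S D D →ₗ[Env k S] D}

theorem twist_untwist_apply
    (z : BTensor k (SkewMonoidAlgebra S G) (TwistedRes R T) (TwistedRes R T)) :
    twist R T (untwist R T z) = z :=
  LinearMap.congr_fun (twist_untwist R T) z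

variable (R T) in
theorem untwist_twist_apply (z : BTensor k (MonoidAlgebra k G) C C ⊗[k] BTensor k S D D) :
    untwist R T (twist R T z) = z :=
  LinearMap.congr_fun (untwist_twist R T) z

theorem phiX_twist (a : BTensor k (MonoidAlgebra k G) C C) (b : BTensor k S D D) :
    phiX R T φC φD (twist R T (a ⊗ₜ b)) =
      TwistedProduct.mk _ _ (φC a) (BTensor.evalLeft T.aug b) +
      TwistedProduct.mk _ _ (R.sgn (BTensor.evalRight R.aug a)) (φD b) := by
  rw [← R.evalRight_map_sgn_id, phiX, LinearMap.comp_apply, LinearMap.comp_apply,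
    untwist_twist_apply]
  rfl

/-- `φ_X` is a homotopy from `μ_X ⊗ 1` to `1 ⊗ μ_X`. Under `1 ⊗ τ ⊗ 1` it first deforms `μ_C ⊗ 1` to
`1 ⊗ μ_C` by `φ_C`, then `μ_D ⊗ 1` to `1 ⊗ μ_D` by `φ_D`. -/
theorem phiX_homotopy (hφC : IsCounitHomotopy R.toBimodResolution φC)
    (hφD : IsCounitHomotopy T.toBimodResolution φD)
    (z : BTensor k (SkewMonoidAlgebra S G) (TwistedRes R T) (TwistedRes R T)) :
    dX R T (phiX R T φC φD z) + phiX R T φC φD (dXT R T z) =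
      BTensor.evalLeft (augXHom R T) z - BTensor.evalRight (augXHom R T) z := by
  obtain ⟨z, rfl⟩ : ∃ y, twist R T y = z := ⟨_, twist_untwist_apply z⟩
  rw [← twist_dZ, evalLeft_twist, evalRight_twist]
  induction z using TensorProduct.induction_on with
  | zero => simp
  | add x y hx hy =>
    simp only [map_add]
    rw [add_add_add_comm, hx, hy]
    abel
  | tmul a b =>
    have h1 : dZ R T (a ⊗ₜ b) =
      R.dTensor a ⊗ₜ b + BTensor.map R.sgn R.sgn a ⊗ₜ T.dTensor b := rfl
    rw [h1, map_add, map_add, phiX_twist, phiX_twist, phiX_twist, map_add, dX_mk, dX_mk,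
      R.evalRight_dTensor, R.evalRight_map_sgn, T.evalLeft_dTensor, hφC.map_sgn, R.sgn_sgn,
      R.d_sgn]
    have h2 := eq_sub_of_add_eq (hφC.homotopy a)
    have h3 := eq_sub_of_add_eq (hφD.homotopy b)
    rw [h2, h3]
    change _ = TwistedProduct.mk _ _ (BTensor.evalLeft R.aug a) (BTensor.evalLeft T.aug b) -
      TwistedProduct.mk _ _ (BTensor.evalRight R.aug a) (BTensor.evalRight T.aug b)
    simp only [map_sub, map_neg, LinearMap.sub_apply, LinearMap.neg_apply]
    abel

theorem augX_phiX (hφC : IsCounitHomotopy R.toBimodResolution φC)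
    (hφD : IsCounitHomotopy T.toBimodResolution φD)
    (z : BTensor k (SkewMonoidAlgebra S G) (TwistedRes R T) (TwistedRes R T)) :
    augX R T (phiX R T φC φD z) = 0 := by
  obtain ⟨z, rfl⟩ : ∃ y, twist R T y = z := ⟨_, twist_untwist_apply z⟩
  induction z using TensorProduct.induction_on with
  | zero => simp
  | add x y hx hy => rw [map_add, map_add, map_add, hx, hy, add_zero]
  | tmul a b =>
    rw [phiX_twist, map_add, augX_mk, augX_mk, hφC.aug_map, hφD.aug_map]
    simp

/-- The linear map `S ⋊ G → X`, `s g ↦ σ(g) ⊗ σ'(g⁻¹ • s)`. As `s g = g (g⁻¹ • s)` in `S ⋊ G`, it is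
a section of the augmentation if `σ` and `σ'` are. -/
def liftX (R : GroupGradedResolution k G C) (T : EquivariantResolution k G S D)
    (σ : MonoidAlgebra k G →ₗ[k] C) (σ' : S →ₗ[k] D) :
    SkewMonoidAlgebra S G →ₗ[k] TwistedRes R T :=
  Finsupp.lsum k (fun g => TwistedProduct.mk R.toGroupGrading T.toCompatibleAction
    (σ (MonoidAlgebra.single g 1)) ∘ₗ σ' ∘ₗ DistribSMul.toLinearMap k S g⁻¹) ∘ₗ
      ({ toFun := SkewMonoidAlgebra.coeff
         map_add' := SkewMonoidAlgebra.coeff_add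
         map_smul' := SkewMonoidAlgebra.coeff_smul } : SkewMonoidAlgebra S G →ₗ[k] G →₀ S)

theorem liftX_single (σ : MonoidAlgebra k G →ₗ[k] C) (σ' : S →ₗ[k] D) (g : G) (s : S) :
    liftX R T σ σ' (SkewMonoidAlgebra.single g s) =
      TwistedProduct.mk _ _ (σ (MonoidAlgebra.single g 1)) (σ' (g⁻¹ • s)) := by
  change (SkewMonoidAlgebra.single g s).coeff.sum (fun g s => TwistedProduct.mk _ _
    (σ (MonoidAlgebra.single g 1)) (σ' (g⁻¹ • s))) = _
  rw [SkewMonoidAlgebra.coeff_single, Finsupp.sum_single_index]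
  rw [smul_zero, map_zero, map_zero]

theorem liftX_augX (σ : MonoidAlgebra k G →ₗ[k] C) (σ' : S →ₗ[k] D) (c : C) (d : D) :
    liftX R T σ σ' (augX R T (TwistedProduct.mk _ _ c d)) =
      TwistedProduct.mk _ _ (σ (R.aug c)) (σ' (T.aug d)) := by
  rw [augX_mk]
  induction R.aug c using MonoidAlgebra.induction_on with
  | of g =>
    rw [groupIncl_of, SkewMonoidAlgebra.single_mul_single, liftX_single, one_mul, mul_one,
      inv_smul_smul]; rfl
  | add a b ha hb => simp only [map_add, add_mul, LinearMap.add_apply, ha, hb]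
  | smul r a ha => simp only [map_smul, smul_mul_assoc, LinearMap.smul_apply, ha]

theorem augX_liftX {σ : MonoidAlgebra k G →ₗ[k] C} {σ' : S →ₗ[k] D}
    (hσ : ∀ a, R.aug (σ a) = a) (hσ' : ∀ a, T.aug (σ' a) = a) (a : SkewMonoidAlgebra S G) :
    augX R T (liftX R T σ σ' a) = a := by
  induction a using SkewMonoidAlgebra.induction_on with
  | zero => rw [map_zero, map_zero]
  | add a b ha hb => rw [map_add, map_add, ha, hb]
  | single g s =>
    rw [liftX_single, augX_mk, hσ, hσ', groupIncl_single, one_smul,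
      SkewMonoidAlgebra.single_mul_single, one_mul, mul_one, smul_inv_smul]

theorem mk_mem_grX {i j n : ℕ} {c : C} {d : D} (hc : c ∈ R.gr i) (hd : d ∈ T.gr j)
    (h : i + j = n) : TwistedProduct.mk _ _ c d ∈ grX R T n :=
  Submodule.subset_span ⟨i, j, c, d, hc, hd, h, rfl⟩

theorem liftX_mem {σ : MonoidAlgebra k G →ₗ[k] C} {σ' : S →ₗ[k] D} (hσ : ∀ a, σ a ∈ R.gr 0)
    (hσ' : ∀ a, σ' a ∈ T.gr 0) (a : SkewMonoidAlgebra S G) : liftX R T σ σ' a ∈ grX R T 0 := by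
  induction a using SkewMonoidAlgebra.induction_on with
  | zero => rw [map_zero]; exact zero_mem _
  | add a b ha hb => rw [map_add]; exact add_mem ha hb
  | single g s => rw [liftX_single]; exact mk_mem_grX (hσ _) (hσ' _) rfl

theorem dX_of_mem_zero {x : TwistedRes R T} (hx : x ∈ grX R T 0) : dX R T x = 0 := by
  induction hx using Submodule.span_induction with
  | zero => rw [map_zero]
  | add x y _ _ hx hy => rw [map_add, hx, hy, add_zero]
  | smul r x _ hx => rw [map_smul, hx, smul_zero]
  | mem x hx =>
    obtain ⟨i, j, c, d, hc, hd, h, rfl⟩ := hx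
    obtain ⟨rfl, rfl⟩ := Nat.add_eq_zero_iff.1 h
    rw [dX_mk, R.d_zero c hc, T.d_zero d hd]
    simp

/-- The contraction `s ⊗ 1 + σ μ_C ⊗ s'` of the twisted product, built from contractions `s` and
`s'` of `C` and `D`. -/
def contractX (R : GroupGradedResolution k G C) (T : EquivariantResolution k G S D)
    (s : C →ₗ[k] C) (σ : MonoidAlgebra k G →ₗ[k] C) (s' : D →ₗ[k] D) :
    TwistedRes R T →ₗ[k] TwistedRes R T :=
  TwistedProduct.map _ _ s LinearMap.id +
    TwistedProduct.map _ _ (σ ∘ₗ R.aug.restrictScalars k) s'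

theorem contractX_mk (s : C →ₗ[k] C) (σ : MonoidAlgebra k G →ₗ[k] C) (s' : D →ₗ[k] D) (c : C)
    (d : D) : contractX R T s σ s' (TwistedProduct.mk _ _ c d) =
      TwistedProduct.mk _ _ (s c) d + TwistedProduct.mk _ _ (σ (R.aug c)) (s' d) := rfl

variable (R T) in
/-- The twisted product has a homogeneous contraction as a complex of vector spaces. -/
theorem exists_contractionX : ∃ (s : TwistedRes R T →ₗ[k] TwistedRes R T)
    (ν : SkewMonoidAlgebra S G →ₗ[k] TwistedRes R T),
    (∀ n, ∀ x ∈ grX R T n, s x ∈ grX R T (n + 1)) ∧ (∀ a, ν a ∈ grX R T 0) ∧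
      (∀ a, augX R T (ν a) = a) ∧ (∀ x, augX R T (s x) = 0) ∧
      ∀ x, dX R T (s x) + s (dX R T x) = x - ν (augX R T x) := by
  obtain ⟨s, σ, hs, hσ, hμσ, hsd⟩ := R.toBimodResolution.exists_contraction
  obtain ⟨s', σ', hs', hσ', hμσ', hsd'⟩ := T.toBimodResolution.exists_contraction
  have hσs (c : C) : s (R.sgn c) = - R.sgn (s c) :=
    LinearMap.congr_fun (f := s ∘ₗ R.sgn.restrictScalars k)
      (g := -(R.sgn.restrictScalars k ∘ₗ s)) (graded_hom_ext R.gr fun n c hc => by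
        change s (R.sgn c) = - R.sgn (s c)
        rw [R.sgn_of_mem hc, R.sgn_of_mem (hs n c hc), map_smul, pow_succ]
        simp) c
  have hμs (c : C) : R.aug (s c) = 0 :=
    LinearMap.congr_fun (f := R.aug.restrictScalars k ∘ₗ s) (g := 0)
      (graded_hom_ext R.gr fun n c hc => R.aug_pos n _ (hs n c hc)) c
  have hμs' (d : D) : T.aug (s' d) = 0 :=
    LinearMap.congr_fun (f := T.aug.restrictScalars k ∘ₗ s') (g := 0)
      (graded_hom_ext T.gr fun n c hc => T.aug_pos n _ (hs' n c hc)) d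
  refine ⟨contractX R T s σ s', liftX R T σ σ', fun n x hx => ?_, liftX_mem hσ hσ',
    augX_liftX hμσ hμσ', fun x => ?_, fun x => ?_⟩
  · induction hx using Submodule.span_induction with
    | zero => rw [map_zero]; exact zero_mem _
    | add x y _ _ hx hy => rw [map_add]; exact add_mem hx hy
    | smul r x _ hx => rw [map_smul]; exact Submodule.smul_mem _ r hx
    | mem x hx =>
      obtain ⟨i, j, c, d, hc, hd, rfl, rfl⟩ := hx
      rw [contractX_mk]
      refine add_mem (mk_mem_grX (hs i c hc) hd (by omega)) ?_
      cases i with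
      | zero => exact mk_mem_grX (hσ _) (hs' j d hd) (by omega)
      | succ i => rw [R.aug_pos i c hc]; simp
  · refine LinearMap.congr_fun (f := augX R T ∘ₗ contractX R T s σ s') (g := 0)
      (twistedRes_ext fun i j g c d hi hg hj => ?_) x
    change augX R T (contractX R T s σ s' (TwistedProduct.mk _ _ c d)) = 0
    rw [contractX_mk, map_add, augX_mk, augX_mk, hμs, hμs']
    simp
  · refine LinearMap.congr_fun (f := dX R T ∘ₗ contractX R T s σ s' +
      contractX R T s σ s' ∘ₗ dX R T) (g := LinearMap.id - liftX R T σ σ' ∘ₗ augX R T)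
      (twistedRes_ext fun i j g c d hi hg hj => ?_) x
    change dX R T (contractX R T s σ s' (TwistedProduct.mk _ _ c d)) +
      contractX R T s σ s' (dX R T (TwistedProduct.mk _ _ c d)) =
        TwistedProduct.mk _ _ c d - liftX R T σ σ' (augX R T (TwistedProduct.mk _ _ c d))
    have h0 : R.sgn (σ (R.aug c)) = σ (R.aug c) := by
      rw [R.sgn_of_mem (hσ _), pow_zero, one_smul]
    rw [liftX_augX, contractX_mk, map_add, dX_mk, dX_mk, dX_mk, map_add, contractX_mk,
      contractX_mk, R.aug_d, R.aug_sgn, R.d_zero _ (hσ _), h0, hσs,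
      eq_sub_of_add_eq (hsd c), eq_sub_of_add_eq (hsd' d)]
    simp only [map_sub, map_neg, map_zero, LinearMap.sub_apply, LinearMap.neg_apply,
      LinearMap.zero_apply]
    abel

variable (R T) in
/-- The twisted product, with a bimodule map `φ_X`, as a complex with a diagonal map. -/
def twistedComplex (hφC : IsCounitHomotopy R.toBimodResolution φC)
    (hφD : IsCounitHomotopy T.toBimodResolution φD)
    (hφ : ∀ (e : Env k (SkewMonoidAlgebra S G)) z,
      phiX R T φC φD (e • z) = e • phiX R T φC φD z) :
    DiagonalComplex k (SkewMonoidAlgebra S G) (TwistedRes R T) where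
  d := dXHom R T
  ε := sgnX R T
  aug := augXHom R T
  Δ := diagX R T
  φ := { toFun := phiX R T φC φD, map_add' := map_add _, map_smul' := hφ }
  d_ε := dX_sgnX R T
  ε_ε := sgnX_sgnX R T
  aug_d := augX_dX R T
  aug_ε := augX_sgnX R T
  Δ_d := diagX_dX
  Δ_ε := diagX_sgnX
  counit_left := counitX_left
  counit_right := counitX_right
  homotopy := phiX_homotopy hφC hφD
  aug_φ := augX_phiX hφC hφD
  exact x hx hx' := by
    obtain ⟨s, ν, -, -, -, -, h⟩ := exists_contractionX R T
    refine ⟨s x, ?_⟩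
    have := h x
    rw [show dX R T x = 0 from hx, show augX R T x = 0 from hx', map_zero, map_zero, add_zero,
      sub_zero] at this
    exact this
  exists_one := by
    obtain ⟨s, ν, -, hν, h, -, -⟩ := exists_contractionX R T
    exact ⟨ν 1, dX_of_mem_zero (hν 1), h 1⟩

/-- The bracket of the diagonal complex `X` is the bracket `[ , ]_X`. -/
theorem twistedComplex_bracket (hφC : IsCounitHomotopy R.toBimodResolution φC)
    (hφD : IsCounitHomotopy T.toBimodResolution φD)
    (hφ : ∀ (e : Env k (SkewMonoidAlgebra S G)) z,
      phiX R T φC φD (e • z) = e • phiX R T φC φD z) (n m : ℕ)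
    (f f' : TwistedRes R T →ₗ[Env k (SkewMonoidAlgebra S G)] SkewMonoidAlgebra S G)
    (x : TwistedRes R T) :
    (twistedComplex R T hφC hφD hφ).bracket n m f f' x = bracketX R T φC φD n m f f' x := rfl

end TwistedComplex

/-! ### Bimodule maps to the twisted product -/

/-- A linear map commutes with the action of `(S ⋊ G)ᵉ` if it commutes with the actions of `S` and
`G` from both sides. -/
theorem map_env_smul_of_single {k G S : Type*} [Field k] [Group G] [DecidableEq G] [Ring S]
    [Algebra k S] [MulSemiringAction G S] [SMulCommClass G k S]
    {M : Type*} [AddCommGroup M] [Module k M] [Module (Env k (SkewMonoidAlgebra S G)) M]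
    [IsScalarTower k (Env k (SkewMonoidAlgebra S G)) M]
    {N : Type*} [AddCommGroup N] [Module k N] [Module (Env k (SkewMonoidAlgebra S G)) N]
    [IsScalarTower k (Env k (SkewMonoidAlgebra S G)) N] (f : M →ₗ[k] N)
    (hls : ∀ (s : S) x, f (lAct k (SkewMonoidAlgebra S G) M (SkewMonoidAlgebra.single 1 s) x) =
      lAct k (SkewMonoidAlgebra S G) N (SkewMonoidAlgebra.single 1 s) (f x))
    (hlg : ∀ (g : G) x, f (lAct k (SkewMonoidAlgebra S G) M (SkewMonoidAlgebra.single g 1) x) =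
      lAct k (SkewMonoidAlgebra S G) N (SkewMonoidAlgebra.single g 1) (f x))
    (hrs : ∀ (s : S) x,
      f (rAct k (SkewMonoidAlgebra S G) M (MulOpposite.op (SkewMonoidAlgebra.single 1 s)) x) =
        rAct k (SkewMonoidAlgebra S G) N (MulOpposite.op (SkewMonoidAlgebra.single 1 s)) (f x))
    (hrg : ∀ (g : G) x,
      f (rAct k (SkewMonoidAlgebra S G) M (MulOpposite.op (SkewMonoidAlgebra.single g 1)) x) =
        rAct k (SkewMonoidAlgebra S G) N (MulOpposite.op (SkewMonoidAlgebra.single g 1)) (f x))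
    (e : Env k (SkewMonoidAlgebra S G)) (x : M) : f (e • x) = e • f x :=
  (bimodHom (A := SkewMonoidAlgebra S G) f
    (fun a x => by
      induction a using SkewMonoidAlgebra.induction_on with
      | zero => rw [map_zero, map_zero, LinearMap.zero_apply, LinearMap.zero_apply, map_zero]
      | add a b ha hb =>
        rw [map_add, map_add, LinearMap.add_apply, LinearMap.add_apply, map_add, ha, hb]
      | single g s =>
        rw [TwistedProduct.single_eq s g, map_mul, map_mul, Module.End.mul_apply,
          Module.End.mul_apply, hls, hlg])
    (fun b x => by
      induction b using MulOpposite.rec' with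
      | h b =>
      induction b using SkewMonoidAlgebra.induction_on with
      | zero =>
        rw [MulOpposite.op_zero, map_zero, map_zero, LinearMap.zero_apply, LinearMap.zero_apply,
          map_zero]
      | add a b ha hb =>
        rw [MulOpposite.op_add, map_add, map_add, LinearMap.add_apply, LinearMap.add_apply,
          map_add, ha, hb]
      | single g s =>
        rw [TwistedProduct.single_eq s g, MulOpposite.op_mul, map_mul, map_mul,
          Module.End.mul_apply, Module.End.mul_apply, hrg, hrs])).map_smul e x

section TwistedComplex

variable {k G : Type*} [Field k] [Group G] [DecidableEq G]
variable {C : Type*} [AddCommGroup C] [Module k C] [Module (Env k (MonoidAlgebra k G)) C]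
  [IsScalarTower k (Env k (MonoidAlgebra k G)) C]
variable {S : Type*} [Ring S] [Algebra k S] [MulSemiringAction G S] [SMulCommClass G k S]
variable {D : Type*} [AddCommGroup D] [Module k D] [Module (Env k S) D]
  [IsScalarTower k (Env k S) D]
variable {R : GroupGradedResolution k G C} {T : EquivariantResolution k G S D}
variable {φC : BTensor k (MonoidAlgebra k G) C C →ₗ[Env k (MonoidAlgebra k G)] C}
variable {φD : BTensor k S D D →ₗ[Env k S] D}

/-- Linear maps out of `X ⊗_A X` agree if they agree on the images of pure tensors under
`1 ⊗ τ ⊗ 1`. -/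
theorem hom_ext_twist {N : Type*} [AddCommGroup N] [Module k N]
    {f f' : BTensor k (SkewMonoidAlgebra S G) (TwistedRes R T) (TwistedRes R T) →ₗ[k] N}
    (h : ∀ a b, f (twist R T (a ⊗ₜ b)) = f' (twist R T (a ⊗ₜ b))) : f = f' := by
  have key : f ∘ₗ twist R T = f' ∘ₗ twist R T := TensorProduct.ext' h
  refine LinearMap.ext fun z => ?_
  rw [← twist_untwist_apply z]
  exact LinearMap.congr_fun key _

variable (R) in
/-- Linear maps out of `C ⊗_{kG} C` agree if they agree on elements that are homogeneous for the
`G`-grading. -/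
theorem comp_tensor_ext {N : Type*} [AddCommGroup N] [Module k N]
    {f f' : BTensor k (MonoidAlgebra k G) C C →ₗ[k] N}
    (h : ∀ g, ∀ z ∈ BTensor.degree k (MonoidAlgebra k G) (· * ·) (fun a => (R.comp a : Set C))
      (fun b => (R.comp b : Set C)) g, f z = f' z) : f = f' :=
  BTensor.hom_ext fun x y => LinearMap.congr_fun₂
    (f := (BTensor.mk k (MonoidAlgebra k G) C C).compr₂ f)
    (g := (BTensor.mk k (MonoidAlgebra k G) C C).compr₂ f')
    (graded_hom_ext R.comp fun i x hx => graded_hom_ext R.comp fun j y hy =>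
      h (i * j) _ (Submodule.subset_span ⟨i, j, x, y, hx, hy, rfl, rfl⟩)) x y

theorem evalLeft_diag (g : G) (z : BTensor k S D D) :
    BTensor.evalLeft T.aug (T.diag g z) = T.ρ g (BTensor.evalLeft T.aug z) :=
  LinearMap.congr_fun (f := (BTensor.evalLeft T.aug).restrictScalars k ∘ₗ T.diag g)
    (g := T.ρ g ∘ₗ (BTensor.evalLeft T.aug).restrictScalars k)
    (BTensor.hom_ext fun x y => by
      change lAct k S D (T.aug (T.ρ g x)) (T.ρ g y) = T.ρ g (lAct k S D (T.aug x) y)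
      rw [T.aug_ρ, T.left_compat]) z

theorem evalRight_aug_comp {g : G} {z : BTensor k (MonoidAlgebra k G) C C}
    (hz : z ∈ BTensor.degree k (MonoidAlgebra k G) (· * ·) (fun a => (R.comp a : Set C))
      (fun b => (R.comp b : Set C)) g) : BTensor.evalRight R.aug z ∈ R.comp g := by
  induction hz using Submodule.span_induction with
  | zero => rw [map_zero]; exact zero_mem _
  | add x y _ _ hx hy => rw [map_add]; exact add_mem hx hy
  | smul r x _ hx => rw [envMap_smul]; exact Submodule.smul_mem _ r hx
  | mem x hx =>
    obtain ⟨a, b, c, c', hc, hc', rfl, rfl⟩ := hx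
    obtain ⟨r, hr⟩ := R.aug_comp b c' hc'
    have h : (MonoidAlgebra.single b r : MonoidAlgebra k G) = r • MonoidAlgebra.of k G b := by simp
    rw [BTensor.evalRight_tmul, hr, h, MulOpposite.op_smul, map_smul, LinearMap.smul_apply]
    exact Submodule.smul_mem _ r (R.gRight_mem hc)

/-- `φ_X` is a bimodule map if `φ_C` preserves the `G`-grading and `φ_D` is `G`-equivariant. -/
theorem phiX_env_smul
    (hC : ∀ g, ∀ z ∈ BTensor.degree k (MonoidAlgebra k G) (· * ·) (fun a => (R.comp a : Set C))
      (fun b => (R.comp b : Set C)) g, φC z ∈ R.comp g)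
    (hD : ∀ g w, φD (T.diag g w) = T.ρ g (φD w)) (e : Env k (SkewMonoidAlgebra S G))
    (z : BTensor k (SkewMonoidAlgebra S G) (TwistedRes R T) (TwistedRes R T)) :
    phiX R T φC φD (e • z) = e • phiX R T φC φD z := by
  refine map_env_smul_of_single _ (fun s => ?_) (fun g => ?_) (fun s => ?_) (fun g => ?_) e z
  · refine LinearMap.congr_fun
      (f := phiX R T φC φD ∘ₗ lAct k (SkewMonoidAlgebra S G) _ (SkewMonoidAlgebra.single 1 s))
      (g := lAct k (SkewMonoidAlgebra S G) _ (SkewMonoidAlgebra.single 1 s) ∘ₗ phiX R T φC φD)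
      (hom_ext_twist fun a b => ?_)
    refine LinearMap.congr_fun
      (f := (phiX R T φC φD ∘ₗ lAct k (SkewMonoidAlgebra S G) _ (SkewMonoidAlgebra.single 1 s)) ∘ₗ
        twist R T ∘ₗ (TensorProduct.mk k _ _).flip b)
      (g := (lAct k (SkewMonoidAlgebra S G) _ (SkewMonoidAlgebra.single 1 s) ∘ₗ
        phiX R T φC φD) ∘ₗ twist R T ∘ₗ (TensorProduct.mk k _ _).flip b)
      (comp_tensor_ext R fun h a ha => ?_) a
    change phiX R T φC φD (lAct k (SkewMonoidAlgebra S G) _ (SkewMonoidAlgebra.single 1 s)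
      (twist R T (a ⊗ₜ b))) = lAct k (SkewMonoidAlgebra S G) _ (SkewMonoidAlgebra.single 1 s)
        (phiX R T φC φD (twist R T (a ⊗ₜ b)))
    rw [← twist_leftS s ha, phiX_twist, phiX_twist, map_add, TwistedProduct.lAct_s,
      TwistedProduct.lAct_s, TwistedProduct.leftS_mk (hC h a ha),
      TwistedProduct.leftS_mk (sgn_comp (evalRight_aug_comp ha)), map_lAct, map_lAct]
  · refine LinearMap.congr_fun
      (f := phiX R T φC φD ∘ₗ lAct k (SkewMonoidAlgebra S G) _ (SkewMonoidAlgebra.single g 1))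
      (g := lAct k (SkewMonoidAlgebra S G) _ (SkewMonoidAlgebra.single g 1) ∘ₗ phiX R T φC φD)
      (hom_ext_twist fun a b => ?_)
    rw [LinearMap.comp_apply, LinearMap.comp_apply, ← twist_gLeft, phiX_twist, phiX_twist, map_add,
      TwistedProduct.lAct_g, TwistedProduct.lAct_g, TwistedProduct.leftG_mk,
      TwistedProduct.leftG_mk, map_lAct, map_lAct, map_lAct]
    rfl
  · refine LinearMap.congr_fun
      (f := phiX R T φC φD ∘ₗ rAct k (SkewMonoidAlgebra S G) _
        (MulOpposite.op (SkewMonoidAlgebra.single 1 s)))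
      (g := rAct k (SkewMonoidAlgebra S G) _ (MulOpposite.op (SkewMonoidAlgebra.single 1 s)) ∘ₗ
        phiX R T φC φD)
      (hom_ext_twist fun a b => ?_)
    rw [LinearMap.comp_apply, LinearMap.comp_apply, ← twist_rightS, phiX_twist, phiX_twist, map_add,
      TwistedProduct.rAct_s, TwistedProduct.rAct_s, TwistedProduct.rightS_mk,
      TwistedProduct.rightS_mk, map_rAct, map_rAct]
  · refine LinearMap.congr_fun
      (f := phiX R T φC φD ∘ₗ rAct k (SkewMonoidAlgebra S G) _
        (MulOpposite.op (SkewMonoidAlgebra.single g 1)))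
      (g := rAct k (SkewMonoidAlgebra S G) _ (MulOpposite.op (SkewMonoidAlgebra.single g 1)) ∘ₗ
        phiX R T φC φD)
      (hom_ext_twist fun a b => ?_)
    rw [LinearMap.comp_apply, LinearMap.comp_apply, ← twist_rightG, phiX_twist, phiX_twist, map_add,
      TwistedProduct.rAct_g, TwistedProduct.rAct_g, TwistedProduct.rightG_mk,
      TwistedProduct.rightG_mk, map_rAct, map_rAct, map_rAct, hD, evalLeft_diag]
    rfl

/-! ### Degrees in the twisted product -/

theorem leftS_mem_grX {i j n : ℕ} {c : C} {d : D} (hc : c ∈ R.gr i) (hd : d ∈ T.gr j)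
    (h : i + j = n) (s : S) :
    TwistedProduct.leftS _ _ s (TwistedProduct.mk _ _ c d : TwistedRes R T) ∈ grX R T n := by
  classical
  rw [← DirectSum.sum_support_decompose R.comp c, map_sum, LinearMap.sum_apply, map_sum]
  refine Submodule.sum_mem _ fun g _ => ?_
  rw [TwistedProduct.leftS_mk (SetLike.coe_mem _)]
  exact mk_mem_grX (R.comp_gr i c hc g) ((T.gr j).smul_mem _ hd) h

theorem lAct_mem_grX {n : ℕ} {x : TwistedRes R T} (hx : x ∈ grX R T n)
    (a : SkewMonoidAlgebra S G) : lAct k (SkewMonoidAlgebra S G) _ a x ∈ grX R T n := by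
  induction hx using Submodule.span_induction with
  | zero => rw [map_zero]; exact zero_mem _
  | add x y _ _ hx hy => rw [map_add]; exact add_mem hx hy
  | smul r x _ hx => rw [map_smul]; exact Submodule.smul_mem _ r hx
  | mem x hx =>
    obtain ⟨i, j, c, d, hc, hd, h, rfl⟩ := hx
    induction a using SkewMonoidAlgebra.induction_on with
    | zero => rw [map_zero]; exact zero_mem _
    | add a b ha hb => rw [map_add]; exact add_mem ha hb
    | single g s =>
      rw [TwistedProduct.lAct_eq, TwistedProduct.left_single, TwistedProduct.leftG_mk]
      exact leftS_mem_grX (gLeft_gr hc g) hd h s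

theorem rAct_mem_grX {n : ℕ} {x : TwistedRes R T} (hx : x ∈ grX R T n)
    (a : (SkewMonoidAlgebra S G)ᵐᵒᵖ) : rAct k (SkewMonoidAlgebra S G) _ a x ∈ grX R T n := by
  induction hx using Submodule.span_induction with
  | zero => rw [map_zero]; exact zero_mem _
  | add x y _ _ hx hy => rw [map_add]; exact add_mem hx hy
  | smul r x _ hx => rw [map_smul]; exact Submodule.smul_mem _ r hx
  | mem x hx =>
    obtain ⟨i, j, c, d, hc, hd, h, rfl⟩ := hx
    induction a using MulOpposite.rec' with
    | h a =>
    induction a using SkewMonoidAlgebra.induction_on with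
    | zero => rw [MulOpposite.op_zero, map_zero]; exact zero_mem _
    | add a b ha hb => rw [MulOpposite.op_add, map_add]; exact add_mem ha hb
    | single g s =>
      rw [TwistedProduct.rAct_eq, TwistedProduct.right_single, TwistedProduct.rightS_mk,
        TwistedProduct.rightG_mk]
      exact mk_mem_grX (gRight_gr hc g) (T.ρ_gr _ j _ ((T.gr j).smul_mem _ hd)) h

theorem sgnX_of_mem {n : ℕ} {x : TwistedRes R T} (hx : x ∈ grX R T n) :
    sgnX R T x = (-1 : k) ^ n • x := by
  induction hx using Submodule.span_induction with
  | zero => rw [map_zero, smul_zero]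
  | add x y _ _ hx hy => rw [map_add, hx, hy, smul_add]
  | smul r x _ hx => rw [envMap_smul, hx, smul_comm]
  | mem x hx =>
    obtain ⟨i, j, c, d, hc, hd, rfl, rfl⟩ := hx
    rw [sgnX_mk, R.sgn_of_mem hc, T.sgn_of_mem hd, map_smul, map_smul, LinearMap.smul_apply,
      smul_smul, ← pow_add, add_comm]

theorem sgnPow_mem {j : ℕ} {d : D} (hd : d ∈ T.gr j) (i : ℕ) : T.sgnPow i d ∈ T.gr j := by
  induction i with
  | zero => exact hd
  | succ i ih => rw [sgnPow_succ]; exact T.sgn_mem ih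

variable (R T) in
/-- The component of degree `n` of `X ⊗_A X`. -/
def grXX (n : ℕ) :
    Submodule k (BTensor k (SkewMonoidAlgebra S G) (TwistedRes R T) (TwistedRes R T)) :=
  BTensor.degree k (SkewMonoidAlgebra S G) (· + ·) (fun i => (grX R T i : Set (TwistedRes R T)))
    (fun i => (grX R T i : Set (TwistedRes R T))) n

theorem twist_mem {p q : ℕ} {z : BTensor k (MonoidAlgebra k G) C C} {w : BTensor k S D D}
    (hz : z ∈ R.grTensor p) (hw : w ∈ T.grTensor q) : twist R T (z ⊗ₜ w) ∈ grXX R T (p + q) := by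
  induction hz using Submodule.span_induction with
  | zero => rw [TensorProduct.zero_tmul, map_zero]; exact zero_mem _
  | add x y _ _ hx hy => rw [TensorProduct.add_tmul, map_add]; exact add_mem hx hy
  | smul r x _ hx =>
    rw [← TensorProduct.smul_tmul', map_smul]; exact Submodule.smul_mem _ r hx
  | mem z hz =>
    obtain ⟨i, i', c, c', hc, hc', rfl, rfl⟩ := hz
    induction hw using Submodule.span_induction with
    | zero => rw [TensorProduct.tmul_zero, map_zero]; exact zero_mem _
    | add x y _ _ hx hy => rw [TensorProduct.tmul_add, map_add]; exact add_mem hx hy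
    | smul r x _ hx => rw [TensorProduct.tmul_smul, map_smul]; exact Submodule.smul_mem _ r hx
    | mem w hw =>
      obtain ⟨j, j', d, d', hd, hd', rfl, rfl⟩ := hw
      classical
      have h : twist R T (BTensor.tmul k (MonoidAlgebra k G) c c' ⊗ₜ BTensor.tmul k S d d') =
        ∑ g ∈ (DirectSum.decompose R.comp c').support, twist R T
          (BTensor.tmul k (MonoidAlgebra k G) c (DirectSum.decompose R.comp c' g : C) ⊗ₜ
            BTensor.tmul k S d d') := by
        rw [← map_sum, ← TensorProduct.sum_tmul]
        conv_lhs => rw [← DirectSum.sum_support_decompose R.comp c', ← BTensor.mk_apply, map_sum]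
        rfl
      rw [h]
      refine Submodule.sum_mem _ fun g _ => ?_
      rw [twist_of_mem (R.comp_gr i' c' hc' g) (SetLike.coe_mem _)]
      exact Submodule.subset_span ⟨i + j, i' + j', _, _,
        mk_mem_grX hc (T.ρ_gr g j _ (sgnPow_mem hd _)) rfl,
        mk_mem_grX (R.comp_gr i' c' hc' g) hd' rfl, by simp only []; omega, rfl⟩

/-- `Δ_X` has degree `0`. -/
theorem diagX_mem {n : ℕ} {x : TwistedRes R T} (hx : x ∈ grX R T n) :
    diagX R T x ∈ grXX R T n := by
  induction hx using Submodule.span_induction with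
  | zero => rw [map_zero]; exact zero_mem _
  | add x y _ _ hx hy => rw [map_add]; exact add_mem hx hy
  | smul r x _ hx => rw [envMap_smul]; exact Submodule.smul_mem _ r hx
  | mem x hx =>
    obtain ⟨i, j, c, d, hc, hd, rfl, rfl⟩ := hx
    rw [diagX_mk]
    exact twist_mem (R.Δ_degree i c hc) (T.Δ_degree j d hd)

/-- `φ_X` has degree `1`. -/
theorem phiX_tmul_mem (hφC : IsCounitHomotopy R.toBimodResolution φC)
    (hφD : IsCounitHomotopy T.toBimodResolution φD) {p q : ℕ} {x y : TwistedRes R T}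
    (hx : x ∈ grX R T p) (hy : y ∈ grX R T q) :
    phiX R T φC φD (BTensor.tmul k (SkewMonoidAlgebra S G) x y) ∈ grX R T (p + q + 1) := by
  induction hx using Submodule.span_induction with
  | zero => rw [BTensor.zero_tmul, map_zero]; exact zero_mem _
  | add x y _ _ hx hy => rw [BTensor.add_tmul, map_add]; exact add_mem hx hy
  | smul r x _ hx => rw [BTensor.smul_tmul, map_smul]; exact Submodule.smul_mem _ r hx
  | mem x hx =>
    obtain ⟨i, j, c, d, hc, hd, rfl, rfl⟩ := hx
    induction hy using Submodule.span_induction with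
    | zero => rw [BTensor.tmul_zero, map_zero]; exact zero_mem _
    | add x y _ _ hx hy => rw [BTensor.tmul_add, map_add]; exact add_mem hx hy
    | smul r x _ hx => rw [BTensor.tmul_smul, map_smul]; exact Submodule.smul_mem _ r hx
    | mem y hy =>
      obtain ⟨i', j', c', d', hc', hd', rfl, rfl⟩ := hy
      -- it suffices to treat `c'` that is homogeneous for the `G`-grading
      suffices key : ∀ g, ∀ c' ∈ R.gr i', c' ∈ R.comp g → phiX R T φC φD
          (BTensor.tmul k (SkewMonoidAlgebra S G) (TwistedProduct.mk _ _ c d)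
            (TwistedProduct.mk _ _ c' d')) ∈ grX R T (i + j + (i' + j') + 1) by
        classical
        rw [← DirectSum.sum_support_decompose R.comp c', map_sum, LinearMap.sum_apply,
          ← BTensor.mk_apply, map_sum, map_sum]
        exact Submodule.sum_mem _ fun g _ => key g _ (R.comp_gr i' c' hc' g) (SetLike.coe_mem _)
      intro g c' hc' hg
      have hd₁ : T.ρ g⁻¹ (T.sgnPow i' d) ∈ T.gr j := T.ρ_gr _ j _ (sgnPow_mem hd _)
      have h := twist_of_mem (T := T) hc' hg c (T.ρ g⁻¹ (T.sgnPow i' d)) d'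
      rw [sgnPow_ρ, ρ_ρ_inv, sgnPow_sgnPow] at h
      rw [← h, phiX_twist]
      refine add_mem ?_ ?_
      · have h1 := hφC.degree (i + i') _ (Submodule.subset_span ⟨i, i', c, c', hc, hc', rfl, rfl⟩)
        rw [BTensor.evalLeft_tmul]
        cases j with
        | zero => exact mk_mem_grX h1 ((T.gr j').smul_mem _ hd') (by omega)
        | succ j => rw [T.aug_pos j _ hd₁]; simp
      · have h1 := hφD.degree (j + j') _ (Submodule.subset_span ⟨j, j', _, d', hd₁, hd', rfl, rfl⟩)
        rw [BTensor.evalRight_tmul]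
        cases i' with
        | zero =>
          exact mk_mem_grX (R.sgn_mem ((R.gr i).smul_mem _ hc)) h1 (by omega)
        | succ i' => rw [R.aug_pos i' _ hc']; simp

end TwistedComplex

/-! ### The bracket on the twisted product -/

section TwistedComplex

open BarCochain

variable {k G : Type*} [Field k] [Group G] [DecidableEq G]
variable {C : Type*} [AddCommGroup C] [Module k C] [Module (Env k (MonoidAlgebra k G)) C]
  [IsScalarTower k (Env k (MonoidAlgebra k G)) C]
variable {S : Type*} [Ring S] [Algebra k S] [MulSemiringAction G S] [SMulCommClass G k S]
variable {D : Type*} [AddCommGroup D] [Module k D] [Module (Env k S) D]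
  [IsScalarTower k (Env k S) D]
variable {R : GroupGradedResolution k G C} {T : EquivariantResolution k G S D}
variable {φC : BTensor k (MonoidAlgebra k G) C C →ₗ[Env k (MonoidAlgebra k G)] C}
variable {φD : BTensor k S D D →ₗ[Env k S] D}
variable {n m : ℕ}
variable {f f' : TwistedRes R T →ₗ[Env k (SkewMonoidAlgebra S G)] SkewMonoidAlgebra S G}

theorem sgnX_pow_mem {i : ℕ} {x : TwistedRes R T} (hx : x ∈ grX R T i) (m : ℕ) :
    ((sgnX R T : Module.End (Env k (SkewMonoidAlgebra S G)) (TwistedRes R T)) ^ m) x ∈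
      grX R T i := by
  induction m with
  | zero => exact hx
  | succ m ih =>
    rw [pow_succ', Module.End.mul_apply, sgnX_of_mem ih]
    exact Submodule.smul_mem _ _ ih

/-- `f ∘_X f'` is concentrated in degree `n + m - 1`. -/
theorem circX_eq_zero (hφC : IsCounitHomotopy R.toBimodResolution φC)
    (hφD : IsCounitHomotopy T.toBimodResolution φD)
    (hf : ∀ i, i ≠ n → ∀ x ∈ grX R T i, f x = 0) (hf' : ∀ i, i ≠ m → ∀ x ∈ grX R T i, f' x = 0)
    {p : ℕ} (hp : p + 1 ≠ n + m) {x : TwistedRes R T} (hx : x ∈ grX R T p) :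
    circX R T φC φD m f f' x = 0 := by
  let L : BTensor k (SkewMonoidAlgebra S G) (TwistedRes R T)
      (BTensor k (SkewMonoidAlgebra S G) (TwistedRes R T) (TwistedRes R T)) →ₗ[k]
        SkewMonoidAlgebra S G :=
    f.restrictScalars k ∘ₗ phiX R T φC φD ∘ₗ
    (BTensor.map ((sgnX R T : Module.End (Env k (SkewMonoidAlgebra S G)) (TwistedRes R T)) ^ m)
      (BTensor.evalLeft f')).restrictScalars k
  have h1 {i q : ℕ} {x : TwistedRes R T} (hx : x ∈ grX R T i) (hq : i + q = p)
      {w : BTensor k (SkewMonoidAlgebra S G) (TwistedRes R T) (TwistedRes R T)}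
      (hw : w ∈ grXX R T q) : L (BTensor.tmul k (SkewMonoidAlgebra S G) x w) = 0 := by
    induction hw using Submodule.span_induction with
    | zero => rw [BTensor.tmul_zero, map_zero]
    | add x y _ _ hx hy => rw [BTensor.tmul_add, map_add, hx, hy, add_zero]
    | smul r x _ hx => rw [BTensor.tmul_smul, map_smul, hx, smul_zero]
    | mem w hw =>
      obtain ⟨a, b, y, z, hy, hz, hab, rfl⟩ := hw
      change f (phiX R T φC φD (BTensor.tmul k (SkewMonoidAlgebra S G) _
        (lAct k (SkewMonoidAlgebra S G) _ (f' y) z))) = 0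
      by_cases ha : a = m
      · refine hf _ ?_ _ (phiX_tmul_mem hφC hφD (sgnX_pow_mem hx m) (lAct_mem_grX hz _))
        simp only [] at hab
        omega
      · rw [hf' a ha y hy, map_zero, LinearMap.zero_apply, BTensor.tmul_zero, map_zero, map_zero]
  have h2 {u : BTensor k (SkewMonoidAlgebra S G) (TwistedRes R T) (TwistedRes R T)}
      (hu : u ∈ grXX R T p) : L (BTensor.map LinearMap.id (diagX R T) u) = 0 := by
    induction hu using Submodule.span_induction with
    | zero => rw [map_zero, map_zero]
    | add x y _ _ hx hy => rw [map_add, map_add, hx, hy, add_zero]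
    | smul r x _ hx => rw [envMap_smul, map_smul, hx, smul_zero]
    | mem u hu =>
      obtain ⟨a, b, y, z, hy, hz, hab, rfl⟩ := hu
      rw [BTensor.map_tmul]
      exact h1 hy hab (diagX_mem hz)
  exact h2 (diagX_mem hx)

/-- `[f, f']_X` is concentrated in degree `n + m - 1`. -/
theorem bracketX_eq_zero (hφC : IsCounitHomotopy R.toBimodResolution φC)
    (hφD : IsCounitHomotopy T.toBimodResolution φD) (hf : IsCocycleX R T n f)
    (hf' : IsCocycleX R T m f') {p : ℕ} (hp : p + 1 ≠ n + m) {x : TwistedRes R T}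
    (hx : x ∈ grX R T p) : bracketX R T φC φD n m f f' x = 0 := by
  rw [bracketX, LinearMap.sub_apply, LinearMap.smul_apply,
    circX_eq_zero hφC hφD hf.1 hf'.1 hp hx,
    circX_eq_zero hφC hφD hf'.1 hf.1 (by rwa [add_comm m n]) hx, smul_zero, sub_zero]

/-- A cocycle of degree `n` on `X` is a cocycle of the parity of `n` on the diagonal complex `X`. -/
theorem IsCocycleX.isCocycle (hφC : IsCounitHomotopy R.toBimodResolution φC)
    (hφD : IsCounitHomotopy T.toBimodResolution φD)
    (hφ : ∀ (e : Env k (SkewMonoidAlgebra S G)) z,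
      phiX R T φC φD (e • z) = e • phiX R T φC φD z) (hf : IsCocycleX R T n f) :
    (twistedComplex R T hφC hφD hφ).IsCocycle n f where
  map_d := hf.2
  map_ε x := LinearMap.congr_fun (f := f.restrictScalars k ∘ₗ (sgnX R T).restrictScalars k)
    (g := (-1 : k) ^ n • f.restrictScalars k) (twistedRes_ext fun i j g c d hi hg hj => by
      change f (sgnX R T (TwistedProduct.mk _ _ c d)) = (-1 : k) ^ n • f (TwistedProduct.mk _ _ c d)
      have h : (TwistedProduct.mk _ _ c d : TwistedRes R T) ∈ grX R T (i + j) :=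
        mk_mem_grX hi hj rfl
      rw [sgnX_of_mem h, envMap_smul]
      by_cases hn : i + j = n
      · rw [hn]
      · rw [hf.1 _ hn _ h, smul_zero, smul_zero]) x

/-! ### Comparison maps -/

/-- A comparison map, as a function of words: its component of degree `n` is evaluated on words of
length `n`. -/
def BarComparison.onWords (θ : BarComparison R T) (w : List (SkewMonoidAlgebra S G)) :
    TwistedRes R T := ofFun (θ.toFun w.length) w

theorem BarComparison.onWords_ofFn (θ : BarComparison R T) (a : Fin n → SkewMonoidAlgebra S G) :
    θ.onWords (List.ofFn a) = θ.toFun n a := by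
  have h (l : ℕ) (hl : l = n) : ofFun (θ.toFun l) (List.ofFn a) = θ.toFun n a := by
    subst hl; exact ofFun_ofFn _ a
  exact h _ List.length_ofFn

theorem BarComparison.onWords_mem (θ : BarComparison R T) (w : List (SkewMonoidAlgebra S G)) :
    θ.onWords w ∈ grX R T w.length := by
  have := θ.isBarComparison.1 w.length w.get
  rwa [← θ.onWords_ofFn, List.ofFn_get] at this

theorem augX_of_mem_succ {x : TwistedRes R T} (hx : x ∈ grX R T (n + 1)) : augX R T x = 0 := by
  induction hx using Submodule.span_induction with
  | zero => rw [map_zero]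
  | add x y _ _ hx hy => rw [map_add, hx, hy, add_zero]
  | smul r x _ hx => rw [map_smul, hx, smul_zero]
  | mem x hx =>
    obtain ⟨i, j, c, d, hc, hd, h, rfl⟩ := hx
    rw [augX_mk]
    cases i with
    | succ i => rw [R.aug_pos i c hc]; simp
    | zero =>
      obtain rfl : j = n + 1 := by omega
      rw [T.aug_pos n d hd]; simp

theorem BarComparison.isComparison (hφC : IsCounitHomotopy R.toBimodResolution φC)
    (hφD : IsCounitHomotopy T.toBimodResolution φD)
    (hφ : ∀ (e : Env k (SkewMonoidAlgebra S G)) z,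
      phiX R T φC φD (e • z) = e • phiX R T φC φD z) (θ : BarComparison R T) :
    (twistedComplex R T hφC hφD hφ).IsComparison θ.onWords where
  multi u v := by
    have h' (w : List (SkewMonoidAlgebra S G)) (l : ℕ) (hl : w.length = l) :
        θ.onWords w = ofFun (θ.toFun l) w := by
      subst hl; rfl
    have h (x : SkewMonoidAlgebra S G) : θ.onWords (u ++ x :: v) =
        ofFun (θ.toFun (u ++ 0 :: v).length) (u ++ x :: v) := h' _ _ (by simp)
    simp only [h]
    exact multi_ofFun _ u v
  map_d w := by
    refine ext_ofFn (t := fun w => dX R T (θ.onWords w)) (fun n a => ?_) w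
    change dX R T (θ.onWords (List.ofFn a)) = _
    rw [θ.onWords_ofFn]
    cases n with
    | zero =>
      rw [dX_of_mem_zero (θ.isBarComparison.1 0 a), List.ofFn_zero, diff_nil]
    | succ n =>
      rw [θ.isBarComparison.2.1, diff_ofFn]
      simp only [θ.onWords_ofFn]
  map_ε w := sgnX_of_mem (θ.onWords_mem w)
  aug_nil := θ.isBarComparison.2.2 _
  aug_cons a w := augX_of_mem_succ (θ.onWords_mem (a :: w))

theorem hochD_mem_grX {t : (Fin n → SkewMonoidAlgebra S G) → TwistedRes R T} {p : ℕ}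
    (ht : ∀ a, t a ∈ grX R T p) (a : Fin (n + 1) → SkewMonoidAlgebra S G) :
    hochD k (SkewMonoidAlgebra S G) t a ∈ grX R T p :=
  add_mem (add_mem (lAct_mem_grX (ht _) _)
    (Submodule.sum_mem _ fun _ _ => Submodule.smul_mem _ _ (ht _)))
    (Submodule.smul_mem _ _ (rAct_mem_grX (ht _) _))

variable (R T) in
/-- A comparison map is constructed degree by degree with a homogeneous contraction of the twisted
product. -/
theorem nonempty_barComparison : Nonempty (BarComparison R T) := by
  obtain ⟨s, ν, hs, hν, hμν, hμs, hsd⟩ := exists_contractionX R T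
  let c : List (SkewMonoidAlgebra S G) → SkewMonoidAlgebra S G :=
    ofFun fun _ : Fin 0 → SkewMonoidAlgebra S G => 1
  have hc : Multi k c := multi_ofFun (MultilinearMap.constOfIsEmpty k _ 1)
  have hc' : diff k (SkewMonoidAlgebra S G) (SkewMonoidAlgebra S G) c = 0 := by
    rw [diff_ofFun]
    funext w
    refine ext_ofFn (fun n a => ?_) w
    by_cases hn : n = 1
    · subst hn
      rw [ofFun_ofFn, hochD, lAct_self, rAct_self]
      simp
    · exact ofFun_of_length_ne _ (by rwa [List.length_ofFn])
  -- for `κ = -1` and `η = 0` the equation of a null-homotopy `h` says that `h` is a chain map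
  obtain ⟨h, hm, hd, hμ, hh⟩ := exists_homotopy_of_section (d := dXHom R T) (μ := augXHom R T)
    (s := s) (σ := ν)
    (fun y h h' => by
      have := hsd y
      rw [show dX R T y = 0 from h, show augX R T y = 0 from h', map_zero, map_zero, add_zero,
        sub_zero] at this
      exact this)
    hμs (fun a => dX_of_mem_zero (hν a)) hμν (κ := -1) (η := 0) Multi.zero (by simp)
    hc (by intro w; rw [hc']; simp)
  have hmem : ∀ (n : ℕ) (a : Fin n → SkewMonoidAlgebra S G), h (List.ofFn a) ∈ grX R T n := by
    intro n
    induction n with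
    | zero =>
      intro a
      rw [hh, List.ofFn_zero, diff_nil]
      simpa using hν _
    | succ n ih =>
      intro a
      have h0 : c (List.ofFn a) = 0 := ofFun_of_length_ne _ (by simp)
      rw [hh, h0, map_zero, add_zero, diff_ofFn]
      simp only [Pi.zero_apply, neg_smul, one_smul, sub_neg_eq_add, zero_add]
      exact hs n _ (hochD_mem_grX ih a)
  refine ⟨⟨fun n => hm.toMultilinear n, hmem, fun n a => ?_, fun a => ?_⟩⟩
  · have := hd (List.ofFn a)
    rw [Pi.zero_apply, neg_one_smul, ← sub_eq_add_neg, sub_eq_zero, diff_ofFn] at this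
    exact this
  · exact hμ (List.ofFn a)

/-! ### Representing the Gerstenhaber bracket -/

/-- A cocycle on the twisted product, pulled back along a comparison map. -/
theorem IsCocycleX.comp_onWords (hf : IsCocycleX R T n f) (θ : BarComparison R T) :
    f ∘ θ.onWords = ofFun fun a => f (θ.toFun n a) := by
  funext w
  refine ext_ofFn (fun l a => ?_) w
  by_cases h : l = n
  · subst h
    rw [ofFun_ofFn, Function.comp_apply, θ.onWords_ofFn]
  · rw [ofFun_of_length_ne _ (by rwa [List.length_ofFn])]
    exact hf.1 l h _ (by rw [θ.onWords_ofFn]; exact θ.isBarComparison.1 l a)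

/-- If `F` represents the class of `f` via `θ`, it does so via every other comparison map `θ'`. -/
theorem SameClass.exists_diff (hφC : IsCounitHomotopy R.toBimodResolution φC)
    (hφD : IsCounitHomotopy T.toBimodResolution φD)
    (hφ : ∀ (e : Env k (SkewMonoidAlgebra S G)) z,
      phiX R T φC φD (e • z) = e • phiX R T φC φD z) (hf : IsCocycleX R T n f)
    (θ θ' : BarComparison R T) {F : (Fin n → SkewMonoidAlgebra S G) → SkewMonoidAlgebra S G}
    (hF : SameClass θ n f F) : ∃ H : List (SkewMonoidAlgebra S G) → SkewMonoidAlgebra S G,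
      Multi k H ∧ (∀ w, wsign k H w = (-1 : k) ^ (n + 1) • H w) ∧
        ofFun F = f ∘ θ'.onWords + diff k (SkewMonoidAlgebra S G) (SkewMonoidAlgebra S G) H := by
  obtain ⟨H₁, hH₁, hs₁, -, h₁⟩ := exists_of_isHochCoboundary hF
  obtain ⟨K, hK, hK'⟩ := (hf.isCocycle hφC hφD hφ).comparison_unique
    (θ.isComparison hφC hφD hφ) (θ'.isComparison hφC hφD hφ)
  -- the homotopy between the pullbacks is replaced by its component of degree `n - 1`
  obtain ⟨H₂, hH₂, hs₂, -, h₂⟩ := exists_of_isHochCoboundary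
    (F := fun a => f (θ.toFun n a) - f (θ'.toFun n a)) <| isHochCoboundary_of_diff hK fun a => by
      rw [← hK', θ.onWords_ofFn, θ'.onWords_ofFn]
  refine ⟨H₁ + H₂, hH₁.add hH₂, fun w => ?_, ?_⟩
  · have h1 := hs₁ w
    have h2 := hs₂ w
    rw [wsign] at h1 h2 ⊢
    rw [Pi.add_apply, smul_add, smul_add, h1, h2]
  · rw [map_add, ← h₁, ← h₂, hf.comp_onWords]
    funext w
    refine ext_ofFn (fun l a => ?_) w
    by_cases h : l = n
    · subst h
      simp only [Pi.add_apply, ofFun_ofFn]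
      abel
    · have h' : (List.ofFn a).length ≠ n := by rwa [List.length_ofFn]
      simp only [Pi.add_apply, ofFun_of_length_ne _ h', add_zero]

theorem gerstenhaberBracket_eq_bracket {A : Type*} [Ring A] [Algebra k A] {l : ℕ}
    (h : n + m = l + 1) (F : MultilinearMap k (fun _ : Fin n => A) A)
    (F' : MultilinearMap k (fun _ : Fin m => A) A) (a : Fin l → A) :
    gerstenhaberBracket k h F F' a =
      BarCochain.bracket k n m (ofFun F) (ofFun F') (List.ofFn a) := by
  rw [gerstenhaberBracket, BarCochain.bracket, Pi.sub_apply, Pi.smul_apply, insertion_ofFn h,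
    insertion_ofFn ((add_comm m n).trans h)]

end TwistedComplex

end

theorem mainTheorem1 {k G : Type*} [Field k] [Group G] [Finite G] [DecidableEq G]
    {C : Type*} [AddCommGroup C] [Module k C] [Module (Env k (MonoidAlgebra k G)) C]
    [IsScalarTower k (Env k (MonoidAlgebra k G)) C]
    {S : Type*} [Ring S] [Algebra k S] [MulSemiringAction G S] [SMulCommClass G k S]
    {D : Type*} [AddCommGroup D] [Module k D] [Module (Env k S) D]
    [IsScalarTower k (Env k S) D]
    (R : GroupGradedResolution k G C) (T : EquivariantResolution k G S D)
    (φC : BTensor k (MonoidAlgebra k G) C C →ₗ[Env k (MonoidAlgebra k G)] C)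
    (hφC : IsCounitHomotopy R.toBimodResolution φC)
    (φD : BTensor k S D D →ₗ[Env k S] D)
    (hφD : IsCounitHomotopy T.toBimodResolution φD) :
    -- Hochschild cohomology can be computed from `X`
    Nonempty (BarComparison R T) ∧
    -- `φ_X` is a map of bimodules if `φ_C` preserves the `G`-grading and `φ_D` is `G`-equivariant
    ((∀ g, ∀ z ∈ BTensor.degree k (MonoidAlgebra k G) (· * ·) (fun a => (R.comp a : Set C))
          (fun b => (R.comp b : Set C)) g, φC z ∈ R.comp g) →
      (∀ g w, φD (T.diag g w) = T.ρ g (φD w)) →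
      ∀ (e : Env k (SkewMonoidAlgebra S G)) z,
        phiX R T φC φD (e • z) = e • phiX R T φC φD z) ∧
    -- the bracket
    ((∀ (e : Env k (SkewMonoidAlgebra S G)) z,
        phiX R T φC φD (e • z) = e • phiX R T φC φD z) →
      ∀ (n m l : ℕ) (h : n + m = l + 1)
        (f f' : TwistedRes R T →ₗ[Env k (SkewMonoidAlgebra S G)] SkewMonoidAlgebra S G),
        IsCocycleX R T n f → IsCocycleX R T m f' →
        ∃ b : TwistedRes R T →ₗ[Env k (SkewMonoidAlgebra S G)] SkewMonoidAlgebra S G,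
          b.restrictScalars k = bracketX R T φC φD n m f f' ∧
          IsCocycleX R T l b ∧
          ∀ (θ₁ θ₂ θ₃ : BarComparison R T)
            (F : MultilinearMap k (fun _ : Fin n => SkewMonoidAlgebra S G)
              (SkewMonoidAlgebra S G))
            (F' : MultilinearMap k (fun _ : Fin m => SkewMonoidAlgebra S G)
              (SkewMonoidAlgebra S G)),
            SameClass θ₁ n f F → SameClass θ₂ m f' F' →
              SameClass θ₃ l b (gerstenhaberBracket k h F F')) := by
  refine ⟨nonempty_barComparison R T, phiX_env_smul, fun hφ n m l h f f' hf hf' => ?_⟩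
  let P := twistedComplex R T hφC hφD hφ
  have hPf : P.IsCocycle n f := hf.isCocycle hφC hφD hφ
  have hPf' : P.IsCocycle m f' := hf'.isCocycle hφC hφD hφ
  -- all three comparison maps are replaced by `θ₃`, along which the bracket is compared
  refine ⟨P.bracket n m f f', LinearMap.ext (twistedComplex_bracket hφC hφD hφ n m f f'),
    ⟨fun p hp x hx => ?_, hPf.bracket_d hPf'⟩, fun θ₁ θ₂ θ₃ F F' hF hF' => ?_⟩
  · exact (twistedComplex_bracket hφC hφD hφ n m f f' x).trans
      (bracketX_eq_zero hφC hφD hf hf' (by omega) hx)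
  · obtain ⟨H, hH, hHs, hFH⟩ := hF.exists_diff hφC hφD hφ hf θ₁ θ₃
    obtain ⟨H', hH', hHs', hFH'⟩ := hF'.exists_diff hφC hφD hφ hf' θ₂ θ₃
    obtain ⟨K, hK, hK'⟩ := hPf.bracket_represents hPf' (θ₃.isComparison hφC hφD hφ)
      (BarCochain.multi_ofFun F) (BarCochain.wsign_ofFun _) hH hHs hFH hH' hHs' hFH'
    exact BarCochain.isHochCoboundary_of_diff hK fun a => by
      rw [← hK', gerstenhaberBracket_eq_bracket, θ₃.onWords_ofFn]
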